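/- Let $N\ge 1$ and let $E$ be a real $N\times N$ matrix all of whose complex eigenvalues have real part greater than $1$; let $E'$ be its transpose, $Q=\operatorname{trace}(E)$, and $c^E=\exp((\ln c)E)$ for $c>0$. Let $\|\cdot\|_E$ be a norm on $\mathbb R^N$, with unit sphere $S_E=\{x:\|x\|_E=1\}$, such that $(r,\theta)\mapsto r^E\theta$ is a homeomorphism of $(0,\infty)\times S_E$ onto $\mathbb R^N\setminus\{0\}$. For $x\neq 0$ let $\tau_E(x)>0$ be the unique number with $x=\tau_E(x)^E\theta$ for some $\theta\in S_E$, and let $\tau_E(0)=0$. Let $\psi:\mathbb R^N\to[0,\infty)$ be continuous and symmetric ($\psi(-x)=\psi(x)$), with $\psi(x)>0$ and $\psi(r^{E'}x)=r\,\psi(x)$ for all $r>0$, $x\ne0$. Let $\widetilde{\mathcal M}$ be a centered complex-valued Gaussian random measure on $\mathbb R^N$ with Lebesgue control measure $m_N$, that is, a centered complex-valued Gaussian process (real and imaginary parts jointly Gaussian) indexed by the measurable sets of finite Lebesgue measure, with $\mathbb E\big(\widetilde{\mathcal M}(A)\overline{\widetilde{\mathcal M}(B)}\big)=m_N(A\cap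 B)$ and, almost surely, $\widetilde{\mathcal M}(-A)=\overline{\widetilde{\mathcal M}(A)}$. Let $X=\{X(t),t\in\mathbb R^N\}$ be a separable version of the real-valued Gaussian random field $$X(t)=\operatorname{Re}\int_{\mathbb R^N}\big(e^{\mathrm i\langle t,\xi\rangle}-1\big)\,\frac{\widetilde{\mathcal M}(d\xi)}{\psi(\xi)^{1+Q/2}},\qquad t\in\mathbb R^N,$$ where the integral is the Wiener integral (the $L^2$-limit of integrals of simple functions); separable means that there is a countable set $S\subset\mathbb R^N$ such that, almost surely, for every $t$ the point $(t,X(t))$ lies in the closure of $\{(s,X(s)):s\in S\}$ (for example, $X$ has continuous sample paths). Write $\log x=\ln(\max(x,e))$. Then there is a constant $C_6\in(0,\infty)$, depending only on $E$, $\|\cdot\|_E$ and $\psi$, such that almost surely $$\lim_{r\to0+}\ \sup_{\substack{s,t\in[0,1]^N,\ s\ne t\\ \tau_E(s-t)\le r}}\ \frac{|X(s)-X(t)|}{\tau_E(s-t)\sqrt{\log\big(1+\tau_E(s-t)^{-1}\big)}}=C_6 .$$ -/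

import Mathlib

open MeasureTheory ProbabilityTheory Filter Topology Set
open scoped ENNReal ComplexConjugate Matrix Pointwise RealInnerProductSpace

noncomputable section

namespace OperatorScaling

/-- The parameter space `ℝ^N` with its Euclidean norm. -/
abbrev Space (N : ℕ) : Type := EuclideanSpace ℝ (Fin N)

/-- The matrix power `c ^ E = exp ((ln c) E)`, for `c > 0`. -/
def matPow {N : ℕ} (c : ℝ) (E : Matrix (Fin N) (Fin N) ℝ) : Matrix (Fin N) (Fin N) ℝ :=
  NormedSpace.exp (Real.log c • E)

/-- The action `x ↦ c ^ E x` on `ℝ^N`. -/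
def powAct {N : ℕ} (E : Matrix (Fin N) (Fin N) ℝ) (c : ℝ) (x : Space N) : Space N :=
  Matrix.toEuclideanLin (matPow c E) x

theorem powAct_ne_zero {N : ℕ} (E : Matrix (Fin N) (Fin N) ℝ) (c : ℝ) {x : Space N}
    (hx : x ≠ 0) : powAct E c x ≠ 0 := by
  intro h
  apply hx
  have h1 : matPow (N := N) c E *ᵥ x.ofLp = 0 := by
    have := congrArg WithLp.ofLp h
    simpa [powAct, Matrix.toEuclideanLin] using this
  have hu : IsUnit (matPow c E) := Matrix.isUnit_exp (Real.log c • E)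
  have h2 : x.ofLp = 0 := by
    apply Matrix.mulVec_injective_of_isUnit hu
    simpa using h1
  ext i
  simpa using congrFun h2 i

/-- All eigenvalues of `E` (over `ℂ`) have real part greater than `1`. -/
def EigenvaluesGtOne {N : ℕ} (E : Matrix (Fin N) (Fin N) ℝ) : Prop :=
  ∀ z ∈ spectrum ℂ (E.map Complex.ofReal), 1 < z.re

/-- The unit sphere of a norm `p` on `ℝ^N`. -/
abbrev UnitSphere {N : ℕ} (p : Seminorm ℝ (Space N)) : Type := {θ : Space N // p θ = 1}

/-- The polar map `Ψ (r, θ) = r ^ E θ` from `(0, ∞) × S_E` to `ℝ^N \ {0}`. -/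
def polarMap {N : ℕ} (E : Matrix (Fin N) (Fin N) ℝ) (p : Seminorm ℝ (Space N)) :
    Ioi (0 : ℝ) × UnitSphere p → {x : Space N // x ≠ 0} := fun y =>
  ⟨powAct E y.1.1 y.2.1, powAct_ne_zero E y.1.1 (by
    intro h
    have h1 := y.2.2
    rw [h, map_zero] at h1
    exact zero_ne_one h1)⟩

/-- A norm `‖·‖_E` on `ℝ^N` adapted to `E`: the associated polar map is a homeomorphism of
`(0, ∞) × S_E` onto `ℝ^N \ {0}`. -/
structure PolarNorm {N : ℕ} (E : Matrix (Fin N) (Fin N) ℝ) where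
  /-- the norm -/
  norm : Seminorm ℝ (Space N)
  /-- a norm, not only a seminorm -/
  definite : ∀ x, norm x = 0 → x = 0
  /-- polar coordinates exist, are unique and are continuous -/
  isHomeomorph : IsHomeomorph (polarMap E norm)

open Classical in
/-- The radial part `τ_E(x)`: for `x ≠ 0` the first component of `Ψ⁻¹ x`, and `τ_E(0) = 0`. -/
def PolarNorm.tau {N : ℕ} {E : Matrix (Fin N) (Fin N) ℝ} (p : PolarNorm E) (x : Space N) : ℝ :=
  if h : x ≠ 0 then (p.isHomeomorph.homeomorph.symm ⟨x, h⟩).1.1 else 0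

/-- `ψ : ℝ^N → [0, ∞)` is continuous, symmetric and `E'`-homogeneous, where `E'` is the
transpose of `E`. -/
structure IsAdmissible {N : ℕ} (E : Matrix (Fin N) (Fin N) ℝ) (ψ : Space N → ℝ) : Prop where
  continuous : Continuous ψ
  nonneg : ∀ x, 0 ≤ ψ x
  pos : ∀ x, x ≠ 0 → 0 < ψ x
  homogeneous : ∀ r : ℝ, 0 < r → ∀ x, x ≠ 0 → ψ (powAct E.transpose r x) = r * ψ x
  symmetric : ∀ x, ψ (-x) = ψ x

/-- The measurable subsets of `ℝ^N` of finite Lebesgue measure. -/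
abbrev FiniteSets (N : ℕ) : Type := {A : Set (Space N) // MeasurableSet A ∧ volume A < ∞}

/-- `M` is a centered complex-valued Gaussian random measure on `ℝ^N` with Lebesgue control
measure and the Hermitian symmetry `M(-A) = conj M(A)`. Only the values of `M` on measurable sets
of finite Lebesgue measure matter. Complex-valued Gaussian means that real and imaginary parts
are jointly Gaussian: `ℂ` is treated as a real vector space. -/
structure IsGaussianRandomMeasure {N : ℕ} {Ω : Type*} [MeasurableSpace Ω] (P : Measure Ω)
    (M : Set (Space N) → Ω → ℂ) : Prop where
  gaussian : IsGaussianProcess (fun A : FiniteSets N => M A.1) P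
  centered : ∀ A : FiniteSets N, ∫ ω, M A.1 ω ∂P = 0
  covariance : ∀ A B : FiniteSets N,
    ∫ ω, M A.1 ω * conj (M B.1 ω) ∂P = ((volume (A.1 ∩ B.1)).toReal : ℂ)
  hermitian : ∀ A : FiniteSets N, M (-A.1) =ᵐ[P] fun ω => conj (M A.1 ω)

/-- The integral `∑ z M(φ = z)` of a simple function `φ` with respect to `M`. -/
def simpleIntegral {N : ℕ} {Ω : Type*} (M : Set (Space N) → Ω → ℂ)
    (φ : SimpleFunc (Space N) ℂ) (ω : Ω) : ℂ :=
  ∑ z ∈ φ.range, z * M (φ ⁻¹' {z}) ω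

/-- `Z` is (a version of) the Wiener integral `∫ f dM`: the limit in `L²(P)` of the integrals of
square-integrable simple functions that converge to `f` in `L²(ℝ^N)`. -/
def IsWienerIntegral {N : ℕ} {Ω : Type*} [MeasurableSpace Ω] (P : Measure Ω)
    (M : Set (Space N) → Ω → ℂ) (f : Space N → ℂ) (Z : Ω → ℂ) : Prop :=
  MemLp Z 2 P ∧ ∃ φ : ℕ → SimpleFunc (Space N) ℂ,
    (∀ n, MemLp (φ n) 2 (volume : Measure (Space N))) ∧
    Tendsto (fun n => eLpNorm (fun ξ => φ n ξ - f ξ) 2 (volume : Measure (Space N)))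
      atTop (𝓝 0) ∧
    Tendsto (fun n => eLpNorm (fun ω => simpleIntegral M (φ n) ω - Z ω) 2 P) atTop (𝓝 0)

/-- The harmonizable kernel `ξ ↦ (e^{i⟨t,ξ⟩} - 1) / ψ(ξ)^{1+Q/2}`, with `Q = trace E`. -/
def kernel {N : ℕ} (E : Matrix (Fin N) (Fin N) ℝ) (ψ : Space N → ℝ) (t ξ : Space N) : ℂ :=
  (Complex.exp (Complex.I * ((⟪t, ξ⟫ : ℝ) : ℂ)) - 1) / ((ψ ξ ^ (1 + E.trace / 2) : ℝ) : ℂ)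

/-- `X` is the random field `X(t) = Re ∫ (e^{i⟨t,ξ⟩} - 1) ψ(ξ)^{-1-Q/2} M(dξ)`, each `X(t)` being
determined almost surely. -/
def IsHarmonizableField {N : ℕ} {Ω : Type*} [MeasurableSpace Ω] (P : Measure Ω)
    (E : Matrix (Fin N) (Fin N) ℝ) (ψ : Space N → ℝ) (M : Set (Space N) → Ω → ℂ)
    (X : Space N → Ω → ℝ) : Prop :=
  ∀ t, ∃ Z : Ω → ℂ, IsWienerIntegral P M (kernel E ψ t) Z ∧ X t =ᵐ[P] fun ω => (Z ω).re

/-- Separability of a random field in the sense of Doob: almost surely, every value `X(t)` is a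
limit of values `X(sₙ)` with `sₙ → t` in a fixed countable set of parameters. Every random
field with continuous sample paths is separable. -/
def IsSeparable {N : ℕ} {Ω : Type*} [MeasurableSpace Ω] (P : Measure Ω)
    (X : Space N → Ω → ℝ) : Prop :=
  ∃ S : Set (Space N), S.Countable ∧
    ∀ᵐ ω ∂P, ∀ t, (t, X t ω) ∈ closure ((fun s => (s, X s ω)) '' S)

/-- The convention `log x = ln (x ∨ e)`. -/
def log' (x : ℝ) : ℝ := Real.log (max x (Real.exp 1))

/-- The cube `I = [0,1]^N`. -/
def cube (N : ℕ) : Set (Space N) := {t | ∀ i, t i ∈ Icc (0 : ℝ) 1}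

/-- The supremum, in `[0, ∞]`, of `|x(s) - x(t)| / (τ(s-t) √(log(1 + τ(s-t)⁻¹)))` over distinct
points `s, t` of the cube with `τ(s-t) ≤ r`. -/
def modulus {N : ℕ} (τ : Space N → ℝ) (x : Space N → ℝ) (r : ℝ) : ℝ≥0∞ :=
  ⨆ (s ∈ cube N) (t ∈ cube N) (_ : s ≠ t) (_ : τ (s - t) ≤ r),
    ENNReal.ofReal (|x s - x t| / (τ (s - t) * √(log' (1 + (τ (s - t))⁻¹))))

end OperatorScaling

end

/-!
Write `K_t` for the harmonizable kernel and `σ(t) = ‖K_t‖_{L²}` (`sd`). The field `X` is a centered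
Gaussian process whose increments satisfy `E (X(s) - X(t))² = σ(s - t)²`, and the covariance of two
increments of the same lag `h` at `s` and `s'` is `∫ ‖K_h(ξ)‖² cos ⟪s - s', ξ⟫ dξ`
(`IsHarmonizableField.gaussian`, `inner_increments`). The square integrability of `K_t` is part of
the existence of the Wiener integral that defines `X(t)`. The homogeneity of `ψ` gives
`σ(r ^ E x) = r σ(x)`; hence `σ` is comparable with `τ_E`, is a continuous subadditive function, and
is bounded above by a power of the Euclidean norm near the origin.

*Upper bound.* The Hölder bound on `σ` yields nets of exponential size at the scales `2⁻ⁿ`, and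
chaining (`HasGaussianIncrements.exists_modulus`) bounds the increments over `σ`-distance `2⁻ⁿ` by
a multiple of `2⁻ⁿ √(n+1)`, first on a separant, then by separability on the cube. In particular
the modulus is bounded for small `r`, and `X` is continuous on the cube.

*The limit is constant.* By continuity, the modulus may be computed over pairs from a countable
dense set. The normalized increments over `τ_E`-distance at most `r` have variance of order
`1 / log(1/r)`, which tends to zero. The supremum of a Gaussian family over an arbitrary number of
indices has fluctuations of the order of the largest standard deviation only
(`integral_abs_norm_sub_norm_le`), so the limit of the suprema as `r → 0` is almost surely constant
(`exists_ae_iInf_iSup_eq`). The constant depends on the law of the normalized increments alone,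
hence on the covariance (`IsHarmonizableField.map_ratio_eq`); it is the same for all fields `X`.

*Lower bound.* For small `r` there is a lag `h = r ^ E x` with `‖h‖ ≤ r`, and increments of lag `h`
at points at distance at least `√r` have correlations at most `1/2`, by the Riemann–Lebesgue lemma
(`exists_correlation_le`). The cube holds about `r ^ (-1/2)` such points. The largest of `n`
standard Gaussian variables with correlations at most `1/2` is at least `√(log n) / 6` with probability at
least `1/4` (`measure_forall_abs_le_sqrt_log_le`), so that the modulus stays above a positive
constant with probability at least `1/4` along a sequence of radii, and the limit is positive.
-/

noncomputable section

namespace OperatorScaling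

/-! ### The action of the one-parameter group -/

section

section DetExp

open scoped Matrix.Norms.Operator

/-- To first order `exp (t A)` is `1 + t A`, whose determinant is a polynomial in `t`. -/
theorem hasDerivAt_det_exp_smul {n : Type*} [Fintype n] [DecidableEq n] (A : Matrix n n ℝ) :
    HasDerivAt (fun t : ℝ => (NormedSpace.exp (t • A)).det) A.trace 0 := by
  have hdet : DifferentiableAt ℝ (fun B : Matrix n n ℝ => B.det) 1 := by
    simp only [Matrix.det_apply]
    have hij : ∀ i j : n, DifferentiableAt ℝ (fun B : Matrix n n ℝ => B i j) 1 := fun i j =>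
      (LinearMap.toContinuousLinearMap (Matrix.entryLinearMap ℝ ℝ i j)).differentiableAt
    fun_prop (disch := intros; apply hij)
  have h1 : HasDerivAt (fun t : ℝ => NormedSpace.exp (t • A)) A 0 := by
    have h := hasDerivAt_exp_smul_const (𝕂 := ℝ) A (0 : ℝ)
    rw [zero_smul, NormedSpace.exp_zero, one_mul] at h
    exact h
  have h2 : HasDerivAt (fun t : ℝ => 1 + t • A) A 0 := by
    have h := ((hasDerivAt_id (0 : ℝ)).smul_const A).const_add (1 : Matrix n n ℝ)
    rw [one_smul] at h
    exact h
  have e1 : HasDerivAt (fun t : ℝ => (NormedSpace.exp (t • A)).det)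
      (fderiv ℝ (fun B : Matrix n n ℝ => B.det) 1 A) 0 := by
    have h := hdet.hasFDerivAt
    have h0 : (1 : Matrix n n ℝ) = NormedSpace.exp ((0 : ℝ) • A) := by
      rw [zero_smul, NormedSpace.exp_zero]
    rw [h0] at h ⊢
    exact HasFDerivAt.comp_hasDerivAt (f := fun t : ℝ => NormedSpace.exp (t • A)) 0 h h1
  have e2 : HasDerivAt (fun t : ℝ => (1 + t • A).det)
      (fderiv ℝ (fun B : Matrix n n ℝ => B.det) 1 A) 0 := by
    have h : HasFDerivAt (fun B : Matrix n n ℝ => B.det)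
        (fderiv ℝ (fun B : Matrix n n ℝ => B.det) 1) (1 + (0 : ℝ) • A) := by
      rw [zero_smul, add_zero]
      exact hdet.hasFDerivAt
    exact HasFDerivAt.comp_hasDerivAt (f := fun t : ℝ => 1 + t • A) 0 h h2
  have e3 : HasDerivAt (fun t : ℝ => (1 + t • A).det) A.trace 0 := by
    have hd : (fun t : ℝ => (1 + t • A).det) = _ := funext fun t => Matrix.det_one_add_smul t A
    rw [hd]
    set q := (Matrix.det (1 + (Polynomial.X : Polynomial ℝ) • A.map Polynomial.C)).divX.divX
    have h := (((hasDerivAt_id (0 : ℝ)).const_mul A.trace).const_add 1).add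
      ((q.hasDerivAt 0).mul ((hasDerivAt_id (0 : ℝ)).pow 2))
    simp only [mul_one, id_eq, ne_eq, OfNat.ofNat_ne_zero, not_false_eq_true, zero_pow, mul_zero,
      Pi.pow_apply, Nat.cast_ofNat, Nat.add_one_sub_one, pow_one, add_zero] at h
    exact h
  rwa [e2.unique e3] at e1

/-- Jacobi's formula in integrated form. -/
theorem det_exp {n : Type*} [Fintype n] [DecidableEq n] (A : Matrix n n ℝ) :
    (NormedSpace.exp A).det = Real.exp A.trace := by
  set f : ℝ → ℝ := fun t => (NormedSpace.exp (t • A)).det with hf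
  have hmul : ∀ s t, f (s + t) = f s * f t := fun s t => by
    simp only [hf, add_smul]
    rw [Matrix.exp_add_of_commute _ _ ((Commute.refl A).smul_left s |>.smul_right t),
      Matrix.det_mul]
  have hder : ∀ t, HasDerivAt f (f t * A.trace) t := fun t => by
    have h0 : HasDerivAt (fun u : ℝ => f t * f (u - t)) (f t * A.trace) t := by
      refine HasDerivAt.const_mul _ ?_
      have h := hasDerivAt_det_exp_smul A
      rw [← sub_self t] at h
      exact h.comp_sub_const t t
    refine h0.congr_of_eventuallyEq (Eventually.of_forall fun u => ?_)
    show f u = f t * f (u - t)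
    rw [← hmul]; congr 1; ring
  have hconst : ∀ t, HasDerivAt (fun t => f t * Real.exp (-(t * A.trace))) 0 t := fun t => by
    have := (hder t).mul (((hasDerivAt_id t).mul_const A.trace).neg.exp)
    exact this.congr_deriv (by simp only [id_eq]; ring)
  have h := is_const_of_deriv_eq_zero (fun t => (hconst t).differentiableAt)
    (fun t => (hconst t).deriv) 1 0
  simp only [hf, one_smul, one_mul, zero_smul, zero_mul, neg_zero, Real.exp_zero,
    mul_one, NormedSpace.exp_zero, Matrix.det_one, Real.exp_neg] at h
  field_simp at h
  exact h

end DetExp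

variable {N : ℕ} {E : Matrix (Fin N) (Fin N) ℝ}

theorem matPow_mul (E : Matrix (Fin N) (Fin N) ℝ) {a b : ℝ} (ha : 0 < a) (hb : 0 < b) :
    matPow (a * b) E = matPow a E * matPow b E := by
  simp only [matPow]
  rw [Real.log_mul ha.ne' hb.ne', add_smul, Matrix.exp_add_of_commute _ _
    ((Commute.refl E).smul_left _ |>.smul_right _)]

theorem powAct_mul (E : Matrix (Fin N) (Fin N) ℝ) {a b : ℝ} (ha : 0 < a) (hb : 0 < b)
    (x : Space N) : powAct E (a * b) x = powAct E a (powAct E b x) := by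
  simp [powAct, matPow_mul E ha hb, Matrix.toEuclideanLin]

theorem powAct_one (E : Matrix (Fin N) (Fin N) ℝ) (x : Space N) : powAct E 1 x = x := by
  simp [powAct, matPow, Matrix.toEuclideanLin]

theorem powAct_inv_powAct (E : Matrix (Fin N) (Fin N) ℝ) {r : ℝ} (hr : 0 < r) (x : Space N) :
    powAct E r⁻¹ (powAct E r x) = x := by
  rw [← powAct_mul E (inv_pos.2 hr) hr, inv_mul_cancel₀ hr.ne', powAct_one]

theorem powAct_powAct_inv (E : Matrix (Fin N) (Fin N) ℝ) {r : ℝ} (hr : 0 < r) (x : Space N) :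
    powAct E r (powAct E r⁻¹ x) = x := by
  rw [← powAct_mul E hr (inv_pos.2 hr), mul_inv_cancel₀ hr.ne', powAct_one]

theorem matPow_transpose (E : Matrix (Fin N) (Fin N) ℝ) (r : ℝ) :
    matPow r Eᵀ = (matPow r E)ᵀ := by
  rw [matPow, matPow, ← Matrix.transpose_smul, Matrix.exp_transpose]

theorem inner_powAct (E : Matrix (Fin N) (Fin N) ℝ) (r : ℝ) (x y : Space N) :
    ⟪powAct E r x, y⟫ = ⟪x, powAct Eᵀ r y⟫ := by
  simp only [powAct, matPow_transpose, PiLp.inner_apply, Matrix.toEuclideanLin]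
  simp only [RCLike.inner_apply, conj_trivial]
  have := Matrix.dotProduct_mulVec y.ofLp (matPow r E) x.ofLp
  simp only [← Matrix.mulVec_transpose] at this
  simpa [dotProduct, mul_comm] using this

theorem det_matPow_transpose (E : Matrix (Fin N) (Fin N) ℝ) {r : ℝ} (hr : 0 < r) :
    (matPow r Eᵀ).det = r ^ E.trace := by
  rw [matPow, det_exp, Matrix.trace_smul, Matrix.trace_transpose, Real.rpow_def_of_pos hr,
    smul_eq_mul]

/-- Change of variables `ξ = r ^ Eᵀ η`. -/
theorem integral_comp_powAct_transpose (E : Matrix (Fin N) (Fin N) ℝ) {r : ℝ} (hr : 0 < r)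
    (g : Space N → ℝ) :
    ∫ ξ, g (powAct Eᵀ r ξ) = (r ^ E.trace)⁻¹ * ∫ ξ, g ξ := by
  have hdet : LinearMap.det (Matrix.toEuclideanLin (matPow r Eᵀ)) = r ^ E.trace := by
    rw [← det_matPow_transpose E hr]
    rw [Matrix.toEuclideanLin_eq_toLin_orthonormal, LinearMap.det_toLin]
  have hpos : 0 < r ^ E.trace := Real.rpow_pos_of_pos hr _
  have hmap := Measure.map_linearMap_addHaar_eq_smul_addHaar (volume : Measure (Space N))
    (f := Matrix.toEuclideanLin (matPow r Eᵀ)) (by rw [hdet]; exact hpos.ne')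
  have hemb : MeasurableEmbedding (powAct Eᵀ r) := by
    have h1 : Function.LeftInverse (powAct Eᵀ r⁻¹) (powAct Eᵀ r) := powAct_inv_powAct _ hr
    have h2 : Function.RightInverse (powAct Eᵀ r⁻¹) (powAct Eᵀ r) := powAct_powAct_inv _ hr
    have hc : ∀ c, Continuous (powAct Eᵀ c : Space N → Space N) := fun c =>
      LinearMap.continuous_of_finiteDimensional _
    exact (Homeomorph.mk ⟨_, _, h1, h2⟩ (hc _) (hc _)).measurableEmbedding
  have h := hemb.integral_map (μ := volume) g
  rw [← h]
  have : (volume : Measure (Space N)).map (powAct Eᵀ r)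
      = ENNReal.ofReal (r ^ E.trace)⁻¹ • volume := by
    have := hmap
    rw [hdet, abs_of_pos (inv_pos.2 hpos)] at this
    exact this
  rw [this, integral_smul_measure, ENNReal.toReal_ofReal (inv_pos.2 hpos).le, smul_eq_mul]

end

/-! ### Polar coordinates -/

section

variable {N : ℕ} {E : Matrix (Fin N) (Fin N) ℝ}

section NormBound

open scoped Matrix.Norms.L2Operator

theorem norm_powAct_le (E : Matrix (Fin N) (Fin N) ℝ) :
    ∃ b : ℕ, 1 ≤ b ∧ ∀ c : ℝ, ∀ x : Space N,
      ‖powAct E c x‖ ≤ Real.exp (|Real.log c| * b) * ‖x‖ := by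
  rcases isEmpty_or_nonempty (Fin N) with h | h
  · refine ⟨1, le_rfl, fun c x => ?_⟩
    have : Subsingleton (Space N) := inferInstance
    rw [Subsingleton.elim (powAct E c x) 0, Subsingleton.elim x 0]
    simp
  obtain ⟨b, hb⟩ := exists_nat_ge (max ‖E‖ 1)
  refine ⟨b, by exact_mod_cast (le_max_right _ _).trans hb, fun c x => ?_⟩
  have h1 : ‖powAct E c x‖ ≤ ‖matPow c E‖ * ‖x‖ := Matrix.l2_opNorm_mulVec (matPow c E) x
  refine h1.trans (mul_le_mul_of_nonneg_right ?_ (norm_nonneg _))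
  have h2 : ‖NormedSpace.exp (Real.log c • E)‖ ≤ Real.exp ‖Real.log c • E‖ := by
    have hs := NormedSpace.norm_expSeries_summable' (𝕂 := ℝ) (Real.log c • E)
    have hle : ∀ n : ℕ, ‖((n.factorial : ℝ)⁻¹) • (Real.log c • E) ^ n‖
        ≤ ((n.factorial : ℝ)⁻¹) • ‖Real.log c • E‖ ^ n := fun n => by
      rw [norm_smul, norm_inv, RCLike.norm_natCast, smul_eq_mul]
      exact mul_le_mul_of_nonneg_left (norm_pow_le _ n) (by positivity)
    rw [NormedSpace.exp_eq_tsum ℝ, Real.exp_eq_exp_ℝ, NormedSpace.exp_eq_tsum ℝ]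
    exact (norm_tsum_le_tsum_norm hs).trans
      (hs.tsum_le_tsum hle (NormedSpace.expSeries_summable' (𝕂 := ℝ) _))
  refine h2.trans (Real.exp_le_exp.2 ?_)
  rw [norm_smul, Real.norm_eq_abs]
  exact mul_le_mul_of_nonneg_left ((le_max_left _ _).trans hb) (abs_nonneg _)

theorem continuousOn_powAct (E : Matrix (Fin N) (Fin N) ℝ) (x : Space N) :
    ContinuousOn (fun r : ℝ => powAct E r x) (Ioi 0) := by
  have h1 : ContinuousOn (fun r : ℝ => matPow r E) (Ioi 0) := by
    let _ : NormedAlgebra ℚ (Matrix (Fin N) (Fin N) ℝ) := NormedAlgebra.restrictScalars ℚ ℝ _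
    refine (NormedSpace.exp_continuous (𝔸 := Matrix (Fin N) (Fin N) ℝ)).comp_continuousOn ?_
    exact (Real.continuousOn_log.mono fun r hr => (ne_of_gt hr)).smul continuousOn_const
  have h2 : Continuous fun A : Matrix (Fin N) (Fin N) ℝ => Matrix.toEuclideanLin A x := by
    simp only [Matrix.toEuclideanLin]
    show Continuous fun A : Matrix (Fin N) (Fin N) ℝ => WithLp.toLp 2 (A *ᵥ x.ofLp)
    fun_prop
  exact h2.comp_continuousOn h1

end NormBound

namespace PolarNorm

variable (p : PolarNorm E)

theorem tau_zero : p.tau 0 = 0 := by simp [tau]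

theorem tau_spec {x : Space N} (hx : x ≠ 0) :
    0 < p.tau x ∧ ∃ θ, p.norm θ = 1 ∧ powAct E (p.tau x) θ = x := by
  set y := p.isHomeomorph.homeomorph.symm ⟨x, hx⟩ with hy
  have hτ : p.tau x = y.1.1 := by simp [tau, hx, hy]
  have h := p.isHomeomorph.homeomorph.apply_symm_apply ⟨x, hx⟩
  have h' : powAct E y.1.1 y.2.1 = x := congrArg Subtype.val h
  rw [hτ]
  exact ⟨y.1.2, y.2.1, y.2.2, h'⟩

theorem tau_pos {x : Space N} (hx : x ≠ 0) : 0 < p.tau x := (p.tau_spec hx).1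

theorem tau_nonneg (x : Space N) : 0 ≤ p.tau x := by
  by_cases hx : x = 0
  · simp [hx, tau_zero]
  · exact (p.tau_pos hx).le

theorem ne_zero_of_norm_eq_one {θ : Space N} (hθ : p.norm θ = 1) : θ ≠ 0 := by
  rintro rfl
  simp at hθ

theorem tau_powAct_of_norm_eq_one {θ : Space N} (hθ : p.norm θ = 1) {r : ℝ} (hr : 0 < r) :
    p.tau (powAct E r θ) = r := by
  have hx := powAct_ne_zero E r (p.ne_zero_of_norm_eq_one hθ)
  have h : p.isHomeomorph.homeomorph.symm ⟨powAct E r θ, hx⟩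
      = ((⟨r, hr⟩ : Ioi (0 : ℝ)), (⟨θ, hθ⟩ : UnitSphere p.norm)) :=
    (Homeomorph.symm_apply_eq _).2 rfl
  simp [tau, hx, h]

theorem tau_powAct {x : Space N} (hx : x ≠ 0) {r : ℝ} (hr : 0 < r) :
    p.tau (powAct E r x) = r * p.tau x := by
  obtain ⟨h, θ, hθ, hθx⟩ := p.tau_spec hx
  have := p.tau_powAct_of_norm_eq_one hθ (mul_pos hr h)
  rwa [powAct_mul E hr h, hθx] at this

theorem continuousAt_tau {x : Space N} (hx : x ≠ 0) : ContinuousAt p.tau x := by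
  have hcont : Continuous fun y : {x : Space N // x ≠ 0} => p.tau y.1 := by
    have : (fun y : {x : Space N // x ≠ 0} => p.tau y.1)
        = fun y => (p.isHomeomorph.homeomorph.symm y).1.1 := by
      ext y
      simp [tau, y.2]
    rw [this]
    fun_prop
  have ho : IsOpen {x : Space N | x ≠ 0} := isOpen_ne
  exact (continuousOn_iff_continuous_domRestrict.2 hcont).continuousAt (ho.mem_nhds hx)

theorem continuous_norm : Continuous p.norm := by
  have h := p.norm.convexOn.continuousOn isOpen_univ
  exact continuousOn_univ.1 h

theorem isCompact_sphere : IsCompact {θ : Space N | p.norm θ = 1} := by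
  rcases isEmpty_or_nonempty (Fin N) with h | h
  · exact (Set.toFinite _).isCompact
  obtain ⟨x, hx, hmin⟩ := (_root_.isCompact_sphere (0 : Space N) 1).exists_isMinOn
    (NormedSpace.sphere_nonempty.2 zero_le_one) p.continuous_norm.continuousOn
  have hpos : 0 < p.norm x := by
    refine lt_of_le_of_ne (apply_nonneg _ _) fun h0 => ?_
    rw [p.definite x h0.symm] at hx
    simp at hx
  refine Metric.isCompact_of_isClosed_isBounded
    (isClosed_eq p.continuous_norm continuous_const)
    (Metric.isBounded_closedBall (x := (0 : Space N)) (r := (p.norm x)⁻¹) |>.subset fun θ hθ => ?_)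
  have hθ0 := p.ne_zero_of_norm_eq_one hθ
  have hn : 0 < ‖θ‖ := norm_pos_iff.2 hθ0
  have h1 : p.norm x ≤ p.norm (‖θ‖⁻¹ • θ) := hmin (by simp [norm_smul, hn.ne'])
  rw [map_smul_eq_mul, show p.norm θ = 1 from hθ, mul_one, norm_inv, norm_norm] at h1
  rw [mem_closedBall_zero_iff]
  exact (le_inv_comm₀ hpos hn).1 h1

end PolarNorm

end

/-! ### The kernel and the variogram -/

section

variable {N : ℕ} {E : Matrix (Fin N) (Fin N) ℝ} {ψ : Space N → ℝ}

theorem kernel_add (s t ξ : Space N) :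
    kernel E ψ (s + t) ξ
      = Complex.exp (Complex.I * (⟪s, ξ⟫ : ℝ)) * kernel E ψ t ξ + kernel E ψ s ξ := by
  simp only [kernel, inner_add_left, Complex.ofReal_add, mul_add, Complex.exp_add]
  ring

theorem kernel_zero (ξ : Space N) : kernel E ψ 0 ξ = 0 := by simp [kernel]

theorem kernel_at_zero (t : Space N) : kernel E ψ t 0 = 0 := by simp [kernel]

theorem kernel_sub_kernel (s t ξ : Space N) :
    kernel E ψ s ξ - kernel E ψ t ξ
      = Complex.exp (Complex.I * (⟪t, ξ⟫ : ℝ)) * kernel E ψ (s - t) ξ := by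
  have := kernel_add (E := E) (ψ := ψ) t (s - t) ξ
  rw [add_sub_cancel] at this
  rw [this]; ring

theorem norm_exp_I_mul (x : ℝ) : ‖Complex.exp (Complex.I * x)‖ = 1 := by
  rw [mul_comm]; exact Complex.norm_exp_ofReal_mul_I x

theorem conj_exp_I_mul (x : ℝ) :
    conj (Complex.exp (Complex.I * x)) = Complex.exp (Complex.I * (-x : ℝ)) := by
  rw [← Complex.exp_conj]; simp

theorem kernel_neg_left (t ξ : Space N) : kernel E ψ (-t) ξ = conj (kernel E ψ t ξ) := by
  simp only [kernel, inner_neg_left, map_div₀, map_sub, conj_exp_I_mul, map_one,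
    Complex.conj_ofReal]

theorem kernel_neg_right (hψ : IsAdmissible E ψ) (t ξ : Space N) :
    kernel E ψ t (-ξ) = conj (kernel E ψ t ξ) := by
  simp only [kernel, inner_neg_right, map_div₀, map_sub, conj_exp_I_mul, map_one,
    Complex.conj_ofReal, hψ.symmetric]

theorem measurable_kernel (hψ : IsAdmissible E ψ) (t : Space N) :
    Measurable (kernel E ψ t) := by
  have h := hψ.continuous.measurable
  unfold kernel
  have h1 : Measurable fun ξ : Space N => (⟪t, ξ⟫ : ℝ) := (by fun_prop : Continuous _).measurable
  fun_prop

/-- The kernels of two increments of the same lag `h` differ by a phase only. -/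
theorem inner_increments (s s' h ξ : Space N) :
    ⟪kernel E ψ (s + h) ξ - kernel E ψ s ξ, kernel E ψ (s' + h) ξ - kernel E ψ s' ξ⟫
      = ‖kernel E ψ h ξ‖ ^ 2 * Real.cos ⟪s - s', ξ⟫ := by
  rw [kernel_sub_kernel, kernel_sub_kernel, add_sub_cancel_left, add_sub_cancel_left,
    Complex.inner]
  set K := kernel E ψ h ξ
  have h1 : conj (Complex.exp (Complex.I * (⟪s, ξ⟫ : ℝ)) * K)
      * (Complex.exp (Complex.I * (⟪s', ξ⟫ : ℝ)) * K)
      = Complex.exp ((-⟪s - s', ξ⟫ : ℝ) * Complex.I) * ((‖K‖ ^ 2 : ℝ) : ℂ) := by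
    rw [map_mul, conj_exp_I_mul]
    have e : Complex.exp ((-⟪s - s', ξ⟫ : ℝ) * Complex.I)
        = Complex.exp (Complex.I * (-⟪s, ξ⟫ : ℝ)) * Complex.exp (Complex.I * (⟪s', ξ⟫ : ℝ)) := by
      rw [← Complex.exp_add, inner_sub_left]; push_cast; ring_nf
    rw [e, ← Complex.normSq_eq_norm_sq, Complex.normSq_eq_conj_mul_self]
    ring
  rw [mul_comm, h1, Complex.re_mul_ofReal, Complex.exp_ofReal_mul_I_re, Real.cos_neg, mul_comm]

/-- The kernel inherits the homogeneity of `ψ`. -/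
theorem kernel_powAct (hψ : IsAdmissible E ψ) {r : ℝ} (hr : 0 < r) (x ξ : Space N) :
    kernel E ψ (powAct E r x) ξ
      = ((r ^ (1 + E.trace / 2) : ℝ) : ℂ) * kernel E ψ x (powAct Eᵀ r ξ) := by
  by_cases hξ : ξ = 0
  · subst hξ
    have : powAct Eᵀ r (0 : Space N) = 0 := by simp [powAct]
    simp [kernel_at_zero, this]
  · simp only [kernel, inner_powAct, hψ.homogeneous r hr ξ hξ]
    rw [Real.mul_rpow hr.le (hψ.nonneg _)]
    have : ((r ^ (1 + E.trace / 2) : ℝ) : ℂ) ≠ 0 := by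
      exact_mod_cast (Real.rpow_pos_of_pos hr _).ne'
    rw [Complex.ofReal_mul, mul_div_assoc', mul_div_mul_left _ _ this]

/-- Scaling of the covariance of increments. The Jacobian `r ^ (-trace E)` of the substitution
cancels the factor `r ^ trace E` that comes from the exponent `1 + trace E / 2` of `ψ`. -/
theorem integral_kernel_powAct (hψ : IsAdmissible E ψ) {r : ℝ} (hr : 0 < r) (x w : Space N) :
    ∫ ξ, ‖kernel E ψ (powAct E r x) ξ‖ ^ 2 * Real.cos ⟪w, ξ⟫
      = r ^ 2 * ∫ ξ, ‖kernel E ψ x ξ‖ ^ 2 * Real.cos ⟪powAct E r⁻¹ w, ξ⟫ := by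
  have h1 : ∀ ξ, ‖kernel E ψ (powAct E r x) ξ‖ ^ 2 * Real.cos ⟪w, ξ⟫
      = (r ^ 2 * r ^ E.trace) * (‖kernel E ψ x (powAct Eᵀ r ξ)‖ ^ 2
        * Real.cos ⟪powAct E r⁻¹ w, powAct Eᵀ r ξ⟫) := fun ξ => by
    rw [← inner_powAct, powAct_powAct_inv E hr, kernel_powAct hψ hr, norm_mul, Complex.norm_real,
      Real.norm_of_nonneg (Real.rpow_nonneg hr.le _), mul_pow, ← Real.rpow_natCast (r ^ _),
      ← Real.rpow_mul hr.le]
    rw [show (1 + E.trace / 2) * ((2 : ℕ) : ℝ) = (2 : ℕ) + E.trace by push_cast; ring,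
      Real.rpow_add hr, Real.rpow_natCast]
    ring
  simp_rw [h1]
  rw [integral_const_mul, integral_comp_powAct_transpose E hr
    (fun η => ‖kernel E ψ x η‖ ^ 2 * Real.cos ⟪powAct E r⁻¹ w, η⟫)]
  have := (Real.rpow_pos_of_pos hr E.trace).ne'
  field_simp

/-- The standard deviation `σ(t) = ‖K_t‖_{L²}` of the increments of lag `t`. It is meaningful for
square-integrable kernels only, a property that the lemmas below assume. -/
def sd (E : Matrix (Fin N) (Fin N) ℝ) (ψ : Space N → ℝ) (t : Space N) : ℝ :=
  (eLpNorm (kernel E ψ t) 2 volume).toReal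

theorem sd_nonneg (t : Space N) : 0 ≤ sd E ψ t := ENNReal.toReal_nonneg

theorem sd_zero : sd E ψ 0 = 0 := by
  have : kernel E ψ 0 = 0 := funext kernel_zero
  simp [sd, this]

theorem sd_neg (t : Space N) : sd E ψ (-t) = sd E ψ t := by
  have : kernel E ψ (-t) = fun ξ => conj (kernel E ψ t ξ) := funext (kernel_neg_left t)
  rw [sd, sd, this]
  congr 1
  exact eLpNorm_congr_norm_ae (ae_of_all _ fun ξ => by simp)

theorem sd_add_le (hψ : IsAdmissible E ψ) (hL : ∀ t, MemLp (kernel E ψ t) 2 volume)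
    (s t : Space N) : sd E ψ (s + t) ≤ sd E ψ s + sd E ψ t := by
  have h1 : eLpNorm (fun ξ => Complex.exp (Complex.I * (⟪s, ξ⟫ : ℝ)) * kernel E ψ t ξ) 2 volume
      = eLpNorm (kernel E ψ t) 2 volume :=
    eLpNorm_congr_norm_ae (ae_of_all _ fun ξ => by rw [norm_mul, norm_exp_I_mul, one_mul])
  have hm : Measurable fun ξ : Space N =>
      Complex.exp (Complex.I * (⟪s, ξ⟫ : ℝ)) * kernel E ψ t ξ := by
    have := measurable_kernel hψ t
    have h1 : Measurable fun ξ : Space N => (⟪s, ξ⟫ : ℝ) :=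
      (by fun_prop : Continuous _).measurable
    fun_prop
  have h2 : eLpNorm (kernel E ψ (s + t)) 2 volume
      ≤ eLpNorm (kernel E ψ t) 2 volume + eLpNorm (kernel E ψ s) 2 volume := by
    rw [← h1, show kernel E ψ (s + t) = (fun ξ => Complex.exp (Complex.I * (⟪s, ξ⟫ : ℝ))
      * kernel E ψ t ξ) + kernel E ψ s from funext (kernel_add s t)]
    exact eLpNorm_add_le hm.aestronglyMeasurable (hL s).1 (by norm_num)
  rw [add_comm (sd E ψ s), sd, sd, sd, ← ENNReal.toReal_add (hL t).2.ne (hL s).2.ne]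
  exact ENNReal.toReal_mono (ENNReal.add_ne_top.2 ⟨(hL t).2.ne, (hL s).2.ne⟩) h2

theorem sd_nsmul_le (hψ : IsAdmissible E ψ) (hL : ∀ t, MemLp (kernel E ψ t) 2 volume)
    (n : ℕ) (t : Space N) : sd E ψ (n • t) ≤ n * sd E ψ t := by
  induction n with
  | zero => simp [sd_zero]
  | succ n ih =>
    rw [succ_nsmul]
    refine (sd_add_le hψ hL _ _).trans ?_
    push_cast
    linarith

theorem sd_sq (hL : ∀ t, MemLp (kernel E ψ t) 2 volume) (t : Space N) :
    sd E ψ t ^ 2 = ∫ ξ, ‖kernel E ψ t ξ‖ ^ 2 := by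
  have h := (hL t).eLpNorm_eq_integral_rpow_norm (by norm_num) (by norm_num)
  rw [sd, h, ENNReal.toReal_ofReal (by positivity)]
  simp only [ENNReal.toReal_ofNat, Real.rpow_ofNat]
  rw [← one_div, ← Real.sqrt_eq_rpow, Real.sq_sqrt (integral_nonneg fun _ => by positivity)]

theorem sd_powAct (hψ : IsAdmissible E ψ) (hL : ∀ t, MemLp (kernel E ψ t) 2 volume)
    {r : ℝ} (hr : 0 < r) (x : Space N) : sd E ψ (powAct E r x) = r * sd E ψ x := by
  have h := integral_kernel_powAct hψ hr x 0
  simp only [powAct, map_zero, inner_zero_left, Real.cos_zero, mul_one] at h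
  rw [← pow_left_inj₀ (sd_nonneg _) (mul_nonneg hr.le (sd_nonneg _)) two_ne_zero, mul_pow,
    sd_sq hL, sd_sq hL]
  exact h

end

/-! ### Comparison of `σ`, `τ_E` and the Euclidean norm -/

section

variable {N : ℕ} {E : Matrix (Fin N) (Fin N) ℝ} {ψ : Space N → ℝ}

theorem continuous_kernel_left (ξ : Space N) : Continuous fun t => kernel E ψ t ξ := by
  unfold kernel
  fun_prop

/-- Lower semicontinuity is Fatou's lemma. -/
theorem lowerSemicontinuous_sd (hL : ∀ t, MemLp (kernel E ψ t) 2 volume) :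
    LowerSemicontinuous (sd E ψ) := by
  rw [lowerSemicontinuous_iff_isClosed_preimage]
  intro c
  refine IsSeqClosed.isClosed fun u t hu hut => ?_
  have h1 : eLpNorm (kernel E ψ t) 2 volume
      ≤ liminf (fun n => eLpNorm (kernel E ψ (u n)) 2 volume) atTop :=
    Lp.eLpNorm_lim_le_liminf_eLpNorm (fun n => (hL (u n)).1) _
      (ae_of_all _ fun ξ => ((continuous_kernel_left ξ).tendsto t).comp hut)
  have hc : 0 ≤ c := (sd_nonneg _).trans (hu 0)
  have h2 : eLpNorm (kernel E ψ t) 2 volume ≤ ENNReal.ofReal c := by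
    refine h1.trans (liminf_le_of_le (by isBoundedDefault) fun b hb => ?_)
    obtain ⟨n, hn⟩ := hb.exists
    exact hn.trans ((ENNReal.le_ofReal_iff_toReal_le (hL _).2.ne hc).2 (hu n))
  exact (ENNReal.le_ofReal_iff_toReal_le (hL _).2.ne hc).1 h2

/-- `σ` is finite and lower semicontinuous, so it is bounded on some ball by Baire's theorem, and
subadditivity spreads the bound to every ball. -/
theorem exists_sd_le (hψ : IsAdmissible E ψ) (hL : ∀ t, MemLp (kernel E ψ t) 2 volume) (R : ℝ) :
    ∃ K : ℝ, ∀ x : Space N, ‖x‖ ≤ R → sd E ψ x ≤ K := by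
  have hcl : ∀ n : ℕ, IsClosed {x : Space N | sd E ψ x ≤ n} := fun n =>
    (lowerSemicontinuous_iff_isClosed_preimage.1 (lowerSemicontinuous_sd hL)) n
  obtain ⟨n, x, hx⟩ := nonempty_interior_of_iUnion_of_closed hcl
    (eq_univ_of_forall fun x => mem_iUnion.2 (exists_nat_ge (sd E ψ x)))
  obtain ⟨ρ, hρ, hball⟩ := Metric.isOpen_iff.1 isOpen_interior x hx
  have hsmall : ∀ y : Space N, ‖y‖ < ρ → sd E ψ y ≤ 2 * n := fun y hy => by
    have hxy : x + y ∈ Metric.ball x ρ := by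
      rw [Metric.mem_ball, dist_eq_norm, add_sub_cancel_left]
      exact hy
    have h1 : x + y ∈ {x : Space N | sd E ψ x ≤ n} := interior_subset (hball hxy)
    have h2 : x ∈ {x : Space N | sd E ψ x ≤ n} := interior_subset hx
    rw [mem_ofPred_eq] at h1 h2
    have h3 := sd_add_le hψ hL (x + y) (-x)
    rw [sd_neg, add_neg_cancel_comm] at h3
    linarith
  obtain ⟨m, hm⟩ := exists_nat_gt (max (R / ρ) 0)
  have hm0 : (0 : ℝ) < m := (le_max_right _ _).trans_lt hm
  refine ⟨m * (2 * n), fun y hy => ?_⟩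
  have h1 : y = m • ((m : ℝ)⁻¹ • y) := by
    rw [← Nat.cast_smul_eq_nsmul ℝ, smul_smul, mul_inv_cancel₀ hm0.ne', one_smul]
  rw [h1]
  refine (sd_nsmul_le hψ hL m _).trans (mul_le_mul_of_nonneg_left (hsmall _ ?_) hm0.le)
  rw [norm_smul, norm_inv, RCLike.norm_natCast, inv_mul_lt_iff₀ hm0]
  have := (div_lt_iff₀ hρ).1 ((le_max_left _ _).trans_lt hm)
  linarith

theorem sd_pos (hψ : IsAdmissible E ψ) (hL : ∀ t, MemLp (kernel E ψ t) 2 volume)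
    {x : Space N} (hx : x ≠ 0) : 0 < sd E ψ x := by
  refine lt_of_le_of_ne (sd_nonneg _) fun h => ?_
  have h0 : eLpNorm (kernel E ψ x) 2 volume = 0 := by
    rcases (ENNReal.toReal_eq_zero_iff _).1 h.symm with h | h
    · exact h
    · exact absurd h (hL x).2.ne
  rw [eLpNorm_eq_zero_iff (hL x).1 (by norm_num)] at h0
  have hN : Nonempty (Fin N) := by
    by_contra hne
    rw [not_nonempty_iff] at hne
    exact hx (Subsingleton.elim _ _)
  have : Nontrivial (Space N) := ⟨x, 0, hx⟩
  have h1 : (fun ξ : Space N => Complex.exp (Complex.I * (⟪x, ξ⟫ : ℝ))) =ᵐ[volume] fun _ => 1 := by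
    have hne : ∀ᵐ ξ : Space N, ξ ≠ 0 := by simp [ae_iff]
    filter_upwards [h0, hne] with ξ hξ hξ0
    have hp : ((ψ ξ ^ (1 + E.trace / 2) : ℝ) : ℂ) ≠ 0 := by
      exact_mod_cast (Real.rpow_pos_of_pos (hψ.pos ξ hξ0) _).ne'
    simp only [kernel, Pi.zero_apply, div_eq_zero_iff, hp, or_false] at hξ
    exact sub_eq_zero.1 hξ
  have h2 := (Continuous.ae_eq_iff_eq volume (by fun_prop) continuous_const).1 h1
  have h3 := congrFun h2 ((Real.pi / ‖x‖ ^ 2) • x)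
  have hn : ‖x‖ ^ 2 ≠ 0 := by simpa using hx
  simp only [inner_smul_right, real_inner_self_eq_norm_sq, div_mul_cancel₀ _ hn] at h3
  rw [mul_comm, Complex.exp_pi_mul_I] at h3
  norm_num at h3

theorem exists_pos_le_sd (hψ : IsAdmissible E ψ) (hL : ∀ t, MemLp (kernel E ψ t) 2 volume)
    {K : Set (Space N)} (hK : IsCompact K) (h0 : (0 : Space N) ∉ K) :
    ∃ c > 0, ∀ x ∈ K, c ≤ sd E ψ x := by
  rcases K.eq_empty_or_nonempty with rfl | hne
  · exact ⟨1, one_pos, by simp⟩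
  obtain ⟨x, hx, hmin⟩ := ((lowerSemicontinuous_sd hL).lowerSemicontinuousOn K).exists_isMinOn
    hne hK
  exact ⟨sd E ψ x, sd_pos hψ hL (fun h => h0 (h ▸ hx)), fun y hy => hmin hy⟩

theorem exists_tau_le_sd (hψ : IsAdmissible E ψ) (hL : ∀ t, MemLp (kernel E ψ t) 2 volume)
    (p : PolarNorm E) : ∃ c > 0, ∀ x, c * p.tau x ≤ sd E ψ x := by
  obtain ⟨c, hc, h⟩ := exists_pos_le_sd hψ hL p.isCompact_sphere (by simp)
  refine ⟨c, hc, fun x => ?_⟩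
  by_cases hx : x = 0
  · simp [hx, p.tau_zero, sd_zero]
  obtain ⟨hτ, θ, hθ, hθx⟩ := p.tau_spec hx
  rw [← hθx, sd_powAct hψ hL hτ, p.tau_powAct_of_norm_eq_one hθ hτ, mul_comm]
  exact mul_le_mul_of_nonneg_left (h θ hθ) hτ.le

theorem exists_sd_le_tau (hψ : IsAdmissible E ψ) (hL : ∀ t, MemLp (kernel E ψ t) 2 volume)
    (p : PolarNorm E) : ∃ C > 0, ∀ x, sd E ψ x ≤ C * p.tau x := by
  obtain ⟨R, hR⟩ := p.isCompact_sphere.isBounded.exists_norm_le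
  obtain ⟨C, hC⟩ := exists_sd_le hψ hL R
  refine ⟨max C 1, by positivity, fun x => ?_⟩
  by_cases hx : x = 0
  · simp [hx, p.tau_zero, sd_zero]
  obtain ⟨hτ, θ, hθ, hθx⟩ := p.tau_spec hx
  rw [← hθx, sd_powAct hψ hL hτ, p.tau_powAct_of_norm_eq_one hθ hτ, mul_comm]
  exact mul_le_mul_of_nonneg_right ((hC θ (hR θ hθ)).trans (le_max_left _ _)) hτ.le

theorem exists_norm_le_sd (hψ : IsAdmissible E ψ) (hL : ∀ t, MemLp (kernel E ψ t) 2 volume) :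
    ∃ c > 0, ∀ x : Space N, ‖x‖ ≤ 1 → c * ‖x‖ ≤ sd E ψ x := by
  have hK : IsCompact (Metric.closedBall (0 : Space N) 1 ∩ {x | 1 / 2 ≤ ‖x‖}) :=
    (isCompact_closedBall _ _).inter_right (isClosed_le continuous_const continuous_norm)
  obtain ⟨c, hc, h⟩ := exists_pos_le_sd hψ hL hK (by norm_num)
  refine ⟨c, hc, fun x hx => ?_⟩
  by_cases hx0 : x = 0
  · simp [hx0, sd_zero]
  have hn : 0 < ‖x‖ := norm_pos_iff.2 hx0
  -- The multiple `m • x` has norm between `1/2` and `1`, and `σ` is subadditive.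
  set m := ⌊1 / ‖x‖⌋₊ with hm
  have h1 : (m : ℝ) ≤ 1 / ‖x‖ := Nat.floor_le (by positivity)
  have h2 : 1 / ‖x‖ < m + 1 := Nat.lt_floor_add_one _
  have hm1 : 1 ≤ m := Nat.one_le_floor_iff _ |>.2 ((one_le_div hn).2 hx)
  have hm1' : (1 : ℝ) ≤ m := by exact_mod_cast hm1
  rw [le_div_iff₀ hn] at h1
  rw [div_lt_iff₀ hn] at h2
  have hmem : m • x ∈ Metric.closedBall (0 : Space N) 1 ∩ {x | 1 / 2 ≤ ‖x‖} := by
    have : ‖m • x‖ = m * ‖x‖ := by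
      rw [← Nat.cast_smul_eq_nsmul ℝ, norm_smul, RCLike.norm_natCast]
    simp only [mem_inter_iff, mem_closedBall_zero_iff, mem_ofPred_eq, this]
    exact ⟨h1, by nlinarith⟩
  have h3 := (h _ hmem).trans (sd_nsmul_le hψ hL m x)
  have hs := sd_nonneg (E := E) (ψ := ψ) x
  nlinarith

/-- A Hölder bound: `σ` is comparable with `τ_E`, and `x = r ^ E θ` gives `‖θ‖ ≤ r ^ (-b) ‖x‖` for
small `r = τ_E(x)`, where `‖θ‖` is bounded below on the unit sphere of the norm. -/
theorem exists_sd_pow_le (hψ : IsAdmissible E ψ) (hL : ∀ t, MemLp (kernel E ψ t) 2 volume)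
    (p : PolarNorm E) :
    ∃ b : ℕ, 1 ≤ b ∧ ∃ C > 0, ∀ x : Space N, ‖x‖ ≤ 1 → sd E ψ x ^ b ≤ C * ‖x‖ := by
  obtain ⟨b, hb, hact⟩ := norm_powAct_le E
  obtain ⟨c₁, hc₁, hτσ⟩ := exists_tau_le_sd hψ hL p
  obtain ⟨c₂, hc₂, hστ⟩ := exists_sd_le_tau hψ hL p
  obtain ⟨K, hK⟩ := exists_sd_le hψ hL 1
  obtain ⟨c₀, hc₀, hθ₀⟩ : ∃ c₀ > 0, ∀ θ, p.norm θ = 1 → c₀ ≤ ‖θ‖ := by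
    rcases {θ : Space N | p.norm θ = 1}.eq_empty_or_nonempty with he | hne
    · exact ⟨1, one_pos, fun θ hθ => absurd hθ (eq_empty_iff_forall_notMem.1 he θ)⟩
    obtain ⟨x, hx, hmin⟩ := p.isCompact_sphere.exists_isMinOn hne continuous_norm.continuousOn
    exact ⟨‖x‖, norm_pos_iff.2 (p.ne_zero_of_norm_eq_one hx), fun θ hθ => hmin hθ⟩
  set T := max (K / c₁) 1
  have hT : 1 ≤ T := le_max_right _ _
  refine ⟨b, hb, c₂ ^ b * (T ^ (2 * b) / c₀), by positivity, fun x hx => ?_⟩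
  by_cases hx0 : x = 0
  · simp [hx0, sd_zero, (Nat.one_le_iff_ne_zero.1 hb)]
  obtain ⟨hτ, θ, hθ, hθx⟩ := p.tau_spec hx0
  set r := p.tau x
  have hrT : r ≤ T := by
    refine le_trans ?_ (le_max_left _ _)
    rw [le_div_iff₀ hc₁, mul_comm]
    exact (hτσ x).trans (hK x hx)
  have h1 : c₀ ≤ Real.exp (|Real.log r| * b) * ‖x‖ := by
    refine (hθ₀ θ hθ).trans ?_
    have := hact r⁻¹ x
    rwa [← hθx, powAct_inv_powAct E hτ, hθx, Real.log_inv, abs_neg] at this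
  have h2 : Real.exp (|Real.log r| * b) * r ^ b ≤ T ^ (2 * b) := by
    have hlog : Real.log r ≤ Real.log T := Real.log_le_log hτ hrT
    have hlogT : 0 ≤ Real.log T := Real.log_nonneg hT
    have e1 : r ^ b = Real.exp (Real.log r * b) := by
      rw [mul_comm, Real.exp_nat_mul, Real.exp_log hτ]
    have e2 : T ^ (2 * b) = Real.exp (2 * Real.log T * b) := by
      rw [mul_comm _ (b : ℝ), Real.exp_nat_mul, pow_mul, two_mul (Real.log T), Real.exp_add,
        Real.exp_log (by positivity : 0 < T), sq]
    rw [e1, e2, ← Real.exp_add, Real.exp_le_exp, ← add_mul]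
    refine mul_le_mul_of_nonneg_right ?_ (Nat.cast_nonneg _)
    rcases abs_cases (Real.log r) with ⟨h, _⟩ | ⟨h, _⟩ <;> rw [h] <;> linarith
  have h3 : r ^ b ≤ T ^ (2 * b) / c₀ * ‖x‖ := by
    rw [div_mul_eq_mul_div, le_div_iff₀ hc₀]
    calc r ^ b * c₀ ≤ r ^ b * (Real.exp (|Real.log r| * b) * ‖x‖) := by gcongr
      _ = Real.exp (|Real.log r| * b) * r ^ b * ‖x‖ := by ring
      _ ≤ _ := by gcongr
  calc sd E ψ x ^ b ≤ (c₂ * r) ^ b := pow_le_pow_left₀ (sd_nonneg _) (hστ x) _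
    _ = c₂ ^ b * r ^ b := mul_pow _ _ _
    _ ≤ _ := by rw [mul_assoc]; gcongr

theorem continuous_sd (hψ : IsAdmissible E ψ) (hL : ∀ t, MemLp (kernel E ψ t) 2 volume)
    (p : PolarNorm E) : Continuous (sd E ψ) := by
  obtain ⟨b, hb, C, hC, h⟩ := exists_sd_pow_le hψ hL p
  have habs : ∀ x y : Space N, |sd E ψ x - sd E ψ y| ≤ sd E ψ (x - y) := fun x y => by
    have h1 := sd_add_le hψ hL (x - y) y
    have h2 := sd_add_le hψ hL (y - x) x
    rw [sub_add_cancel] at h1 h2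
    rw [← neg_sub x y, sd_neg] at h2
    rw [abs_le]
    constructor <;> linarith
  rw [Metric.continuous_iff]
  intro y ε hε
  refine ⟨min 1 (ε ^ b / C), by positivity, fun x hx => ?_⟩
  rw [Real.dist_eq]
  refine (habs x y).trans_lt (lt_of_pow_lt_pow_left₀ b hε.le ?_)
  rw [dist_eq_norm] at hx
  refine (h _ (hx.le.trans (min_le_left _ _))).trans_lt ?_
  rw [mul_comm, ← lt_div_iff₀ hC]
  exact hx.trans_le (min_le_right _ _)

/-- A direction along which `r ^ E x` tends to zero at least linearly: a path `r ↦ r ^ E x` that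
starts close to the origin cannot cross the unit sphere, on which `σ` is bounded below. -/
theorem exists_norm_powAct_le (hN : 1 ≤ N) (hψ : IsAdmissible E ψ)
    (hL : ∀ t, MemLp (kernel E ψ t) 2 volume) (p : PolarNorm E) :
    ∃ x : Space N, x ≠ 0 ∧ ∀ r : ℝ, 0 < r → r ≤ 1 → ‖powAct E r x‖ ≤ r := by
  obtain ⟨c, hc, hlow⟩ := exists_norm_le_sd hψ hL
  have : Nonempty (Fin N) := ⟨⟨0, hN⟩⟩
  have hev : ∀ᶠ x in 𝓝 (0 : Space N), sd E ψ x < c ∧ ‖x‖ < 1 := by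
    refine ((continuous_sd hψ hL p).tendsto 0).eventually_lt_const (by rwa [sd_zero]) |>.and ?_
    exact (continuous_norm.tendsto (0 : Space N)).eventually_lt_const (by simp)
  have hnt : Nontrivial (Space N) := inferInstance
  have hne : (𝓝[≠] (0 : Space N)).NeBot := Module.punctured_nhds_neBot ℝ (Space N) 0
  obtain ⟨x, ⟨hσ, hx1⟩, hx0⟩ := ((hev.filter_mono (nhdsWithin_le_nhds (s := {0}ᶜ))).and
    eventually_mem_nhdsWithin).exists
  refine ⟨x, hx0, fun r hr hr1 => ?_⟩
  have hcross : ∀ s : ℝ, 0 < s → s ≤ 1 → ‖powAct E s x‖ ≠ 1 := fun s hs hs1 h => by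
    have := hlow _ h.le
    rw [h, sd_powAct hψ hL hs] at this
    have := sd_nonneg (E := E) (ψ := ψ) x
    nlinarith
  have hlt : ‖powAct E r x‖ < 1 := by
    by_contra! hge
    have hcont : ContinuousOn (fun s => ‖powAct E s x‖) (Icc r 1) :=
      ((continuousOn_powAct E x).mono fun s hs => hr.trans_le hs.1).norm
    obtain ⟨s, hs, h⟩ := intermediate_value_Icc' hr1 hcont
      (show (1 : ℝ) ∈ Icc _ _ from ⟨by simpa [powAct_one] using hx1.le, hge⟩)
    exact hcross s (hr.trans_le hs.1) hs.2 h
  have := hlow _ hlt.le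
  rw [sd_powAct hψ hL hr] at this
  nlinarith

/-- The Riemann–Lebesgue lemma for the spectral density `‖K_x‖²` of the increments of lag `x`. -/
theorem tendsto_integral_cos_cocompact (hL : ∀ t, MemLp (kernel E ψ t) 2 volume) (x : Space N) :
    Tendsto (fun w : Space N => ∫ ξ, ‖kernel E ψ x ξ‖ ^ 2 * Real.cos ⟪w, ξ⟫)
      (cocompact (Space N)) (𝓝 0) := by
  set g : Space N → ℝ := fun ξ => ‖kernel E ψ x ξ‖ ^ 2 with hg
  have hgi : Integrable g := (memLp_two_iff_integrable_sq_norm (hL x).1).1 (hL x)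
  have h := tendsto_integral_exp_inner_smul_cocompact (fun ξ => ((g ξ : ℝ) : ℂ))
  have hinj : Tendsto (fun w : Space N => (2 * Real.pi)⁻¹ • w) (cocompact (Space N))
      (cocompact (Space N)) :=
    (Homeomorph.smulOfNeZero ((2 * Real.pi)⁻¹ : ℝ)
      (by positivity)).isClosedEmbedding.tendsto_cocompact
  have h2 := (Complex.continuous_re.tendsto 0).comp (h.comp hinj)
  rw [Complex.zero_re] at h2
  refine h2.congr fun w => ?_
  simp only [Function.comp_apply]
  rw [← RCLike.re_eq_complex_re, ← integral_re]
  · refine integral_congr_ae (ae_of_all _ fun ξ => ?_)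
    simp only [Circle.smul_def, smul_eq_mul, RCLike.re_eq_complex_re, Complex.re_mul_ofReal]
    rw [Real.fourierChar_apply, Complex.exp_ofReal_mul_I_re, mul_comm]
    congr 1
    rw [inner_smul_right, real_inner_comm, ← Real.cos_neg]
    congr 1
    have := Real.pi_ne_zero
    field_simp
  · have hi : Integrable (fun ξ => ((g ξ : ℝ) : ℂ)) := hgi.ofReal
    exact (Real.fourierIntegral_convergent_iff' (innerSL ℝ) _).2 hi

/-- Increments of lag `r ^ E x` at points at distance at least `√r` from each other have
correlation at most `1/2`, for small `r`. -/
theorem exists_correlation_le (hψ : IsAdmissible E ψ) (hL : ∀ t, MemLp (kernel E ψ t) 2 volume)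
    {x : Space N} (hx : x ≠ 0) :
    ∃ r₀ > 0, ∀ r : ℝ, 0 < r → r < r₀ → ∀ w : Space N, √r ≤ ‖w‖ → ‖w‖ ≤ 1 →
      |∫ ξ, ‖kernel E ψ (powAct E r x) ξ‖ ^ 2 * Real.cos ⟪w, ξ⟫|
        ≤ sd E ψ (powAct E r x) ^ 2 / 2 := by
  have hσ := sd_pos hψ hL hx
  have h1 := (tendsto_integral_cos_cocompact hL x).abs.eventually_lt_const
    (u := sd E ψ x ^ 2 / 2) (by rw [abs_zero]; positivity)
  rw [← Metric.cobounded_eq_cocompact,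
    (Metric.hasBasis_cobounded_compl_closedBall 0).eventually_iff] at h1
  obtain ⟨R, -, hR⟩ := h1
  obtain ⟨K, hK⟩ := exists_sd_le hψ hL R
  obtain ⟨c, hc, hlow⟩ := exists_norm_le_sd hψ hL
  set K' := max K 1
  have hK' : 0 < K' := by positivity
  refine ⟨(c / K') ^ 2, by positivity, fun r hr hr0 w hw hw1 => ?_⟩
  rw [integral_kernel_powAct hψ hr, sd_powAct hψ hL hr, abs_mul,
    abs_of_pos (by positivity : 0 < r ^ 2), mul_pow, mul_div_assoc]
  refine mul_le_mul_of_nonneg_left (le_of_lt ?_) (by positivity)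
  -- `r ^ (-E) w` is outside the ball of radius `R`, because `σ(r ^ (-E) w) = σ(w) / r` is at least
  -- of order `√r / r`.
  refine hR ?_
  simp only [mem_compl_iff, mem_closedBall_zero_iff]
  intro hle
  have h2 := hK _ hle
  rw [sd_powAct hψ hL (inv_pos.2 hr)] at h2
  have h3 := hlow w hw1
  have hsr : 0 < √r := Real.sqrt_pos.2 hr
  have hsq : √r * √r = r := Real.mul_self_sqrt hr.le
  have h4 : √r < c / K' := by
    rw [← Real.sqrt_sq (by positivity : 0 ≤ c / K')]
    exact Real.sqrt_lt_sqrt hr.le hr0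
  rw [lt_div_iff₀ hK'] at h4
  rw [inv_mul_le_iff₀ hr] at h2
  have h5 : K ≤ K' := le_max_left _ _
  nlinarith [mul_le_mul_of_nonneg_left h5 hr.le]

end

/-! ### Limits in `L²` -/

section

theorem tendsto_integral_inner {α F : Type*} [MeasurableSpace α] {μ : Measure α}
    [NormedAddCommGroup F] [InnerProductSpace ℝ F] {f g : ℕ → α → F} {f' g' : α → F}
    (hf : ∀ n, MemLp (f n) 2 μ) (hg : ∀ n, MemLp (g n) 2 μ) (hf' : MemLp f' 2 μ)
    (hg' : MemLp g' 2 μ) (hff : Tendsto (fun n => eLpNorm (f n - f') 2 μ) atTop (𝓝 0))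
    (hgg : Tendsto (fun n => eLpNorm (g n - g') 2 μ) atTop (𝓝 0)) :
    Tendsto (fun n => ∫ a, ⟪f n a, g n a⟫ ∂μ) atTop (𝓝 (∫ a, ⟪f' a, g' a⟫ ∂μ)) := by
  have h1 := (Lp.tendsto_Lp_iff_tendsto_eLpNorm'' f hf f' hf').2 hff
  have h2 := (Lp.tendsto_Lp_iff_tendsto_eLpNorm'' g hg g' hg').2 hgg
  have key : ∀ {u v : α → F} (hu : MemLp u 2 μ) (hv : MemLp v 2 μ),
      ⟪hu.toLp u, hv.toLp v⟫ = ∫ a, ⟪u a, v a⟫ ∂μ := fun hu hv => by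
    rw [L2.inner_def]
    refine integral_congr_ae ?_
    filter_upwards [hu.coeFn_toLp, hv.coeFn_toLp] with a ha hb
    rw [ha, hb]
  have h3 := h1.inner (𝕜 := ℝ) h2
  simpa only [key] using h3

variable {Ω : Type*} [MeasurableSpace Ω] {P : Measure Ω}

theorem tendsto_integral_of_L2 [IsProbabilityMeasure P] {Z : ℕ → Ω → ℝ} {Y : Ω → ℝ}
    (hZ : ∀ n, MemLp (Z n) 2 P) (hY : MemLp Y 2 P)
    (h : Tendsto (fun n => eLpNorm (Z n - Y) 2 P) atTop (𝓝 0)) :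
    Tendsto (fun n => ∫ ω, Z n ω ∂P) atTop (𝓝 (∫ ω, Y ω ∂P)) := by
  refine tendsto_integral_of_L1' Y hY.1
    (Eventually.of_forall fun n => (hZ n).integrable (by norm_num)) ?_
  refine tendsto_of_tendsto_of_tendsto_of_le_of_le tendsto_const_nhds h (fun _ => zero_le)
    fun n => ?_
  exact eLpNorm_le_eLpNorm_of_exponent_le (by norm_num) ((hZ n).sub hY).1

theorem norm_exp_mul_I_sub_le (a b : ℝ) :
    ‖Complex.exp (a * Complex.I) - Complex.exp (b * Complex.I)‖ ≤ |a - b| := by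
  have h : Complex.exp (a * Complex.I) - Complex.exp (b * Complex.I)
      = Complex.exp (b * Complex.I) * (Complex.exp (Complex.I * (a - b : ℝ)) - 1) := by
    rw [mul_sub, ← Complex.exp_add, mul_one]
    congr 2
    push_cast; ring
  rw [h, norm_mul, Complex.norm_exp_ofReal_mul_I, one_mul]
  exact Real.norm_exp_I_mul_ofReal_sub_one_le

/-- A limit in `L²` of Gaussian random variables is Gaussian, because the characteristic functions
converge. -/
theorem hasGaussianLaw_of_tendsto [IsProbabilityMeasure P] {Z : ℕ → Ω → ℝ} {Y : Ω → ℝ}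
    (hZ : ∀ n, HasGaussianLaw (Z n) P) (hY : MemLp Y 2 P)
    (h : Tendsto (fun n => eLpNorm (Z n - Y) 2 P) atTop (𝓝 0)) : HasGaussianLaw Y P := by
  have hZ2 : ∀ n, MemLp (Z n) 2 P := fun n => (hZ n).memLp_two
  rw [hasGaussianLaw_iff_charFun_map_eq hY.1.aemeasurable]
  intro u
  have hmean := tendsto_integral_of_L2 hZ2 hY h
  have hvar : Tendsto (fun n => Var[Z n; P]) atTop (𝓝 Var[Y; P]) := by
    have h2 := tendsto_integral_inner hZ2 hZ2 hY hY h h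
    have e : ∀ {W : Ω → ℝ}, MemLp W 2 P → Var[W; P] = ∫ ω, ⟪W ω, W ω⟫ ∂P - (∫ ω, W ω ∂P) ^ 2 :=
      fun hW => by
        rw [variance_eq_sub hW]
        simp [sq]
    rw [e hY]
    simp_rw [e (hZ2 _)]
    exact h2.sub (hmean.pow 2)
  have hL : Tendsto (fun n => charFun (P.map (Z n)) u) atTop (𝓝 (charFun (P.map Y) u)) := by
    have e : ∀ {W : Ω → ℝ}, MemLp W 2 P →
        charFun (P.map W) u = ∫ ω, Complex.exp ((u * W ω : ℝ) * Complex.I) ∂P := fun hW => by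
      rw [charFun_apply_real, integral_map hW.1.aemeasurable (by fun_prop)]
      push_cast; rfl
    have hint : ∀ {W : Ω → ℝ}, MemLp W 2 P →
        Integrable (fun ω => Complex.exp ((u * W ω : ℝ) * Complex.I)) P := fun {W} hW => by
      refine Integrable.of_bound (C := 1) ?_ (ae_of_all _ fun ω => ?_)
      · have := hW.1.aemeasurable
        exact (by fun_prop : AEMeasurable _ P).aestronglyMeasurable
      · rw [Complex.norm_exp_ofReal_mul_I]
    simp_rw [e hY, e (hZ2 _)]
    rw [tendsto_iff_norm_sub_tendsto_zero]
    have hb : Tendsto (fun n => |u| * (eLpNorm (Z n - Y) 2 P).toReal) atTop (𝓝 0) := by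
      have := (ENNReal.tendsto_toReal ENNReal.zero_ne_top).comp h
      simpa using this.const_mul |u|
    refine squeeze_zero (fun _ => norm_nonneg _) (fun n => ?_) hb
    rw [← integral_sub (hint (hZ2 n)) (hint hY)]
    have hd := (hZ2 n).sub hY
    have hd1 : Integrable (Z n - Y) P := hd.integrable (by norm_num)
    calc _ ≤ ∫ ω, |u| * |Z n ω - Y ω| ∂P := by
          refine norm_integral_le_of_norm_le (hd1.abs.const_mul _) (ae_of_all _ fun ω => ?_)
          refine (norm_exp_mul_I_sub_le _ _).trans ?_
          rw [← mul_sub, abs_mul]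
      _ = |u| * (eLpNorm (Z n - Y) 1 P).toReal := by
          rw [integral_const_mul, eLpNorm_one_eq_lintegral_enorm,
            ← integral_norm_eq_lintegral_enorm hd.1]
          rfl
      _ ≤ _ := by
          gcongr
          · exact hd.2.ne
          · exact eLpNorm_le_eLpNorm_of_exponent_le (by norm_num) hd.1
  have hR : Tendsto (fun n => charFun (P.map (Z n)) u) atTop
      (𝓝 (Complex.exp ((P[fun ω ↦ ⟪u, Y ω⟫] : ℝ) * Complex.I - Var[fun ω ↦ ⟪u, Y ω⟫; P] / 2))) := by
    have e : ∀ n, charFun (P.map (Z n)) u = _ := fun n => (hZ n).charFun_map_eq u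
    have hm : ∀ W : Ω → ℝ, ∫ ω, ⟪u, W ω⟫ ∂P = u * ∫ ω, W ω ∂P := fun W => by
      rw [← integral_const_mul]; simp [mul_comm]
    have hv : ∀ W : Ω → ℝ, Var[fun ω ↦ ⟪u, W ω⟫; P] = u ^ 2 * Var[W; P] := fun W => by
      rw [← variance_const_mul]; simp [mul_comm]
    simp only [hm, hv] at e ⊢
    simp_rw [e]
    refine (Complex.continuous_exp.tendsto _).comp ?_
    refine Tendsto.sub (Tendsto.mul_const _ ?_) (Tendsto.div_const ?_ _)
    · exact (Complex.continuous_ofReal.tendsto _).comp (hmean.const_mul u)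
    · exact (Complex.continuous_ofReal.tendsto _).comp (hvar.const_mul (u ^ 2))
  exact tendsto_nhds_unique hL hR

theorem hasGaussianLaw_of_strongDual {F : Type*} [NormedAddCommGroup F] [NormedSpace ℝ F]
    [MeasurableSpace F] [BorelSpace F] {Y : Ω → F} (hY : AEMeasurable Y P)
    (h : ∀ L : StrongDual ℝ F, HasGaussianLaw (fun ω => L (Y ω)) P) : HasGaussianLaw Y P := by
  refine ⟨⟨fun L => ?_⟩⟩
  have h1 := (h L).map_eq_gaussianReal
  rw [AEMeasurable.map_map_of_aemeasurable (by fun_prop) hY,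
    integral_map hY (by fun_prop), variance_map (by fun_prop) hY]
  exact h1

theorem strongDual_restrict_eq_sum {ι : Type*} (I : Finset ι) [DecidableEq I]
    (L : StrongDual ℝ (I → ℝ)) (y : ι → ℝ) :
    L (I.restrict y) = ∑ i : I, L (Pi.single i 1) * y i := by
  conv_lhs => rw [← Finset.univ_sum_single (I.restrict y), map_sum]
  refine Finset.sum_congr rfl fun t _ => ?_
  have : (Pi.single t (I.restrict y t) : I → ℝ) = (y t) • Pi.single t 1 := by
    rw [← Pi.single_smul]; simp
  rw [this, map_smul, smul_eq_mul, mul_comm]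

theorem isGaussianProcess_of_tendsto [IsProbabilityMeasure P] {T : Type*} {Y : ℕ → T → Ω → ℝ}
    {X : T → Ω → ℝ} (hY : ∀ n, IsGaussianProcess (Y n) P) (hX : ∀ t, MemLp (X t) 2 P)
    (h : ∀ t, Tendsto (fun n => eLpNorm (Y n t - X t) 2 P) atTop (𝓝 0)) :
    IsGaussianProcess X P := by
  refine ⟨fun I => hasGaussianLaw_of_strongDual
    (aemeasurable_pi_lambda _ fun t => (hX t).1.aemeasurable) fun L => ?_⟩
  classical
  have hLsum : ∀ W : T → Ω → ℝ, (fun ω => L (I.restrict (W · ω)))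
      = ∑ t : I, (L (Pi.single t 1)) • W t := fun W => by
    ext ω
    simp [strongDual_restrict_eq_sum]
  refine hasGaussianLaw_of_tendsto (Z := fun n ω => L (I.restrict (Y n · ω)))
    (fun n => ((hY n).hasGaussianLaw I).map_fun L) ?_ ?_
  · rw [hLsum]
    exact memLp_finsetSum' _ fun t _ => (hX t).const_smul _
  · have hle : ∀ n, eLpNorm ((fun ω => L (I.restrict (Y n · ω)))
        - (fun ω => L (I.restrict (X · ω)))) 2 P
        ≤ ∑ t : I, ‖L (Pi.single t 1)‖ₑ * eLpNorm (Y n t - X t) 2 P := fun n => by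
      rw [hLsum, hLsum, ← Finset.sum_sub_distrib]
      simp_rw [← smul_sub, ← eLpNorm_const_smul]
      refine eLpNorm_sum_le (fun t _ => ?_) (by norm_num)
      exact ((((hY n).hasGaussianLaw_eval t).memLp_two.sub (hX t)).const_smul _).1
    refine tendsto_of_tendsto_of_tendsto_of_le_of_le tendsto_const_nhds ?_ (fun _ => zero_le) hle
    rw [show (0 : ℝ≥0∞) = ∑ t : I, ‖L (Pi.single t 1)‖ₑ * 0 by simp]
    exact tendsto_finsetSum _ fun t _ => ENNReal.Tendsto.const_mul (h t) (Or.inr enorm_ne_top)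

end

/-! ### The Wiener integral -/

section

variable {N : ℕ} {Ω : Type*} [MeasurableSpace Ω] {P : Measure Ω}
  {M : Set (Space N) → Ω → ℂ}

theorem integral_inner_sum_indicator {α ι κ : Type*} [MeasurableSpace α] {μ : Measure α}
    (S : Finset ι) (T : Finset κ) (z : ι → ℂ) (w : κ → ℂ) (A : ι → Set α) (B : κ → Set α)
    (hA : ∀ i ∈ S, MeasurableSet (A i)) (hB : ∀ j ∈ T, MeasurableSet (B j))
    (hAf : ∀ i ∈ S, z i ≠ 0 → μ (A i) < ∞) :
    ∫ ξ, ⟪∑ i ∈ S, (A i).indicator (fun _ => z i) ξ, ∑ j ∈ T, (B j).indicator (fun _ => w j) ξ⟫ ∂μ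
      = ∑ i ∈ S, ∑ j ∈ T, ⟪z i, w j⟫ * (μ (A i ∩ B j)).toReal := by
  have h1 : ∀ ξ, ⟪∑ i ∈ S, (A i).indicator (fun _ => z i) ξ,
      ∑ j ∈ T, (B j).indicator (fun _ => w j) ξ⟫
      = ∑ i ∈ S, ∑ j ∈ T, (A i ∩ B j).indicator (fun _ => ⟪z i, w j⟫) ξ := fun ξ => by
    rw [sum_inner]
    simp_rw [inner_sum]
    refine Finset.sum_congr rfl fun i _ => Finset.sum_congr rfl fun j _ => ?_
    by_cases hi : ξ ∈ A i <;> by_cases hj : ξ ∈ B j <;> simp [hi, hj]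
  have h2 : ∀ i ∈ S, ∀ j ∈ T,
      Integrable ((A i ∩ B j).indicator fun _ => (⟪z i, w j⟫ : ℝ)) μ := fun i hi j hj => by
    by_cases hz : z i = 0
    · simp [hz]
    · exact (integrable_indicator_iff ((hA i hi).inter (hB j hj))).2
        (integrableOn_const ((measure_mono inter_subset_left).trans_lt (hAf i hi hz)).ne)
  simp_rw [h1]
  rw [integral_finsetSum _ fun i hi => integrable_finsetSum _ fun j hj => h2 i hi j hj]
  refine Finset.sum_congr rfl fun i hi => ?_
  rw [integral_finsetSum _ fun j hj => h2 i hi j hj]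
  refine Finset.sum_congr rfl fun j hj => ?_
  rw [integral_indicator_const _ ((hA i hi).inter (hB j hj)), smul_eq_mul, mul_comm]
  rfl

theorem simpleFunc_eq_sum_indicator {α : Type*} [MeasurableSpace α] (φ : SimpleFunc α ℂ) (ξ : α) :
    φ ξ = ∑ z ∈ φ.range, (φ ⁻¹' {z}).indicator (fun _ => z) ξ := by
  rw [Finset.sum_eq_single (φ ξ)]
  · simp
  · intro z _ hz
    have : ξ ∉ φ ⁻¹' {z} := fun h => hz h.symm
    simp [this]
  · intro h
    exact absurd (SimpleFunc.mem_range_self φ ξ) h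

namespace IsGaussianRandomMeasure

theorem memLp (hM : IsGaussianRandomMeasure P M) (A : FiniteSets N) : MemLp (M A.1) 2 P :=
  (hM.gaussian.hasGaussianLaw_eval A).memLp_two

theorem neg_mem (A : FiniteSets N) : MeasurableSet (-A.1) ∧ volume (-A.1) < ∞ :=
  ⟨A.2.1.neg, by rw [Measure.measure_neg]; exact A.2.2⟩

/-- `E[Re(z M(A)) Re(w M(B))]`: the Hermitian symmetry of `M` turns `M(B)` into the conjugate of
`M(-B)`, so that `E[M(A) M(B)]` is known as well. -/
theorem integral_re_mul_re (hM : IsGaussianRandomMeasure P M) (A B : FiniteSets N) (z w : ℂ) :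
    ∫ ω, (z * M A.1 ω).re * (w * M B.1 ω).re ∂P
      = (⟪z, w⟫ * (volume (A.1 ∩ B.1)).toReal
        + ⟪z, conj w⟫ * (volume (A.1 ∩ -B.1)).toReal) / 2 := by
  have hA := hM.memLp A
  have hB := hM.memLp B
  have hBc : MemLp (fun ω => conj (M B.1 ω)) 2 P :=
    hB.congr_norm (Complex.continuous_conj.comp_aestronglyMeasurable hB.1)
      (ae_of_all _ fun ω => by simp)
  have i1 : Integrable (fun ω => M A.1 ω * conj (M B.1 ω)) P := hA.integrable_mul hBc
  have i2 : Integrable (fun ω => M A.1 ω * M B.1 ω) P := hA.integrable_mul hB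
  have e2 : ∫ ω, M A.1 ω * M B.1 ω ∂P = ((volume (A.1 ∩ -B.1)).toReal : ℂ) := by
    rw [← hM.covariance A ⟨-B.1, neg_mem B⟩]
    refine integral_congr_ae ?_
    filter_upwards [hM.hermitian B] with ω hω
    rw [hω, Complex.conj_conj]
  have h1 : ∀ ω, (z * M A.1 ω).re * (w * M B.1 ω).re
      = ((z * conj w * (M A.1 ω * conj (M B.1 ω)) + z * w * (M A.1 ω * M B.1 ω)) / 2).re :=
    fun ω => by
      simp only [Complex.add_re, Complex.mul_re, Complex.mul_im, Complex.conj_re, Complex.conj_im,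
        Complex.div_ofNat_re]
      ring
  simp_rw [h1]
  have hi := ((i1.const_mul (z * conj w)).add (i2.const_mul (z * w))).div_const 2
  have := integral_re hi
  simp only [RCLike.re_eq_complex_re, Pi.add_apply] at this
  rw [this, integral_div, integral_add (i1.const_mul _) (i2.const_mul _), integral_const_mul,
    integral_const_mul, hM.covariance A B, e2]
  simp only [Complex.inner, Complex.add_re, Complex.mul_re, Complex.mul_im, Complex.conj_re,
    Complex.conj_im, Complex.div_ofNat_re, Complex.ofReal_re, Complex.ofReal_im]
  ring

theorem preimage_mem {φ : SimpleFunc (Space N) ℂ} (hφ : MemLp φ 2 volume) {z : ℂ} (hz : z ≠ 0) :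
    MeasurableSet (φ ⁻¹' {z}) ∧ (volume : Measure (Space N)) (φ ⁻¹' {z}) < ∞ :=
  ⟨φ.measurableSet_fiber z,
    SimpleFunc.measure_preimage_lt_top_of_memLp (by norm_num) (by norm_num) φ hφ z hz⟩

theorem isGaussianProcess_re_simpleIntegral (hM : IsGaussianRandomMeasure P M) {T : Type*}
    {φ : T → SimpleFunc (Space N) ℂ} (hφ : ∀ t, MemLp (φ t) 2 volume) :
    IsGaussianProcess (fun t ω => (simpleIntegral M (φ t) ω).re) P := by
  classical
  refine hM.gaussian.of_isGaussianProcess fun t => ?_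
  let F : {z : ℂ // z ∈ (φ t).range.filter (· ≠ 0)} → FiniteSets N := fun z =>
    ⟨φ t ⁻¹' {z.1}, preimage_mem (hφ t) (Finset.mem_filter.1 z.2).2⟩
  let L : (Finset.univ.image F → ℂ) →ₗ[ℝ] ℝ :=
    ∑ z : {z : ℂ // z ∈ (φ t).range.filter (· ≠ 0)}, Complex.reLm ∘ₗ (LinearMap.mul ℝ ℂ z.1) ∘ₗ
      LinearMap.proj (R := ℝ) (φ := fun _ : Finset.univ.image F => ℂ)
        ⟨F z, Finset.mem_image_of_mem _ (Finset.mem_univ z)⟩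
  refine ⟨Finset.univ.image F, LinearMap.toContinuousLinearMap L, fun ω => ?_⟩
  simp only [simpleIntegral, LinearMap.coe_toContinuousLinearMap', L, LinearMap.sum_apply,
    LinearMap.comp_apply, LinearMap.proj_apply, Finset.restrict_def, LinearMap.mul_apply_apply,
    Complex.reLm_coe, Complex.re_sum, F]
  rw [Finset.sum_coe_sort ((φ t).range.filter (· ≠ 0)) fun z => (z * M (φ t ⁻¹' {z}) ω).re,
    Finset.sum_filter]
  refine Finset.sum_congr rfl fun z _ => ?_
  by_cases hz : z = 0 <;> simp [hz]

/-- The real part of the integral is an isometry up to symmetrization: the second term equals the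
first for a function `χ` with `χ(-ξ) = conj χ(ξ)`. -/
theorem integral_re_simpleIntegral_mul (hM : IsGaussianRandomMeasure P M)
    {φ χ : SimpleFunc (Space N) ℂ} (hφ : MemLp φ 2 volume) (hχ : MemLp χ 2 volume) :
    ∫ ω, (simpleIntegral M φ ω).re * (simpleIntegral M χ ω).re ∂P
      = ((∫ ξ, ⟪φ ξ, χ ξ⟫) + ∫ ξ, ⟪φ ξ, conj (χ (-ξ))⟫) / 2 := by
  have e1 : ∀ ξ, φ ξ = ∑ z ∈ φ.range, (φ ⁻¹' {z}).indicator (fun _ => z) ξ :=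
    simpleFunc_eq_sum_indicator φ
  have e2 : ∀ ξ, χ ξ = ∑ z ∈ χ.range, (χ ⁻¹' {z}).indicator (fun _ => z) ξ :=
    simpleFunc_eq_sum_indicator χ
  have e3 : ∀ ξ, conj (χ (-ξ))
      = ∑ z ∈ χ.range, (-(χ ⁻¹' {z})).indicator (fun _ => conj z) ξ := fun ξ => by
    rw [simpleFunc_eq_sum_indicator χ (-ξ), map_sum]
    refine Finset.sum_congr rfl fun z _ => ?_
    by_cases h : χ (-ξ) = z <;> simp [indicator, h]
  have hfin : ∀ z ∈ φ.range, z ≠ 0 → (volume : Measure (Space N)) (φ ⁻¹' {z}) < ∞ :=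
    fun z _ hz => (preimage_mem hφ hz).2
  have f1 := integral_inner_sum_indicator (μ := (volume : Measure (Space N))) φ.range χ.range
    id id (fun z => φ ⁻¹' {z}) (fun z => χ ⁻¹' {z}) (fun z _ => φ.measurableSet_fiber z)
    (fun z _ => χ.measurableSet_fiber z) hfin
  have f2 := integral_inner_sum_indicator (μ := (volume : Measure (Space N))) φ.range χ.range
    id conj (fun z => φ ⁻¹' {z}) (fun z => -(χ ⁻¹' {z})) (fun z _ => φ.measurableSet_fiber z)
    (fun z _ => (χ.measurableSet_fiber z).neg) hfin
  simp only [id_eq, ← e1, ← e2, ← e3] at f1 f2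
  rw [f1, f2]
  have hint : ∀ z ∈ φ.range, ∀ w ∈ χ.range,
      Integrable (fun ω => (z * M (φ ⁻¹' {z}) ω).re * (w * M (χ ⁻¹' {w}) ω).re) P :=
    fun z _ w _ => by
      by_cases hz : z = 0
      · simp [hz]
      by_cases hw : w = 0
      · simp [hw]
      have h1 := ((hM.memLp ⟨_, preimage_mem hφ hz⟩).const_mul z).re
      have h2 := ((hM.memLp ⟨_, preimage_mem hχ hw⟩).const_mul w).re
      exact h1.integrable_mul h2
  simp only [simpleIntegral, Complex.re_sum, Finset.sum_mul_sum]
  rw [integral_finsetSum _ fun z hz => integrable_finsetSum _ fun w hw => hint z hz w hw,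
    ← Finset.sum_add_distrib, Finset.sum_div]
  refine Finset.sum_congr rfl fun z hz => ?_
  rw [integral_finsetSum _ fun w hw => hint z hz w hw, ← Finset.sum_add_distrib, Finset.sum_div]
  refine Finset.sum_congr rfl fun w hw => ?_
  by_cases hz0 : z = 0
  · simp [hz0]
  by_cases hw0 : w = 0
  · simp [hw0]
  exact hM.integral_re_mul_re ⟨_, preimage_mem hφ hz0⟩ ⟨_, preimage_mem hχ hw0⟩ z w

theorem integral_re_simpleIntegral (hM : IsGaussianRandomMeasure P M)
    {φ : SimpleFunc (Space N) ℂ} (hφ : MemLp φ 2 volume) :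
    ∫ ω, (simpleIntegral M φ ω).re ∂P = 0 := by
  have hint : ∀ z ∈ φ.range, Integrable (fun ω => z * M (φ ⁻¹' {z}) ω) P := fun z _ => by
    have := (hM.gaussian).isProbabilityMeasure
    by_cases hz : z = 0
    · simp [hz]
    exact ((hM.memLp ⟨_, preimage_mem hφ hz⟩).integrable (by norm_num)).const_mul z
  have h := integral_re (integrable_finsetSum _ hint)
  simp only [RCLike.re_eq_complex_re] at h
  simp only [simpleIntegral]
  rw [h, integral_finsetSum _ hint]
  simp only [Complex.re_sum]
  refine Finset.sum_eq_zero fun z _ => ?_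
  by_cases hz : z = 0
  · simp [hz]
  rw [integral_const_mul, hM.centered ⟨_, preimage_mem hφ hz⟩]
  simp

end IsGaussianRandomMeasure

/-! ### The harmonizable field as a Gaussian process -/

variable {E : Matrix (Fin N) (Fin N) ℝ} {ψ : Space N → ℝ} {X : Space N → Ω → ℝ}

/-- The existence of the Wiener integrals contains the square integrability of the kernels, which
are limits in `L²` of simple functions. -/
theorem IsHarmonizableField.memLp_kernel (hψ : IsAdmissible E ψ)
    (hX : IsHarmonizableField P E ψ M X) (t : Space N) : MemLp (kernel E ψ t) 2 volume := by
  obtain ⟨Z, ⟨-, φ, hφ, hlim, -⟩, -⟩ := hX t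
  obtain ⟨n, hn⟩ := (hlim.eventually_lt_const one_pos).exists
  have h1 : MemLp (fun ξ => φ n ξ - kernel E ψ t ξ) 2 volume :=
    ⟨(φ n).aestronglyMeasurable.sub (measurable_kernel hψ t).aestronglyMeasurable,
      hn.trans ENNReal.one_lt_top⟩
  have h2 := (hφ n).sub h1
  refine h2.ae_eq (ae_of_all _ fun ξ => ?_)
  simp

theorem eLpNorm_comp_neg (f : Space N → ℂ) (hf : AEStronglyMeasurable f volume) :
    eLpNorm (fun ξ => f (-ξ)) 2 volume = eLpNorm f 2 volume :=
  eLpNorm_comp_measurePreserving hf (Measure.measurePreserving_neg volume)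

/-- The field is a centered Gaussian process, with covariance `∫ ⟪K_s, K_t⟫`. -/
theorem IsHarmonizableField.gaussian [IsProbabilityMeasure P]
    (hψ : IsAdmissible E ψ) (hM : IsGaussianRandomMeasure P M)
    (hX : IsHarmonizableField P E ψ M X) :
    IsGaussianProcess X P ∧ (∀ t, ∫ ω, X t ω ∂P = 0) ∧
      ∀ s t, ∫ ω, X s ω * X t ω ∂P = ∫ ξ, ⟪kernel E ψ s ξ, kernel E ψ t ξ⟫ := by
  have hK := fun t => hX.memLp_kernel hψ t
  choose Z hZ hXZ using hX
  choose hZ2 φ hφ hφlim hZlim using hZ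
  have hX2 : ∀ t, MemLp (X t) 2 P := fun t => (hZ2 t).re.ae_eq (hXZ t).symm
  have hG : ∀ n, IsGaussianProcess (fun t ω => (simpleIntegral M (φ t n) ω).re) P := fun n =>
    hM.isGaussianProcess_re_simpleIntegral fun t => hφ t n
  have hY2 : ∀ n t, MemLp (fun ω => (simpleIntegral M (φ t n) ω).re) 2 P := fun n t =>
    ((hG n).hasGaussianLaw_eval t).memLp_two
  have hlim : ∀ t, Tendsto (fun n => eLpNorm ((fun ω => (simpleIntegral M (φ t n) ω).re) - X t) 2 P)
      atTop (𝓝 0) := fun t => by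
    refine tendsto_of_tendsto_of_tendsto_of_le_of_le tendsto_const_nhds (hZlim t)
      (fun _ => zero_le) fun n => ?_
    refine eLpNorm_mono_ae ?_
    filter_upwards [hXZ t] with ω hω
    rw [Pi.sub_apply, hω, ← Complex.sub_re]
    exact Complex.abs_re_le_norm _
  refine ⟨isGaussianProcess_of_tendsto hG hX2 hlim, fun t => ?_, fun s t => ?_⟩
  · have h := tendsto_integral_of_L2 (fun n => hY2 n t) (hX2 t) (hlim t)
    simp only [hM.integral_re_simpleIntegral (hφ t _)] at h
    exact tendsto_nhds_unique h tendsto_const_nhds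
  · have h1 := tendsto_integral_inner (fun n => hY2 n s) (fun n => hY2 n t) (hX2 s) (hX2 t)
      (hlim s) (hlim t)
    simp only [RCLike.inner_apply, conj_trivial] at h1
    have h1' : Tendsto
        (fun n => ((∫ ξ, ⟪φ s n ξ, φ t n ξ⟫) + ∫ ξ, ⟪φ s n ξ, conj (φ t n (-ξ))⟫) / 2) atTop
        (𝓝 (∫ ω, X s ω * X t ω ∂P)) := by
      simp_rw [mul_comm (X s _)]
      refine h1.congr fun n => ?_
      rw [← hM.integral_re_simpleIntegral_mul (hφ s n) (hφ t n)]
      simp_rw [mul_comm]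
    have h2 := tendsto_integral_inner (hφ s) (hφ t) (hK s) (hK t) (hφlim s) (hφlim t)
    have hneg : ∀ n, MemLp (fun ξ => conj (φ t n (-ξ))) 2 volume := fun n => by
      have h := (hφ t n).comp_measurePreserving (Measure.measurePreserving_neg volume)
      exact h.congr_norm (Complex.continuous_conj.comp_aestronglyMeasurable h.1)
        (ae_of_all _ fun ω => by simp)
    have h3 := tendsto_integral_inner (hφ s) hneg (hK s) (hK t) (hφlim s) (by
      refine (hφlim t).congr fun n => ?_
      rw [← eLpNorm_comp_neg (fun ξ => φ t n ξ - kernel E ψ t ξ) ((hφ t n).sub (hK t)).1]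
      refine eLpNorm_congr_norm_ae (ae_of_all _ fun ξ => ?_)
      simp only [Pi.sub_apply, kernel_neg_right hψ]
      rw [← Complex.norm_conj, map_sub, Complex.conj_conj])
    have h4 := tendsto_nhds_unique h1' ((h2.add h3).div_const 2)
    rw [h4]
    ring

end

/-! ### Chaining -/

section

variable {Ω : Type*} [MeasurableSpace Ω] {P : Measure Ω}

theorem hasSubgaussianMGF_of_hasGaussianLaw [IsProbabilityMeasure P] {Z : Ω → ℝ}
    (hZ : HasGaussianLaw Z P) (h0 : ∫ ω, Z ω ∂P = 0) {v : ℝ} (hv : ∫ ω, Z ω ^ 2 ∂P ≤ v ^ 2) :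
    HasSubgaussianMGF Z (v ^ 2).toNNReal P := by
  have hvar : Var[Z; P] ≤ v ^ 2 := by
    rw [variance_of_integral_eq_zero hZ.aemeasurable h0]
    exact hv
  have hmap := hZ.map_eq_gaussianReal
  rw [h0] at hmap
  refine ⟨fun t => ?_, fun t => ?_⟩
  · have h := integrable_exp_mul_gaussianReal (μ := 0) (v := Var[Z; P].toNNReal) t
    rw [← hmap, integrable_map_measure (by fun_prop) hZ.aemeasurable] at h
    exact h
  · rw [mgf_gaussianReal hmap, Real.exp_le_exp, zero_mul, zero_add,
      Real.coe_toNNReal _ (variance_nonneg _ _), Real.coe_toNNReal _ (sq_nonneg v)]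
    gcongr

theorem measure_lt_abs_le [IsProbabilityMeasure P] {Z : Ω → ℝ}
    (hZ : HasGaussianLaw Z P) (h0 : ∫ ω, Z ω ∂P = 0) {v : ℝ} (hv : ∫ ω, Z ω ^ 2 ∂P ≤ v ^ 2)
    {u : ℝ} (hu : 0 ≤ u) :
    P {ω | u < |Z ω|} ≤ ENNReal.ofReal (2 * Real.exp (-u ^ 2 / (2 * v ^ 2))) := by
  have h := hasSubgaussianMGF_of_hasGaussianLaw hZ h0 hv
  have h1 := h.measure_ge_le hu
  have h2 := h.neg.measure_ge_le hu
  rw [Real.coe_toNNReal _ (sq_nonneg v)] at h1 h2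
  have hsub : {ω | u < |Z ω|} ⊆ {ω | u ≤ Z ω} ∪ {ω | u ≤ (-Z) ω} := fun ω hω => by
    rcases le_abs.1 (le_of_lt (show u < |Z ω| from hω)) with h | h
    · exact Or.inl h
    · exact Or.inr h
  refine (measure_mono hsub).trans ((measure_union_le _ _).trans ?_)
  rw [two_mul, ENNReal.ofReal_add (Real.exp_nonneg _) (Real.exp_nonneg _)]
  refine add_le_add ?_ ?_
  · rw [← ofReal_measureReal]; exact ENNReal.ofReal_le_ofReal h1
  · rw [← ofReal_measureReal]; exact ENNReal.ofReal_le_ofReal h2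

/-- The gauge `2⁻ⁿ √(n+1)` of the chaining argument. -/
def chainGauge (n : ℕ) : ℝ := (1 / 2) ^ n * √(n + 1)

theorem chainGauge_nonneg (n : ℕ) : 0 ≤ chainGauge n := by unfold chainGauge; positivity

theorem chainGauge_succ_le (n : ℕ) : chainGauge (n + 1) ≤ 3 / 4 * chainGauge n := by
  have h : √((n + 1 : ℕ) + 1 : ℝ) ≤ 3 / 2 * √(n + 1) := by
    rw [Real.sqrt_le_left (by positivity), mul_pow, Real.sq_sqrt (by positivity)]
    have : (0 : ℝ) ≤ n := Nat.cast_nonneg n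
    push_cast
    linarith
  unfold chainGauge
  rw [pow_succ]
  have : (0 : ℝ) < (1 / 2) ^ n := by positivity
  nlinarith

theorem chainGauge_add_le (n m : ℕ) : chainGauge (n + m) ≤ (3 / 4) ^ m * chainGauge n := by
  induction m with
  | zero => simp
  | succ m ih =>
    rw [← add_assoc, pow_succ]
    have := chainGauge_succ_le (n + m)
    linarith

theorem tendsto_chainGauge : Tendsto chainGauge atTop (𝓝 0) := by
  refine squeeze_zero chainGauge_nonneg (fun n => ?_)
    (tendsto_pow_atTop_nhds_zero_of_lt_one (by norm_num : (0 : ℝ) ≤ 3 / 4) (by norm_num))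
  have := chainGauge_add_le 0 n
  simpa [chainGauge] using this

/-- A real process with centered Gaussian increments whose standard deviations are given by `d`. -/
structure HasGaussianIncrements {T : Type*} (X : T → Ω → ℝ) (d : T → T → ℝ) (P : Measure Ω) :
    Prop where
  gaussian : ∀ s t, HasGaussianLaw (fun ω => X s ω - X t ω) P
  centered : ∀ s t, ∫ ω, (X s ω - X t ω) ∂P = 0
  variance : ∀ s t, ∫ ω, (X s ω - X t ω) ^ 2 ∂P = d s t ^ 2
  nonneg : ∀ s t, 0 ≤ d s t

namespace HasGaussianIncrements

variable {T : Type*} {X : T → Ω → ℝ} {d : T → T → ℝ}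

/-- A Borel–Cantelli estimate for exponentially many increments at scale `2⁻ⁿ`. -/
theorem ae_eventually_le [IsProbabilityMeasure P] (hX : HasGaussianIncrements X d P)
    {B K κ : ℝ} (hB : 1 ≤ B) (hκ : 0 ≤ κ) (hκB : 32 * Real.log (2 * B) ≤ κ ^ 2)
    (F : ℕ → Finset (T × T)) (hF : ∀ n, ((F n).card : ℝ) ≤ K * B ^ n)
    (hd : ∀ n, ∀ q ∈ F n, d q.1 q.2 ≤ 4 * (1 / 2) ^ n) :
    ∀ᵐ ω ∂P, ∀ᶠ n in atTop, ∀ q ∈ F n, |X q.1 ω - X q.2 ω| ≤ κ * chainGauge n := by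
  have hK : 0 ≤ K := by simpa using (Nat.cast_nonneg _).trans (hF 0)
  have hB0 : 0 < B := one_pos.trans_le hB
  set A : ℕ → Set Ω := fun n => ⋃ q ∈ F n, {ω | κ * chainGauge n < |X q.1 ω - X q.2 ω|}
  have hlog : 0 ≤ Real.log (2 * B) := Real.log_nonneg (by linarith)
  have hA : ∀ n, P (A n) ≤ ENNReal.ofReal (2 * K * (1 / 2) ^ n) := fun n => by
    have h1 : ∀ q ∈ F n, P {ω | κ * chainGauge n < |X q.1 ω - X q.2 ω|}
        ≤ ENNReal.ofReal (2 * (1 / (2 * B)) ^ n) := fun q hq => by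
      refine (measure_lt_abs_le (hX.gaussian _ _) (hX.centered _ _)
        (v := 4 * (1 / 2) ^ n) ?_ (mul_nonneg hκ (chainGauge_nonneg n))).trans ?_
      · rw [hX.variance]
        exact pow_le_pow_left₀ (hX.nonneg _ _) (hd n q hq) 2
      · refine ENNReal.ofReal_le_ofReal (mul_le_mul_of_nonneg_left ?_ zero_le_two)
        have e1 : -(κ * chainGauge n) ^ 2 / (2 * (4 * (1 / 2) ^ n) ^ 2)
            = -(κ ^ 2 * (n + 1) / 32) := by
          rw [chainGauge, mul_pow, mul_pow, Real.sq_sqrt (by positivity), mul_pow]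
          have : ((1 / 2 : ℝ) ^ n) ^ 2 ≠ 0 := by positivity
          field_simp
          ring
        have e2 : (1 / (2 * B)) ^ n = Real.exp (-(n * Real.log (2 * B))) := by
          rw [Real.exp_neg, Real.exp_nat_mul, Real.exp_log (by positivity), one_div, inv_pow]
        rw [e1, e2, Real.exp_le_exp, neg_le_neg_iff]
        have : (0 : ℝ) ≤ n := Nat.cast_nonneg n
        nlinarith [mul_nonneg this hlog]
    calc P (A n) ≤ ∑ q ∈ F n, P {ω | κ * chainGauge n < |X q.1 ω - X q.2 ω|} :=
          measure_biUnion_finset_le _ _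
      _ ≤ ∑ q ∈ F n, ENNReal.ofReal (2 * (1 / (2 * B)) ^ n) := Finset.sum_le_sum h1
      _ = ENNReal.ofReal ((F n).card * (2 * (1 / (2 * B)) ^ n)) := by
          rw [Finset.sum_const, nsmul_eq_mul, ENNReal.ofReal_mul (Nat.cast_nonneg _),
            ENNReal.ofReal_natCast]
      _ ≤ _ := by
          refine ENNReal.ofReal_le_ofReal ?_
          calc (F n).card * (2 * (1 / (2 * B)) ^ n) ≤ K * B ^ n * (2 * (1 / (2 * B)) ^ n) := by
                gcongr
                exact hF n
            _ = 2 * K * (1 / 2) ^ n := by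
                rw [one_div, mul_inv, mul_pow, inv_pow B]
                field_simp
  have hsum : ∑' n, P (A n) ≠ ∞ := by
    refine ne_top_of_le_ne_top ?_ (ENNReal.tsum_le_tsum hA)
    rw [← ENNReal.ofReal_tsum_of_nonneg (fun n => by positivity)
      ((summable_geometric_of_lt_one (by norm_num) (by norm_num)).mul_left _)]
    exact ENNReal.ofReal_ne_top
  filter_upwards [ae_eventually_notMem hsum] with ω hω
  filter_upwards [hω] with n hn q hq
  by_contra! h
  exact hn (mem_biUnion hq h)

/-- **Modulus of continuity by chaining.** If a countable set has nets of exponential size, then its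
increments over `d`-distance at most `2⁻ⁿ` are eventually of order `2⁻ⁿ √(n+1)`. -/
theorem exists_modulus [IsProbabilityMeasure P] (hX : HasGaussianIncrements X d P)
    (hsymm : ∀ s t, d s t = d t s) (htri : ∀ s t u, d s u ≤ d s t + d t u)
    {A K : ℝ} (hA : 1 ≤ A) (G : ℕ → Finset T) (hG : ∀ n, ((G n).card : ℝ) ≤ K * A ^ n)
    {D : Set T} (hD : D.Countable) (hcov : ∀ n, ∀ t ∈ D, ∃ g ∈ G n, d t g ≤ (1 / 2) ^ n) :
    ∃ C > 0, ∀ᵐ ω ∂P, ∀ᶠ n in atTop, ∀ s ∈ D, ∀ t ∈ D,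
      d s t ≤ (1 / 2) ^ n → |X s ω - X t ω| ≤ C * chainGauge n := by
  classical
  have hA2 : 1 ≤ A ^ 2 := one_le_pow₀ hA
  have hlog : 0 ≤ Real.log (2 * A ^ 2) := Real.log_nonneg (by linarith)
  set κ := √(32 * Real.log (2 * A ^ 2)) + 1
  have hκ : 0 < κ := by positivity
  have hκA : 32 * Real.log (2 * A ^ 2) ≤ κ ^ 2 := by
    have h1 := Real.sq_sqrt (by positivity : 0 ≤ 32 * Real.log (2 * A ^ 2))
    have h2 := Real.sqrt_nonneg (32 * Real.log (2 * A ^ 2))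
    nlinarith
  have hK : 0 ≤ K := by simpa using (Nat.cast_nonneg _).trans (hG 0)
  -- The pairs of `H n` contain the links of the chain within the net `G n` and from `G n` to
  -- `G (n + 1)`.
  set H : ℕ → Finset T := fun n => G n ∪ G (n + 1)
  have hH : ∀ n, ((H n).card : ℝ) ≤ K * (1 + A) * A ^ n := fun n => by
    calc ((H n).card : ℝ) ≤ (G n).card + (G (n + 1)).card := by
          exact_mod_cast Finset.card_union_le _ _
      _ ≤ K * A ^ n + K * A ^ (n + 1) := add_le_add (hG n) (hG (n + 1))
      _ = _ := by ring
  have hnet := hX.ae_eventually_le (K := (K * (1 + A)) ^ 2) hA2 hκ.le hκA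
    (fun n => (H n ×ˢ H n).filter fun q => d q.1 q.2 ≤ 4 * (1 / 2) ^ n)
    (fun n => by
      refine (Nat.cast_le.2 (Finset.card_filter_le _ _)).trans ?_
      rw [Finset.card_product, Nat.cast_mul, ← pow_mul, mul_comm 2 n, pow_mul, ← mul_pow, ← sq]
      exact pow_le_pow_left₀ (Nat.cast_nonneg _) (hH n) 2)
    (fun n q hq => (Finset.mem_filter.1 hq).2)
  choose! π hπG hπ using hcov
  have hpt : ∀ᵐ ω ∂P, ∀ t ∈ D, ∀ᶠ n in atTop, |X t ω - X (π n t) ω| ≤ κ * chainGauge n := by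
    refine (ae_ball_iff hD).2 fun t ht => ?_
    have h := hX.ae_eventually_le (K := 1) hA2 hκ.le hκA (fun n => {(t, π n t)})
      (fun n => by simpa using one_le_pow₀ hA2)
      (fun n q hq => by
        rw [Finset.mem_singleton] at hq
        subst hq
        have := hπ n t ht
        have h0 : (0 : ℝ) < (1 / 2) ^ n := by positivity
        simp only
        linarith)
    filter_upwards [h] with ω hω
    filter_upwards [hω] with n hn
    exact hn _ (Finset.mem_singleton_self _)
  refine ⟨9 * κ, by positivity, ?_⟩
  filter_upwards [hnet, hpt] with ω hω hωt
  obtain ⟨n₀, hn₀⟩ := eventually_atTop.1 hω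
  have hstep : ∀ t ∈ D, ∀ n ≥ n₀, |X (π n t) ω - X (π (n + 1) t) ω| ≤ κ * chainGauge n :=
    fun t ht n hn => by
      refine hn₀ n hn (π n t, π (n + 1) t) (Finset.mem_filter.2 ⟨Finset.mem_product.2 ⟨?_, ?_⟩, ?_⟩)
      · exact Finset.mem_union_left _ (hπG n t ht)
      · exact Finset.mem_union_right _ (hπG (n + 1) t ht)
      · have h1 := htri (π n t) t (π (n + 1) t)
        rw [hsymm _ t] at h1
        have h2 := hπ n t ht
        have h3 := hπ (n + 1) t ht
        have h0 : (0 : ℝ) < (1 / 2) ^ n := by positivity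
        rw [pow_succ] at h3
        simp only
        linarith
  have hchain : ∀ t ∈ D, ∀ m, ∀ n ≥ n₀,
      |X (π n t) ω - X (π (n + m) t) ω| ≤ 4 * κ * chainGauge n := fun t ht m => by
    induction m with
    | zero =>
      intro n _
      simpa using mul_nonneg (by positivity : 0 ≤ 4 * κ) (chainGauge_nonneg n)
    | succ m ih =>
      intro n hn
      have h1 := hstep t ht n hn
      have h2 := ih (n + 1) (by omega)
      rw [show n + 1 + m = n + (m + 1) by ring] at h2
      have h3 := abs_sub_le (X (π n t) ω) (X (π (n + 1) t) ω) (X (π (n + (m + 1)) t) ω)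
      have h4 := mul_le_mul_of_nonneg_left (chainGauge_succ_le n) (by positivity : 0 ≤ 4 * κ)
      linarith
  have hlim : ∀ t ∈ D, ∀ n ≥ n₀, |X (π n t) ω - X t ω| ≤ 4 * κ * chainGauge n :=
    fun t ht n hn => by
      have hten : Tendsto (fun m => X (π (n + m) t) ω) atTop (𝓝 (X t ω)) := by
        rw [tendsto_iff_dist_tendsto_zero]
        have hg : Tendsto (fun m => κ * chainGauge (n + m)) atTop (𝓝 0) := by
          have := (tendsto_chainGauge.comp (tendsto_add_atTop_nat n)).const_mul κ
          simpa [Function.comp_def, add_comm] using this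
        refine squeeze_zero' (Eventually.of_forall fun _ => dist_nonneg) ?_ hg
        have := (tendsto_add_atTop_nat n).eventually (hωt t ht)
        filter_upwards [this] with m hm
        rw [add_comm] at hm
        rwa [Real.dist_eq, abs_sub_comm]
      exact le_of_tendsto ((tendsto_const_nhds.sub hten).abs)
        (Eventually.of_forall fun m => hchain t ht m n hn)
  filter_upwards [eventually_ge_atTop n₀] with n hn s hs t ht hst
  have h0 : (0 : ℝ) < (1 / 2) ^ n := by positivity
  have h1 : |X (π n s) ω - X (π n t) ω| ≤ κ * chainGauge n := by
    refine hn₀ n hn (π n s, π n t) (Finset.mem_filter.2 ⟨Finset.mem_product.2 ⟨?_, ?_⟩, ?_⟩)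
    · exact Finset.mem_union_left _ (hπG n s hs)
    · exact Finset.mem_union_left _ (hπG n t ht)
    · have h1 := htri (π n s) s (π n t)
      have h2 := htri s t (π n t)
      rw [hsymm _ s] at h1
      have h3 := hπ n s hs
      have h4 := hπ n t ht
      simp only
      linarith
  have h2 := hlim s hs n hn
  have h3 := hlim t ht n hn
  have h4 := abs_sub_le (X s ω) (X (π n s) ω) (X t ω)
  have h5 := abs_sub_le (X (π n s) ω) (X (π n t) ω) (X t ω)
  rw [abs_sub_comm] at h2
  linarith

end HasGaussianIncrements

end

/-! ### Concentration of the maximum of a Gaussian vector -/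

section Rotation

variable {ι : Type*} [Fintype ι]

theorem exists_norm_eq_abs [Nonempty ι] (y : ι → ℝ) : ∃ i, ‖y‖ = |y i| := by
  obtain ⟨i, -, hi⟩ := Finset.exists_max_image Finset.univ (fun i => |y i|) Finset.univ_nonempty
  refine ⟨i, le_antisymm ?_ (norm_le_pi_norm y i)⟩
  exact (pi_norm_le_iff_of_nonneg (abs_nonneg _)).2 fun j => hi j (Finset.mem_univ j)

theorem rotation_neg_rotation (θ : ℝ) (z : (ι → ℝ) × (ι → ℝ)) :
    ContinuousLinearMap.rotation (-θ) (ContinuousLinearMap.rotation θ z) = z := by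
  have h := Real.sin_sq_add_cos_sq θ
  simp only [ContinuousLinearMap.rotation_apply, Real.cos_neg, Real.sin_neg]
  ext i
  · simp only [Pi.add_apply, Pi.smul_apply, smul_eq_mul]
    linear_combination (z.1 i) * h
  · simp only [Pi.add_apply, Pi.smul_apply, smul_eq_mul]
    linear_combination (z.2 i) * h

theorem rotation_rotation (θ η : ℝ) (z : (ι → ℝ) × (ι → ℝ)) :
    ContinuousLinearMap.rotation θ (ContinuousLinearMap.rotation η z)
      = ContinuousLinearMap.rotation (θ + η) z := by
  simp only [ContinuousLinearMap.rotation_apply, Real.cos_add, Real.sin_add]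
  ext i <;> simp only [Pi.add_apply, Pi.smul_apply, smul_eq_mul] <;> ring

variable {μ : Measure (ι → ℝ)} [IsGaussian μ]

/-- The mean loss `(cos δ ‖y‖ - ‖cos δ y + sin δ y'‖)⁺` in the norm under a rotation. The loss is at
most `|sin δ|` times the absolute value of the coordinate of `y'` at an index where the norm of `y`
is attained; this index is independent of `y'`. -/
theorem integral_rotation_loss_le {s : ℝ} (hs0 : 0 ≤ s) (hs : ∀ i, ∫ y, |y i| ∂μ ≤ s) (δ : ℝ) :
    ∫ z, max (Real.cos δ * ‖z.1‖ - ‖(ContinuousLinearMap.rotation δ z).1‖) 0 ∂(μ.prod μ)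
      ≤ |Real.sin δ| * s := by
  have hid : Integrable (fun y : ι → ℝ => y) μ := IsGaussian.integrable_fun_id
  have hi : ∀ i, Integrable (fun y : ι → ℝ => y i) μ := fun i => hid.eval i
  have hfst : Integrable (fun z : (ι → ℝ) × (ι → ℝ) => ‖z.1‖) (μ.prod μ) := hid.norm.comp_fst μ
  have hint : Integrable (fun z : (ι → ℝ) × (ι → ℝ) =>
      max (Real.cos δ * ‖z.1‖ - ‖(ContinuousLinearMap.rotation δ z).1‖) 0) (μ.prod μ) := by
    refine (hfst.const_mul |Real.cos δ|).mono' (by fun_prop) (ae_of_all _ fun z => ?_)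
    rw [Real.norm_of_nonneg (le_max_right _ _)]
    refine max_le ?_ (by positivity)
    have := mul_le_mul_of_nonneg_right (le_abs_self (Real.cos δ)) (norm_nonneg z.1)
    have := norm_nonneg (ContinuousLinearMap.rotation δ z).1
    linarith
  rw [integral_prod _ hint]
  have hinner : ∀ y : ι → ℝ, ∫ y', max (Real.cos δ * ‖y‖
      - ‖(ContinuousLinearMap.rotation δ (y, y')).1‖) 0 ∂μ ≤ |Real.sin δ| * s := fun y => by
    rcases isEmpty_or_nonempty ι with he | hne
    · have : ∀ y : ι → ℝ, ‖y‖ = 0 := fun y => by simp [Subsingleton.elim y 0]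
      simp only [this, mul_zero, sub_zero, max_self, integral_zero]
      positivity
    obtain ⟨j, hj⟩ := exists_norm_eq_abs y
    calc _ ≤ ∫ y', |Real.sin δ| * |y' j| ∂μ := by
          refine integral_mono_of_nonneg (ae_of_all _ fun _ => le_max_right _ _)
            ((hi j).abs.const_mul _) (ae_of_all _ fun y' => ?_)
          refine max_le ?_ (by positivity)
          have h1 := norm_le_pi_norm (ContinuousLinearMap.rotation δ (y, y')).1 j
          simp only [ContinuousLinearMap.rotation_apply, Pi.add_apply, Pi.smul_apply,
            smul_eq_mul, Real.norm_eq_abs] at h1 ⊢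
          have h2 : |Real.cos δ * y j| ≤ |Real.cos δ * y j + Real.sin δ * y' j|
              + |Real.sin δ * y' j| := by
            have := abs_sub (Real.cos δ * y j + Real.sin δ * y' j) (Real.sin δ * y' j)
            rwa [add_sub_cancel_right] at this
          rw [abs_mul, abs_mul (Real.sin δ)] at h2
          have h3 := mul_le_mul_of_nonneg_right (le_abs_self (Real.cos δ)) (abs_nonneg (y j))
          rw [hj]
          linarith
      _ = |Real.sin δ| * ∫ y', |y' j| ∂μ := integral_const_mul _ _
      _ ≤ _ := mul_le_mul_of_nonneg_left (hs j) (abs_nonneg _)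
  calc _ ≤ ∫ _, |Real.sin δ| * s ∂μ :=
        integral_mono hint.integral_prod_left (integrable_const _) hinner
    _ = _ := by simp

/-- The change of the norm under a rotation, from the losses under the rotation and its inverse; the
former preserves the product measure. -/
theorem integral_abs_norm_rotation_sub_le (hμ : μ[id] = 0) {s : ℝ} (hs0 : 0 ≤ s)
    (hs : ∀ i, ∫ y, |y i| ∂μ ≤ s) (δ : ℝ) :
    ∫ z, |‖(ContinuousLinearMap.rotation δ z).1‖ - ‖z.1‖| ∂(μ.prod μ)
      ≤ 2 * (1 - Real.cos δ) * ∫ y, ‖y‖ ∂μ + 2 * |Real.sin δ| * s := by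
  set R := ContinuousLinearMap.rotation (E := ι → ℝ) δ with hR
  have hid : Integrable (fun y : ι → ℝ => y) μ := IsGaussian.integrable_fun_id
  have hfst : Integrable (fun z : (ι → ℝ) × (ι → ℝ) => ‖z.1‖) (μ.prod μ) := hid.norm.comp_fst μ
  have hmp : MeasurePreserving R (μ.prod μ) (μ.prod μ) :=
    ⟨by fun_prop, IsGaussian.map_rotation_eq_self hμ δ⟩
  have hRfst : Integrable (fun z => ‖(R z).1‖) (μ.prod μ) := by
    rw [← hmp.map_eq] at hfst
    exact hfst.comp_measurable hmp.measurable
  set h : ℝ → (ι → ℝ) × (ι → ℝ) → ℝ := fun η z =>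
    max (Real.cos η * ‖z.1‖ - ‖(ContinuousLinearMap.rotation η z).1‖) 0 with hh
  have hint : ∀ η, Integrable (h η) (μ.prod μ) := fun η => by
    refine (hfst.const_mul |Real.cos η|).mono' (by fun_prop) (ae_of_all _ fun z => ?_)
    rw [Real.norm_of_nonneg (le_max_right _ _)]
    refine max_le ?_ (by positivity)
    have := mul_le_mul_of_nonneg_right (le_abs_self (Real.cos η)) (norm_nonneg z.1)
    have := norm_nonneg (ContinuousLinearMap.rotation η z).1
    linarith
  have hintR : Integrable (fun z => h (-δ) (R z)) (μ.prod μ) := by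
    have := hint (-δ)
    rw [← hmp.map_eq] at this
    exact this.comp_measurable hmp.measurable
  have hpt : ∀ z, |‖(R z).1‖ - ‖z.1‖|
      ≤ (1 - Real.cos δ) * (‖z.1‖ + ‖(R z).1‖) + (h δ z + h (-δ) (R z)) := fun z => by
    have h1 : Real.cos δ * ‖z.1‖ - ‖(R z).1‖ ≤ h δ z := le_max_left _ _
    have h2 : Real.cos (-δ) * ‖(R z).1‖ - ‖(ContinuousLinearMap.rotation (-δ) (R z)).1‖
        ≤ h (-δ) (R z) := le_max_left _ _
    rw [hR, rotation_neg_rotation, Real.cos_neg, ← hR] at h2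
    have h3 : 0 ≤ h δ z := le_max_right _ _
    have h4 : 0 ≤ h (-δ) (R z) := le_max_right _ _
    have h5 := Real.cos_le_one δ
    have h6 := mul_nonneg (sub_nonneg.2 h5) (norm_nonneg z.1)
    have h7 := mul_nonneg (sub_nonneg.2 h5) (norm_nonneg (R z).1)
    rw [abs_le]
    constructor <;> nlinarith
  have e1 : ∫ z, ‖(R z).1‖ ∂(μ.prod μ) = ∫ y, ‖y‖ ∂μ := by
    have h1 : ∫ z, ‖(R z).1‖ ∂(μ.prod μ) = ∫ z, ‖z.1‖ ∂(μ.prod μ) := by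
      conv_rhs => rw [← hmp.map_eq]
      rw [integral_map hmp.measurable.aemeasurable (by fun_prop)]
    rw [h1, integral_fun_fst (fun y : ι → ℝ => ‖y‖)]
    simp
  have e2 : ∫ z, ‖z.1‖ ∂(μ.prod μ) = ∫ y, ‖y‖ ∂μ := by
    rw [integral_fun_fst (fun y : ι → ℝ => ‖y‖)]
    simp
  have e3 : ∫ z, h (-δ) (R z) ∂(μ.prod μ) = ∫ z, h (-δ) z ∂(μ.prod μ) := by
    conv_rhs => rw [← hmp.map_eq]
    rw [integral_map hmp.measurable.aemeasurable]
    exact (by fun_prop : Continuous (h (-δ))).aestronglyMeasurable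
  have i0 : Integrable (fun z : (ι → ℝ) × (ι → ℝ) => ‖z.1‖ + ‖(R z).1‖) (μ.prod μ) :=
    hfst.add hRfst
  have i1 : Integrable (fun z => (1 - Real.cos δ) * (‖z.1‖ + ‖(R z).1‖)) (μ.prod μ) :=
    i0.const_mul _
  have i2 : Integrable (fun z => h δ z + h (-δ) (R z)) (μ.prod μ) := (hint δ).add hintR
  have b1 := integral_rotation_loss_le hs0 hs δ
  have b2 := integral_rotation_loss_le hs0 hs (-δ)
  rw [Real.sin_neg, abs_neg] at b2
  calc _ ≤ ∫ z, ((1 - Real.cos δ) * (‖z.1‖ + ‖(R z).1‖) + (h δ z + h (-δ) (R z))) ∂(μ.prod μ) :=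
        integral_mono (hRfst.sub hfst).abs (i1.add i2) hpt
    _ = (1 - Real.cos δ) * (∫ y, ‖y‖ ∂μ + ∫ y, ‖y‖ ∂μ)
        + (∫ z, h δ z ∂(μ.prod μ) + ∫ z, h (-δ) z ∂(μ.prod μ)) := by
        rw [integral_add i1 i2, integral_const_mul,
          integral_add hfst hRfst, e1, e2, integral_add (hint δ) hintR, e3]
    _ ≤ _ := by
        have b1' : ∫ z, h δ z ∂(μ.prod μ) ≤ |Real.sin δ| * s := b1
        have b2' : ∫ z, h (-δ) z ∂(μ.prod μ) ≤ |Real.sin δ| * s := b2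
        linarith

/-- **Concentration of the norm.** The norms of two independent copies of a centered Gaussian vector
differ in mean by at most `π` times the largest first absolute moment of a coordinate, whatever the
number of coordinates: the quarter turn that exchanges the copies is split into small rotations. -/
theorem integral_abs_norm_sub_norm_le (hμ : μ[id] = 0) {s : ℝ} (hs0 : 0 ≤ s)
    (hs : ∀ i, ∫ y, |y i| ∂μ ≤ s) :
    ∫ z, |‖z.2‖ - ‖z.1‖| ∂(μ.prod μ) ≤ Real.pi * s := by
  have hid : Integrable (fun y : ι → ℝ => y) μ := IsGaussian.integrable_fun_id
  have hfst : Integrable (fun z : (ι → ℝ) × (ι → ℝ) => ‖z.1‖) (μ.prod μ) := hid.norm.comp_fst μ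
  have hmp : ∀ θ, MeasurePreserving (ContinuousLinearMap.rotation (E := ι → ℝ) θ)
      (μ.prod μ) (μ.prod μ) := fun θ => ⟨by fun_prop, IsGaussian.map_rotation_eq_self hμ θ⟩
  have hRfst : ∀ θ, Integrable (fun z => ‖(ContinuousLinearMap.rotation (E := ι → ℝ) θ z).1‖)
      (μ.prod μ) := fun θ => by
    have h := hfst
    rw [← (hmp θ).map_eq] at h
    exact h.comp_measurable (hmp θ).measurable
  set m := ∫ y, ‖y‖ ∂μ with hm
  have hm0 : 0 ≤ m := integral_nonneg fun _ => norm_nonneg _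
  have htel : ∀ δ : ℝ, ∀ n : ℕ,
      ∫ z, |‖(ContinuousLinearMap.rotation (E := ι → ℝ) (n * δ) z).1‖ - ‖z.1‖| ∂(μ.prod μ)
        ≤ n * (2 * (1 - Real.cos δ) * m + 2 * |Real.sin δ| * s) := fun δ n => by
    induction n with
    | zero => simp [ContinuousLinearMap.rotation_apply]
    | succ n ih =>
      have h1 : ∫ z, |‖(ContinuousLinearMap.rotation (E := ι → ℝ) ((n + 1 : ℕ) * δ) z).1‖
          - ‖(ContinuousLinearMap.rotation (E := ι → ℝ) (n * δ) z).1‖| ∂(μ.prod μ)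
          ≤ 2 * (1 - Real.cos δ) * m + 2 * |Real.sin δ| * s := by
        refine le_of_eq_of_le ?_ (integral_abs_norm_rotation_sub_le hμ hs0 hs δ)
        conv_rhs => rw [← (hmp (n * δ)).map_eq]
        rw [integral_map (hmp (n * δ)).measurable.aemeasurable
          (by fun_prop : Continuous _).aestronglyMeasurable]
        simp_rw [rotation_rotation]
        rw [show δ + n * δ = (n + 1 : ℕ) * δ by push_cast; ring]
      have i1 : Integrable (fun z =>
          |‖(ContinuousLinearMap.rotation (E := ι → ℝ) ((n + 1 : ℕ) * δ) z).1‖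
            - ‖(ContinuousLinearMap.rotation (E := ι → ℝ) (n * δ) z).1‖|) (μ.prod μ) :=
        ((hRfst _).sub (hRfst _)).abs
      have i2 : Integrable (fun z =>
          |‖(ContinuousLinearMap.rotation (E := ι → ℝ) (n * δ) z).1‖ - ‖z.1‖|) (μ.prod μ) :=
        ((hRfst _).sub hfst).abs
      have h2 : ∫ z, |‖(ContinuousLinearMap.rotation (E := ι → ℝ) ((n + 1 : ℕ) * δ) z).1‖ - ‖z.1‖|
          ∂(μ.prod μ)
          ≤ ∫ z, (|‖(ContinuousLinearMap.rotation (E := ι → ℝ) ((n + 1 : ℕ) * δ) z).1‖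
            - ‖(ContinuousLinearMap.rotation (E := ι → ℝ) (n * δ) z).1‖|
            + |‖(ContinuousLinearMap.rotation (E := ι → ℝ) (n * δ) z).1‖ - ‖z.1‖|) ∂(μ.prod μ) :=
        integral_mono ((hRfst _).sub hfst).abs (i1.add i2) fun z => abs_sub_le _ _ _
      rw [integral_add i1 i2] at h2
      push_cast at h1 h2 ⊢
      linarith
  have hquarter : ∀ n : ℕ, 0 < n → ∫ z, |‖z.2‖ - ‖z.1‖| ∂(μ.prod μ)
      ≤ (Real.pi / 2) ^ 2 * m / n + Real.pi * s := fun n hn => by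
    have hn' : (0 : ℝ) < n := by exact_mod_cast hn
    set δ := Real.pi / 2 / n with hδ
    have hδ0 : 0 < δ := by have := Real.pi_pos; positivity
    have h := htel δ n
    rw [show n * δ = Real.pi / 2 by rw [hδ]; field_simp] at h
    simp only [ContinuousLinearMap.rotation_apply, Real.cos_pi_div_two, Real.sin_pi_div_two,
      zero_smul, one_smul, zero_add] at h
    refine h.trans ?_
    have h1 := Real.one_sub_sq_div_two_le_cos (x := δ)
    have h2 : |Real.sin δ| ≤ δ := (Real.abs_sin_le_abs).trans_eq (abs_of_pos hδ0)
    calc n * (2 * (1 - Real.cos δ) * m + 2 * |Real.sin δ| * s)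
        ≤ n * (2 * (δ ^ 2 / 2) * m + 2 * δ * s) := by
          gcongr
          linarith
      _ = _ := by rw [hδ]; field_simp
  have hlim : Tendsto (fun n : ℕ => (Real.pi / 2) ^ 2 * m / n + Real.pi * s) atTop
      (𝓝 (0 + Real.pi * s)) :=
    (tendsto_const_div_atTop_nhds_zero_nat _).add_const _
  rw [zero_add] at hlim
  exact ge_of_tendsto hlim ((eventually_gt_atTop 0).mono hquarter)

end Rotation

/-! ### A zero-one law for Gaussian suprema -/

section Oscillation

variable {α : Type*} [MeasurableSpace α] {ν : Measure α} [IsProbabilityMeasure ν]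

/-- The mean difference `E|g(y') ∧ K - g(y) ∧ K|` for independent `y`, `y'` with law `ν`. -/
def meanDifference (ν : Measure α) (K : ℕ) (g : α → ℝ≥0∞) : ℝ :=
  ∫ z, |(min (g z.2) K).toReal - (min (g z.1) K).toReal| ∂(ν.prod ν)

theorem min_natCast_ne_top (x : ℝ≥0∞) (K : ℕ) : min x K ≠ ∞ :=
  ne_top_of_le_ne_top (ENNReal.natCast_ne_top K) (min_le_right _ _)

theorem toReal_min_natCast_le (x : ℝ≥0∞) (K : ℕ) : (min x K).toReal ≤ K := by
  have h := ENNReal.toReal_mono (ENNReal.natCast_ne_top K) (min_le_right x (K : ℝ≥0∞))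
  rwa [ENNReal.toReal_natCast] at h

theorem abs_toReal_min_sub_le (x y : ℝ≥0∞) (K : ℕ) :
    |(min x K).toReal - (min y K).toReal| ≤ K := by
  have h1 := toReal_min_natCast_le x K
  have h2 := toReal_min_natCast_le y K
  have h3 : 0 ≤ (min x K).toReal := ENNReal.toReal_nonneg
  have h4 : 0 ≤ (min y K).toReal := ENNReal.toReal_nonneg
  rw [abs_le]
  constructor <;> linarith

theorem measurable_truncated_difference {g : α → ℝ≥0∞} (hg : Measurable g) (K : ℕ) :
    Measurable fun z : α × α => |(min (g z.2) K).toReal - (min (g z.1) K).toReal| := by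
  have h1 : Measurable fun z : α × α => (min (g z.2) K).toReal := by fun_prop
  have h2 : Measurable fun z : α × α => (min (g z.1) K).toReal := by fun_prop
  exact continuous_abs.measurable.comp (h1.sub h2)

theorem tendsto_meanDifference {g : ℕ → α → ℝ≥0∞} {g' : α → ℝ≥0∞} (hg : ∀ n, Measurable (g n))
    (h : ∀ y, Tendsto (fun n => g n y) atTop (𝓝 (g' y))) (K : ℕ) :
    Tendsto (fun n => meanDifference ν K (g n)) atTop (𝓝 (meanDifference ν K g')) := by
  refine tendsto_integral_of_dominated_convergence (fun _ => (K : ℝ))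
    (fun n => (measurable_truncated_difference (hg n) K).aestronglyMeasurable)
    (integrable_const _) (fun n => ae_of_all _ fun z => ?_) (ae_of_all _ fun z => ?_)
  · rw [Real.norm_eq_abs, abs_abs]
    exact abs_toReal_min_sub_le _ _ _
  · have hlim : ∀ y, Tendsto (fun n => (min (g n y) K).toReal) atTop (𝓝 (min (g' y) K).toReal) :=
      fun y => (ENNReal.tendsto_toReal (min_natCast_ne_top _ K)).comp
        ((h y).min tendsto_const_nhds)
    exact ((hlim z.2).sub (hlim z.1)).abs

/-- A function that takes the same value at two independent points is almost surely constant. -/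
theorem exists_ae_eq_const_of_meanDifference_le {g : α → ℝ≥0∞} (hg : Measurable g)
    (h : ∀ K, meanDifference ν K g ≤ 0) : ∃ c, ∀ᵐ y ∂ν, g y = c := by
  have h1 : ∀ K : ℕ, ∀ᵐ z ∂(ν.prod ν),
      (min (g z.2) K).toReal = (min (g z.1) K).toReal := fun K => by
    have hm := measurable_truncated_difference hg K
    have hint : Integrable (fun z : α × α => |(min (g z.2) K).toReal - (min (g z.1) K).toReal|)
        (ν.prod ν) := by
      refine (integrable_const (K : ℝ)).mono' hm.aestronglyMeasurable (ae_of_all _ fun z => ?_)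
      rw [Real.norm_eq_abs, abs_abs]
      exact abs_toReal_min_sub_le _ _ _
    have h0 := (integral_eq_zero_iff_of_nonneg (fun _ => abs_nonneg _) hint).1
      (le_antisymm (h K) (integral_nonneg fun _ => abs_nonneg _))
    filter_upwards [h0] with z hz
    exact sub_eq_zero.1 (abs_eq_zero.1 hz)
  have h2 : ∀ᵐ y ∂ν, ∀ᵐ y' ∂ν, ∀ K : ℕ, (min (g y') K).toReal = (min (g y) K).toReal := by
    exact Measure.ae_ae_of_ae_prod (ae_all_iff.2 h1)
  obtain ⟨y, hy⟩ := h2.exists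
  refine ⟨g y, ?_⟩
  filter_upwards [hy] with y' hy'
  have hlim : ∀ x : ℝ≥0∞, Tendsto (fun K : ℕ => min x (K : ℝ≥0∞)) atTop (𝓝 x) := fun x => by
    have := (tendsto_const_nhds (x := x)).min ENNReal.tendsto_nat_nhds_top
    rwa [min_top_right] at this
  refine tendsto_nhds_unique (hlim (g y')) ((hlim (g y)).congr fun K => ?_)
  exact ((ENNReal.toReal_eq_toReal_iff' (min_natCast_ne_top _ _) (min_natCast_ne_top _ _)).1
    (hy' K)).symm

end Oscillation

theorem enorm_restrict_eq {ι : Type*} (I : Finset ι) (y : ι → ℝ) :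
    ‖I.restrict y‖ₑ = ⨆ p ∈ I, ‖y p‖ₑ := by
  refine le_antisymm ?_ (iSup₂_le fun p hp => ?_)
  · rcases isEmpty_or_nonempty I with he | hne
    · simp [Subsingleton.elim (I.restrict y) 0]
    obtain ⟨p, hp⟩ := exists_norm_eq_abs (I.restrict y)
    refine le_iSup₂_of_le p.1 p.2 ?_
    rw [← ofReal_norm, hp, ← ofReal_norm]
    rfl
  · rw [← ofReal_norm, ← ofReal_norm]
    exact ENNReal.ofReal_le_ofReal (norm_le_pi_norm (I.restrict y) ⟨p, hp⟩)

/-- **Zero-one law.** For a centered Gaussian process over a countable set and decreasing index sets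
over which the first absolute moments tend uniformly to zero, the limit of the suprema is almost
surely constant. -/
theorem exists_ae_iInf_iSup_eq {ι : Type*} [Countable ι] {ν : Measure (ι → ℝ)}
    [IsProbabilityMeasure ν] (hG : IsGaussianProcess (fun (p : ι) (y : ι → ℝ) => y p) ν)
    (h0 : ∀ p, ∫ y, y p ∂ν = 0) {J : ℕ → Set ι} (hJ : Antitone J) {s : ℕ → ℝ}
    (hs0 : ∀ k, 0 ≤ s k) (hs : ∀ k, ∀ p ∈ J k, ∫ y, |y p| ∂ν ≤ s k)
    (hlim : Tendsto s atTop (𝓝 0)) :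
    ∃ c : ℝ≥0∞, ∀ᵐ y ∂ν, ⨅ k, ⨆ p ∈ J k, ‖y p‖ₑ = c := by
  classical
  obtain ⟨f, hf⟩ := exists_injective_nat ι
  have hfin : ∀ n, {p | f p ≤ n}.Finite := fun n => (finite_Iic n).preimage hf.injOn
  set I : ℕ → ℕ → Finset ι := fun k n => (hfin n).toFinset.filter (· ∈ J k) with hI
  have hmemI : ∀ k n p, p ∈ I k n ↔ f p ≤ n ∧ p ∈ J k := fun k n p => by
    simp [hI, Finset.mem_filter]
  have hmean : ∀ K k n, meanDifference ν K (fun y => ‖(I k n).restrict y‖ₑ) ≤ Real.pi * s k :=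
    fun K k n => by
      set μ := ν.map (I k n).restrict
      have : IsGaussian μ := (hG.hasGaussianLaw (I k n)).isGaussian_map
      have hr : Measurable ((I k n).restrict : (ι → ℝ) → (I k n → ℝ)) := by fun_prop
      have hint : Integrable (fun y : I k n → ℝ => y) μ := IsGaussian.integrable_fun_id
      have hμ0 : μ[id] = 0 := by
        ext i
        show (∫ y : I k n → ℝ, y ∂μ) i = 0
        rw [eval_integral fun i => hint.eval i,
          integral_map hr.aemeasurable (measurable_pi_apply i).aestronglyMeasurable]
        exact h0 i
      have hμs : ∀ i, ∫ y, |y i| ∂μ ≤ s k := fun i => by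
        rw [integral_map (f := fun y : I k n → ℝ => |y i|) hr.aemeasurable
          (continuous_abs.measurable.comp (measurable_pi_apply i)).aestronglyMeasurable]
        exact hs k i ((hmemI k n i).1 i.2).2
      have hmain := integral_abs_norm_sub_norm_le hμ0 (hs0 k) hμs
      refine le_trans ?_ hmain
      have hprod : μ.prod μ = (ν.prod ν).map (Prod.map (I k n).restrict (I k n).restrict) :=
        Measure.map_prod_map _ _ hr hr
      have hintn : Integrable (fun z : (I k n → ℝ) × (I k n → ℝ) => |‖z.2‖ - ‖z.1‖|) (μ.prod μ) :=
        ((hint.norm.comp_snd μ).sub (hint.norm.comp_fst μ)).abs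
      rw [hprod] at hintn ⊢
      rw [integral_map (by fun_prop) (by fun_prop)]
      refine integral_mono_of_nonneg (ae_of_all _ fun _ => abs_nonneg _)
        (hintn.comp_measurable (by fun_prop)) (ae_of_all _ fun z => ?_)
      have e : ∀ x : I k n → ℝ, (min ‖x‖ₑ (K : ℝ≥0∞)).toReal = min ‖x‖ K := fun x => by
        rw [ENNReal.toReal_min enorm_ne_top (ENNReal.natCast_ne_top K), toReal_enorm,
          ENNReal.toReal_natCast]
      simp only [e, Prod.map_fst, Prod.map_snd]
      refine (abs_min_sub_min_le_max _ _ _ _).trans ?_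
      rw [sub_self, abs_zero, max_eq_left (abs_nonneg _)]
  have hSmeas : ∀ k, Measurable fun y : ι → ℝ => ⨆ p ∈ J k, ‖y p‖ₑ := fun k =>
    Measurable.biSup _ (J k).to_countable fun p _ => by fun_prop
  have hn : ∀ k (y : ι → ℝ),
      Tendsto (fun n => ‖(I k n).restrict y‖ₑ) atTop (𝓝 (⨆ p ∈ J k, ‖y p‖ₑ)) :=
    fun k y => by
      have hmono : Monotone fun n => ‖(I k n).restrict y‖ₑ := fun n m hnm => by
        simp only [enorm_restrict_eq]
        refine biSup_mono fun p hp => ?_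
        rw [hmemI] at hp ⊢
        exact ⟨hp.1.trans hnm, hp.2⟩
      have := tendsto_atTop_iSup hmono
      convert this using 2
      simp only [enorm_restrict_eq]
      refine le_antisymm (iSup₂_le fun p hp => ?_) (iSup_le fun n => iSup₂_le fun p hp => ?_)
      · exact le_iSup_of_le (f p) (le_iSup₂_of_le p ((hmemI _ _ _).2 ⟨le_rfl, hp⟩) le_rfl)
      · exact le_iSup₂_of_le p ((hmemI _ _ _).1 hp).2 le_rfl
  have hk : ∀ y : ι → ℝ, Tendsto (fun k => ⨆ p ∈ J k, ‖y p‖ₑ) atTop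
      (𝓝 (⨅ k, ⨆ p ∈ J k, ‖y p‖ₑ)) := fun y =>
    tendsto_atTop_iInf fun k m hkm => biSup_mono fun p hp => hJ hkm hp
  -- The bound on the mean differences passes from finite subsets to `J k`, then to the limit.
  refine exists_ae_eq_const_of_meanDifference_le (Measurable.iInf hSmeas) fun K => ?_
  have h1 : ∀ k, meanDifference ν K (fun y => ⨆ p ∈ J k, ‖y p‖ₑ) ≤ Real.pi * s k := fun k =>
    le_of_tendsto (tendsto_meanDifference
      (fun n => (measurable_enorm.comp (Finset.measurable_restrict (I k n)))) (hn k) K)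
      (Eventually.of_forall fun n => hmean K k n)
  have h2 := hlim.const_mul Real.pi
  rw [mul_zero] at h2
  exact le_of_tendsto_of_tendsto' (tendsto_meanDifference hSmeas hk K) h2 h1

theorem integral_strongDual_restrict {ι Ω : Type*} [MeasurableSpace Ω] {P : Measure Ω}
    {Z : ι → Ω → ℝ} (hZ : ∀ p, Integrable (Z p) P) (hZ0 : ∀ p, ∫ ω, Z p ω ∂P = 0) (I : Finset ι)
    (L : StrongDual ℝ (I → ℝ)) : ∫ ω, L (I.restrict (Z · ω)) ∂P = 0 := by
  classical
  simp_rw [strongDual_restrict_eq_sum]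
  rw [integral_finsetSum (Finset.univ : Finset I) fun i _ => (hZ i).const_mul _]
  refine Finset.sum_eq_zero fun i _ => ?_
  rw [integral_const_mul, hZ0, mul_zero]

theorem integral_strongDual_restrict_sq {ι Ω : Type*} [MeasurableSpace Ω] {P : Measure Ω}
    {Z : ι → Ω → ℝ} (hZ : ∀ p, MemLp (Z p) 2 P) (I : Finset ι) [DecidableEq I]
    (L : StrongDual ℝ (I → ℝ)) : ∫ ω, L (I.restrict (Z · ω)) ^ 2 ∂P
      = ∑ i : I, ∑ j : I, L (Pi.single i 1) * L (Pi.single j 1) * ∫ ω, Z i ω * Z j ω ∂P := by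
  have hsq : ∀ ω, L (I.restrict (Z · ω)) ^ 2
      = ∑ i : I, ∑ j : I, L (Pi.single i 1) * L (Pi.single j 1) * (Z i ω * Z j ω) := fun ω => by
    rw [strongDual_restrict_eq_sum, sq, Finset.sum_mul_sum]
    refine Finset.sum_congr rfl fun i _ => Finset.sum_congr rfl fun j _ => by ring
  have hint : ∀ i j : I, Integrable
      (fun ω => L (Pi.single i 1) * L (Pi.single j 1) * (Z i ω * Z j ω)) P := fun i j =>
    ((hZ i).integrable_mul (hZ j)).const_mul _
  simp_rw [hsq]
  rw [integral_finsetSum (Finset.univ : Finset I) fun i _ =>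
    integrable_finsetSum (Finset.univ : Finset I) fun j _ => hint i j]
  refine Finset.sum_congr rfl fun i _ => ?_
  rw [integral_finsetSum (Finset.univ : Finset I) fun j _ => hint i j]
  refine Finset.sum_congr rfl fun j _ => integral_const_mul _ _

/-- The law of a centered Gaussian process is determined by its covariance. -/
theorem map_eq_of_covariance_eq {ι Ω Ω' : Type*} [Countable ι] [MeasurableSpace Ω]
    [MeasurableSpace Ω'] {P : Measure Ω} {P' : Measure Ω'} [IsProbabilityMeasure P]
    [IsProbabilityMeasure P'] {Y : ι → Ω → ℝ} {Y' : ι → Ω' → ℝ} (hY : IsGaussianProcess Y P)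
    (hY' : IsGaussianProcess Y' P') (h0 : ∀ p, ∫ ω, Y p ω ∂P = 0) (h0' : ∀ p, ∫ ω, Y' p ω ∂P' = 0)
    (hcov : ∀ p q, ∫ ω, Y p ω * Y q ω ∂P = ∫ ω, Y' p ω * Y' q ω ∂P') :
    P.map (fun ω p => Y p ω) = P'.map (fun ω p => Y' p ω) := by
  classical
  have l1 := isProjectiveLimit_map (X := Y) (aemeasurable_pi_lambda _ fun p => hY.aemeasurable p)
  have l2 := isProjectiveLimit_map (X := Y') (aemeasurable_pi_lambda _ fun p => hY'.aemeasurable p)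
  have hI : ∀ I : Finset ι, P.map (fun ω => I.restrict (Y · ω))
      = P'.map (fun ω => I.restrict (Y' · ω)) := fun I => by
    have g1 := (hY.hasGaussianLaw I).isGaussian_map
    have g2 := (hY'.hasGaussianLaw I).isGaussian_map
    refine Measure.ext_of_charFunDual (funext fun L => ?_)
    rw [(hY.hasGaussianLaw I).charFunDual_map_eq_fun, (hY'.hasGaussianLaw I).charFunDual_map_eq_fun]
    have m1 : ∀ p, MemLp (Y p) 2 P := fun p => (hY.hasGaussianLaw_eval p).memLp_two
    have m2 : ∀ p, MemLp (Y' p) 2 P' := fun p => (hY'.hasGaussianLaw_eval p).memLp_two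
    have a1 := integral_strongDual_restrict (fun p => (m1 p).integrable (by norm_num)) h0 I L
    have a2 := integral_strongDual_restrict (fun p => (m2 p).integrable (by norm_num)) h0' I L
    rw [a1, a2,
      variance_of_integral_eq_zero (((hY.hasGaussianLaw I).map_fun L).aemeasurable) a1,
      variance_of_integral_eq_zero (((hY'.hasGaussianLaw I).map_fun L).aemeasurable) a2,
      integral_strongDual_restrict_sq m1, integral_strongDual_restrict_sq m2]
    simp_rw [hcov]
  have : ∀ I : Finset ι, IsFiniteMeasure (P.map (fun ω => I.restrict (Y · ω))) := fun I =>
    inferInstance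
  simp_rw [← hI] at l2
  exact l1.unique l2

/-! ### A lower bound for the maximum of weakly correlated Gaussian variables -/

section

/-- Comparison of the densities of `N(lam, 1)` and `N(0, 1)` on a half-line. -/
theorem gaussianReal_shift_le {lam m : ℝ} (hl : 0 ≤ lam) {C : Set ℝ} (hC : MeasurableSet C)
    (hCm : C ⊆ Iic (lam + m)) :
    gaussianReal lam 1 C
      ≤ ENNReal.ofReal (Real.exp (lam ^ 2 / 2 + lam * m)) * gaussianReal 0 1 C := by
  rw [gaussianReal_apply _ one_ne_zero, gaussianReal_apply _ one_ne_zero,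
    ← lintegral_const_mul _ (by fun_prop)]
  refine setLIntegral_mono' hC fun x hx => ?_
  rw [gaussianPDF, gaussianPDF, ← ENNReal.ofReal_mul (Real.exp_nonneg _)]
  refine ENNReal.ofReal_le_ofReal ?_
  rw [gaussianPDFReal, gaussianPDFReal, mul_left_comm, ← Real.exp_add]
  refine mul_le_mul_of_nonneg_left (Real.exp_le_exp.2 ?_) (by positivity)
  have hx' : x ≤ lam + m := hCm hx
  have := mul_le_mul_of_nonneg_left hx' hl
  simp only [NNReal.coe_one, mul_one, sub_zero]
  nlinarith

variable {Ω : Type*} [MeasurableSpace Ω] {P : Measure Ω} [IsProbabilityMeasure P]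
  {ι : Type*} [Fintype ι] {Y : ι → Ω → ℝ}

/-- Cameron–Martin shift: adding `5m` times the covariances with `Y i` turns the event that all
coordinates are at most `m` into the event that the coordinate `i` is the largest, and multiplies
probabilities by at most `exp(18m²)`. -/
theorem measure_forall_abs_le_le (hY : HasGaussianLaw (fun ω i => Y i ω) P)
    (h0 : ∀ i, ∫ ω, Y i ω ∂P = 0) (h1 : ∀ i, ∫ ω, Y i ω * Y i ω ∂P = 1)
    (hcov : ∀ i j, i ≠ j → |∫ ω, Y i ω * Y j ω ∂P| ≤ 1 / 2) {m : ℝ} (hm : 0 < m) (i : ι) :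
    P {ω | ∀ j, |Y j ω| ≤ m}
      ≤ ENNReal.ofReal (Real.exp (18 * m ^ 2)) * P {ω | ∀ j, j ≠ i → Y j ω < Y i ω} := by
  -- The residuals `R j` of the regression on `Y i` are independent of `Y i`, so that only the law
  -- `N(0, 1)` of `Y i` has to be shifted.
  set c : ι → ℝ := fun j => ∫ ω, Y i ω * Y j ω ∂P with hc
  set R : ι → Ω → ℝ := fun j ω => Y j ω - c j * Y i ω with hR
  have hYi : ∀ j, HasGaussianLaw (Y j) P := fun j => hY.eval j
  have m2 : ∀ j, MemLp (Y j) 2 P := fun j => (hYi j).memLp_two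
  have i1 : ∀ j, Integrable (Y j) P := fun j => (hYi j).integrable
  have hR0 : ∀ j, MemLp (R j) 2 P := fun j => (m2 j).sub ((m2 i).const_mul _)
  have hRm : AEMeasurable (fun ω j => R j ω) P :=
    aemeasurable_pi_lambda _ fun j => (hR0 j).1.aemeasurable
  have hpair : HasGaussianLaw (fun ω => (fun _ : Unit => Y i ω, fun j => R j ω)) P := by
    let L : (ι → ℝ) →L[ℝ] (Unit → ℝ) × (ι → ℝ) :=
      (ContinuousLinearMap.pi fun _ => ContinuousLinearMap.proj i).prod
        (ContinuousLinearMap.pi fun j => ContinuousLinearMap.proj j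
          - c j • ContinuousLinearMap.proj i)
    exact hY.map_fun L
  have hind : IndepFun (Y i) (fun ω j => R j ω) P := by
    have h := hpair.indepFun_of_covariance_eval (X := fun _ : Unit => Y i) (Y := R) fun _ j => by
      rw [covariance_eq_sub (m2 i) (hR0 j), h0 i, zero_mul, sub_zero]
      have e : ∀ ω, (Y i * R j) ω = Y i ω * Y j ω - c j * (Y i ω * Y i ω) := fun ω => by
        simp only [Pi.mul_apply, hR]; ring
      simp_rw [e]
      have j1 : Integrable (fun ω => Y i ω * Y j ω) P := (m2 i).integrable_mul (m2 j)
      have j2 : Integrable (fun ω => c j * (Y i ω * Y i ω)) P :=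
        ((m2 i).integrable_mul (m2 i)).const_mul _
      rw [integral_sub j1 j2, integral_const_mul, h1 i, mul_one, sub_self]
    exact h.comp (φ := fun f : Unit → ℝ => f ()) (ψ := id) (measurable_pi_apply _) measurable_id
  have hlawY : P.map (Y i) = gaussianReal 0 1 := by
    rw [(hYi i).map_eq_gaussianReal, h0 i, variance_of_integral_eq_zero (hYi i).aemeasurable (h0 i)]
    have := h1 i
    simp_rw [← sq] at this
    rw [this, Real.toNNReal_one]
  have hlaw : P.map (fun ω => (Y i ω, fun j => R j ω))
      = (gaussianReal 0 1).prod (P.map fun ω j => R j ω) := by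
    rw [(indepFun_iff_map_prod_eq_prod_map_map (hYi i).aemeasurable hRm).1 hind, hlawY]
  have hpm : AEMeasurable (fun ω => (Y i ω, fun j => R j ω)) P := (hYi i).aemeasurable.prodMk hRm
  set B : Set (ℝ × (ι → ℝ)) := {z | (∀ j, j ≠ i → z.2 j + c j * z.1 < z.1) ∧ z.1 ≤ 5 * m + m}
  have hB : MeasurableSet B := by
    refine MeasurableSet.inter ?_ (measurableSet_le measurable_fst measurable_const)
    have e : {z : ℝ × (ι → ℝ) | ∀ j, j ≠ i → z.2 j + c j * z.1 < z.1}
        = ⋂ j, {z : ℝ × (ι → ℝ) | j ≠ i → z.2 j + c j * z.1 < z.1} := by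
      ext z
      simp only [mem_iInter, mem_ofPred_eq]
    change MeasurableSet {z : ℝ × (ι → ℝ) | ∀ j, j ≠ i → z.2 j + c j * z.1 < z.1}
    rw [e]
    refine MeasurableSet.iInter fun j => ?_
    by_cases hj : j = i
    · simp [hj]
    · simp only [ne_eq, hj, not_false_eq_true, forall_const]
      exact measurableSet_lt (by fun_prop) (by fun_prop)
  have hS : Measurable fun z : ℝ × (ι → ℝ) => (z.1 + 5 * m, z.2) := by fun_prop
  have hsub1 : {ω | ∀ j, |Y j ω| ≤ m}
      ⊆ (fun ω => (Y i ω, fun j => R j ω)) ⁻¹' ((fun z => (z.1 + 5 * m, z.2)) ⁻¹' B) := by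
    -- The shift raises the coordinate `i` by `5m` and the others by at most `5m/2`, a difference
    -- of more than `2m`.
    intro ω hω
    have hω' : ∀ j, |Y j ω| ≤ m := hω
    refine ⟨fun j hj => ?_, ?_⟩
    · have a := abs_le.1 (hω' i)
      have b := abs_le.1 (hω' j)
      have d := abs_le.1 (hcov i j hj.symm)
      have e : c j ≤ 1 / 2 := d.2
      simp only [hR]
      nlinarith
    · have a := abs_le.1 (hω' i)
      simp only
      linarith
  have hsub2 : (fun ω => (Y i ω, fun j => R j ω)) ⁻¹' B ⊆ {ω | ∀ j, j ≠ i → Y j ω < Y i ω} := by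
    intro ω hω j hj
    have := hω.1 j hj
    simp only [hR] at this
    linarith
  set ρ := P.map fun ω j => R j ω with hρ
  have hρp : IsProbabilityMeasure ρ := Measure.isProbabilityMeasure_map hRm
  calc P {ω | ∀ j, |Y j ω| ≤ m}
      ≤ ((gaussianReal 0 1).prod ρ) ((fun z => (z.1 + 5 * m, z.2)) ⁻¹' B) := by
        rw [← hlaw, Measure.map_apply_of_aemeasurable hpm (hS hB)]
        exact measure_mono hsub1
    _ = ∫⁻ y, gaussianReal (5 * m) 1 ((fun x => (x, y)) ⁻¹' B) ∂ρ := by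
        rw [Measure.prod_apply_symm (hS hB)]
        refine lintegral_congr fun y => ?_
        rw [← zero_add (5 * m), ← gaussianReal_map_add_const, Measure.map_apply (by fun_prop)
          (measurable_prodMk_right hB)]
        rw [zero_add]
        rfl
    _ ≤ ∫⁻ y, ENNReal.ofReal (Real.exp (18 * m ^ 2))
          * gaussianReal 0 1 ((fun x => (x, y)) ⁻¹' B) ∂ρ := by
        refine lintegral_mono fun y => ?_
        refine (gaussianReal_shift_le (m := m) (by positivity) (measurable_prodMk_right hB)
          fun x hx => hx.2).trans ?_
        gcongr
        nlinarith [sq_nonneg m]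
    _ = ENNReal.ofReal (Real.exp (18 * m ^ 2)) * ((gaussianReal 0 1).prod ρ) B := by
        rw [lintegral_const_mul _ (measurable_measure_prodMk_right hB),
          Measure.prod_apply_symm hB]
    _ ≤ _ := by
        rw [← hlaw, Measure.map_apply_of_aemeasurable hpm hB]
        exact mul_le_mul_right (measure_mono hsub2) _

/-- The maximum of `n` standard Gaussian variables with correlations at most `1/2` is at least of
order `√(log n)`, with probability at least `1/4`: the events that a given variable is the largest
are disjoint, so one of them has probability at most `1/n`. -/
theorem measure_forall_abs_le_sqrt_log_le (hY : HasGaussianLaw (fun ω i => Y i ω) P)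
    (h0 : ∀ i, ∫ ω, Y i ω ∂P = 0) (h1 : ∀ i, ∫ ω, Y i ω * Y i ω ∂P = 1)
    (hcov : ∀ i j, i ≠ j → |∫ ω, Y i ω * Y j ω ∂P| ≤ 1 / 2) (hcard : 2 ≤ Fintype.card ι) :
    P {ω | ∀ j, |Y j ω| ≤ √(Real.log (Fintype.card ι)) / 6} ≤ ENNReal.ofReal (3 / 4) := by
  set n := Fintype.card ι
  have hn : (2 : ℝ) ≤ n := by exact_mod_cast hcard
  have hlog : 0 < Real.log n := Real.log_pos (by linarith)
  set m := √(Real.log n) / 6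
  have hm : 0 < m := by positivity
  set q := P {ω | ∀ j, |Y j ω| ≤ m}
  have hq := fun i => measure_forall_abs_le_le hY h0 h1 hcov hm i
  have hsum : ∑ i, P {ω | ∀ j, j ≠ i → Y j ω < Y i ω} ≤ 1 := by
    have hYm : ∀ j, AEMeasurable (Y j) P := fun j => (hY.eval j).aemeasurable
    rw [← measure_univ (μ := P)]
    have key := tsum_meas_le_meas_iUnion_of_disjoint₀ P
      (As := fun i => {ω | ∀ j, j ≠ i → Y j ω < Y i ω}) (fun i => ?_) (fun i j hij => ?_)
    · rw [tsum_fintype] at key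
      exact key.trans (measure_mono (subset_univ _))
    · have : {ω | ∀ j, j ≠ i → Y j ω < Y i ω} = ⋂ j, {ω | j ≠ i → Y j ω < Y i ω} := by
        ext; simp only [mem_iInter, mem_ofPred_eq]
      rw [this]
      refine NullMeasurableSet.iInter fun j => ?_
      by_cases hj : j = i
      · simp [hj]
      · simp only [ne_eq, hj, not_false_eq_true, forall_const]
        exact nullMeasurableSet_lt (hYm j) (hYm i)
    · refine Disjoint.aedisjoint (disjoint_left.2 fun ω h1 h2 => ?_)
      exact lt_asymm (h1 j hij.symm) (h2 i hij)
  have hbound : (n : ℝ≥0∞) * q ≤ ENNReal.ofReal (Real.exp (18 * m ^ 2)) := by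
    calc (n : ℝ≥0∞) * q = ∑ _i : ι, q := by simp [n]
      _ ≤ ∑ i, ENNReal.ofReal (Real.exp (18 * m ^ 2)) * P {ω | ∀ j, j ≠ i → Y j ω < Y i ω} :=
          Finset.sum_le_sum fun i _ => hq i
      _ = ENNReal.ofReal (Real.exp (18 * m ^ 2)) * ∑ i, P {ω | ∀ j, j ≠ i → Y j ω < Y i ω} := by
          rw [Finset.mul_sum]
      _ ≤ ENNReal.ofReal (Real.exp (18 * m ^ 2)) * 1 := mul_le_mul_right hsum _
      _ = _ := mul_one _
  have hq1 : q ≠ ∞ := measure_ne_top _ _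
  have hexp : Real.exp (18 * m ^ 2) = √n := by
    have : 18 * m ^ 2 = Real.log n * (1 / 2) := by
      rw [div_pow, Real.sq_sqrt hlog.le]; ring
    rw [this, Real.exp_mul, Real.exp_log (by linarith), ← Real.sqrt_eq_rpow]
  have hreal : n * q.toReal ≤ √n := by
    have := ENNReal.toReal_mono ENNReal.ofReal_ne_top hbound
    rwa [ENNReal.toReal_mul, ENNReal.toReal_natCast, ENNReal.toReal_ofReal (Real.exp_nonneg _),
      hexp] at this
  rw [ENNReal.le_ofReal_iff_toReal_le hq1 (by norm_num)]
  have hs : √n * √n = n := Real.mul_self_sqrt (by linarith)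
  have hs2 : (4 / 3 : ℝ) ≤ √n := by
    rw [Real.le_sqrt (by norm_num) (by linarith)]
    norm_num
    linarith
  have hqn : 0 ≤ q.toReal := ENNReal.toReal_nonneg
  have hmul : √n * q.toReal ≤ 1 := by
    have hpos : 0 < √(n : ℝ) := by linarith
    refine le_of_mul_le_mul_left ?_ hpos
    rw [← mul_assoc, hs, mul_one]
    exact hreal
  nlinarith

end

/-! ### Increments of the field -/

section Increments

variable {N : ℕ} {E : Matrix (Fin N) (Fin N) ℝ} {ψ : Space N → ℝ}
  {Ω : Type*} [MeasurableSpace Ω] {P : Measure Ω}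
  {M : Set (Space N) → Ω → ℂ} {X : Space N → Ω → ℝ}

/-- Weighted increments of a Gaussian process form a Gaussian process. -/
theorem isGaussianProcess_increments {T ι : Type*} {X : T → Ω → ℝ} (hX : IsGaussianProcess X P)
    (a : ι → ℝ) (f g : ι → T) :
    IsGaussianProcess (fun i ω => a i * (X (f i) ω - X (g i) ω)) P := by
  classical
  refine hX.of_isGaussianProcess fun i => ⟨{f i, g i},
    a i • (ContinuousLinearMap.proj ⟨f i, by simp⟩ - ContinuousLinearMap.proj ⟨g i, by simp⟩),
    fun ω => ?_⟩
  simp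

variable [IsProbabilityMeasure P]

theorem IsHarmonizableField.integral_increment (hψ : IsAdmissible E ψ)
    (hM : IsGaussianRandomMeasure P M) (hX : IsHarmonizableField P E ψ M X) (a : ℝ)
    (s t : Space N) : ∫ ω, a * (X s ω - X t ω) ∂P = 0 := by
  obtain ⟨hG, h0, -⟩ := hX.gaussian hψ hM
  have hi : ∀ t, Integrable (X t) P := fun t => (hG.hasGaussianLaw_eval t).integrable
  rw [integral_const_mul, integral_sub (hi s) (hi t), h0, h0, sub_zero, mul_zero]

theorem IsHarmonizableField.integral_increment_mul (hψ : IsAdmissible E ψ)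
    (hM : IsGaussianRandomMeasure P M) (hX : IsHarmonizableField P E ψ M X) (a a' : ℝ)
    (s t s' t' : Space N) :
    ∫ ω, (a * (X s ω - X t ω)) * (a' * (X s' ω - X t' ω)) ∂P
      = a * a' * ∫ ξ, ⟪kernel E ψ s ξ - kernel E ψ t ξ, kernel E ψ s' ξ - kernel E ψ t' ξ⟫ := by
  obtain ⟨hG, h0, hcov⟩ := hX.gaussian hψ hM
  have h2 : ∀ t, MemLp (X t) 2 P := fun t => (hG.hasGaussianLaw_eval t).memLp_two
  have hi : ∀ s t, Integrable (fun ω => X s ω * X t ω) P := fun s t =>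
    (h2 s).integrable_mul (h2 t)
  have hk : ∀ s t, Integrable fun ξ => ⟪kernel E ψ s ξ, kernel E ψ t ξ⟫ := fun s t =>
    (L2.integrable_inner (𝕜 := ℝ) ((hX.memLp_kernel hψ s).toLp _)
      ((hX.memLp_kernel hψ t).toLp _)).congr (by
        filter_upwards [(hX.memLp_kernel hψ s).coeFn_toLp, (hX.memLp_kernel hψ t).coeFn_toLp]
          with ξ h1 h2
        rw [h1, h2])
  have i1 : ∀ s t u, Integrable (fun ω => X s ω * X u ω - X t ω * X u ω) P := fun s t u =>
    (hi s u).sub (hi t u)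
  have i2 : ∀ s t u, Integrable fun ξ =>
      ⟪kernel E ψ s ξ, kernel E ψ u ξ⟫ - ⟪kernel E ψ t ξ, kernel E ψ u ξ⟫ := fun s t u =>
    (hk s u).sub (hk t u)
  have e1 : ∀ ω, (a * (X s ω - X t ω)) * (a' * (X s' ω - X t' ω))
      = a * a' * ((X s ω * X s' ω - X t ω * X s' ω) - (X s ω * X t' ω - X t ω * X t' ω)) :=
    fun ω => by ring
  simp_rw [e1, inner_sub_right, inner_sub_left]
  rw [integral_const_mul, integral_sub (i1 _ _ _) (i1 _ _ _), integral_sub (hi _ _) (hi _ _),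
    integral_sub (hi _ _) (hi _ _), integral_sub (i2 _ _ _) (i2 _ _ _),
    integral_sub (hk _ _) (hk _ _), integral_sub (hk _ _) (hk _ _), hcov, hcov, hcov, hcov]

theorem IsHarmonizableField.hasGaussianIncrements (hψ : IsAdmissible E ψ)
    (hM : IsGaussianRandomMeasure P M) (hX : IsHarmonizableField P E ψ M X) :
    HasGaussianIncrements X (fun s t => sd E ψ (s - t)) P where
  gaussian s t := by
    have := (isGaussianProcess_increments (hX.gaussian hψ hM).1 (fun _ : Unit => 1) (fun _ => s)
      (fun _ => t)).hasGaussianLaw_eval ()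
    simpa using this
  centered s t := by simpa using hX.integral_increment hψ hM 1 s t
  variance s t := by
    have := hX.integral_increment_mul hψ hM 1 1 s t s t
    simp only [one_mul, ← sq] at this
    rw [this, sd_sq (fun t => hX.memLp_kernel hψ t), one_pow, one_mul]
    refine integral_congr_ae (ae_of_all _ fun ξ => ?_)
    simp only
    rw [real_inner_self_eq_norm_sq, kernel_sub_kernel, norm_mul, norm_exp_I_mul, one_mul]
  nonneg s t := sd_nonneg _

end Increments

/-! ### Nets of polynomial size -/

section Nets

variable {N : ℕ} {E : Matrix (Fin N) (Fin N) ℝ} {ψ : Space N → ℝ}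

theorem norm_le_of_forall_abs_le {x : Space N} {δ : ℝ} (hδ : 0 ≤ δ) (h : ∀ i, |x i| ≤ δ) :
    ‖x‖ ≤ N * δ := by
  refine abs_le_of_sq_le_sq' ?_ (by positivity) |>.2
  rw [EuclideanSpace.norm_sq_eq]
  calc ∑ i, ‖x i‖ ^ 2 ≤ ∑ _i : Fin N, δ ^ 2 :=
        Finset.sum_le_sum fun i _ => pow_le_pow_left₀ (norm_nonneg _) (h i) 2
    _ = N * δ ^ 2 := by simp
    _ ≤ (N : ℝ) ^ 2 * δ ^ 2 := by
        refine mul_le_mul_of_nonneg_right ?_ (sq_nonneg _)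
        exact_mod_cast Nat.le_self_pow two_ne_zero N
    _ = _ := by ring

/-- The points of the grid `q⁻¹ ℤ^N` whose coordinates are at most `R` in absolute value. -/
def grid (N R q : ℕ) : Finset (Space N) :=
  (Fintype.piFinset fun _ : Fin N => Finset.Icc (-(R * q : ℤ)) (R * q)).image
    fun k => WithLp.toLp 2 fun i => (k i : ℝ) / q

theorem card_grid_le {R q : ℕ} (hR : 1 ≤ R) (hq : 1 ≤ q) : (grid N R q).card ≤ (3 * R * q) ^ N := by
  refine Finset.card_image_le.trans ?_
  rw [Fintype.card_piFinset, Finset.prod_const, Finset.card_univ, Fintype.card_fin, Int.card_Icc]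
  refine Nat.pow_le_pow_left ?_ N
  have : 1 ≤ R * q := Nat.mul_le_mul hR hq
  zify at this ⊢
  rw [Int.toNat_of_nonneg (by linarith)]
  linarith

theorem exists_mem_grid {R q : ℕ} (hq : 1 ≤ q) {t : Space N} (ht : ‖t‖ ≤ R) :
    ∃ g ∈ grid N R q, ‖t - g‖ ≤ N * (1 / q) := by
  have hq0 : (0 : ℝ) < q := by exact_mod_cast hq
  refine ⟨WithLp.toLp 2 fun i => (⌊t i * q⌋ : ℝ) / q,
    Finset.mem_image.2 ⟨fun i => ⌊t i * q⌋, Fintype.mem_piFinset.2 fun i => ?_, rfl⟩,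
    norm_le_of_forall_abs_le (by positivity) fun i => ?_⟩
  · have hti := abs_le.1 ((PiLp.norm_apply_le t i).trans ht)
    rw [Finset.mem_Icc]
    constructor
    · rw [Int.le_floor]
      push_cast
      nlinarith [hti.1]
    · rw [← Int.cast_le (R := ℝ)]
      refine (Int.floor_le _).trans ?_
      push_cast
      nlinarith [hti.2]
  · have h1 := Int.floor_le (t i * q)
    have h2 := Int.lt_floor_add_one (t i * q)
    have e : (t - WithLp.toLp 2 fun i => (⌊t i * q⌋ : ℝ) / q) i = (t i * q - ⌊t i * q⌋) / q := by
      simp only [PiLp.sub_apply]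
      field_simp
    rw [e, abs_div, abs_of_pos hq0, abs_of_nonneg (by linarith)]
    exact div_le_div_of_nonneg_right (by linarith) hq0.le

/-- Balls have nets of exponential size at the scales `2⁻ⁿ` of `σ`, by the Hölder bound. -/
theorem exists_nets (hψ : IsAdmissible E ψ) (hL : ∀ t, MemLp (kernel E ψ t) 2 volume)
    (p : PolarNorm E) {R : ℕ} (hR : 1 ≤ R) :
    ∃ A : ℝ, 1 ≤ A ∧ ∃ K : ℝ, ∃ G : ℕ → Finset (Space N), (∀ n, ((G n).card : ℝ) ≤ K * A ^ n) ∧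
      ∀ n t, ‖t‖ ≤ R → ∃ g ∈ G n, sd E ψ (t - g) ≤ (1 / 2) ^ n := by
  obtain ⟨b, hb, C, hC, h⟩ := exists_sd_pow_le hψ hL p
  obtain ⟨L, hLC⟩ := exists_nat_ge ((C + 1) * N + 1)
  have hN0 : (0 : ℝ) ≤ N := Nat.cast_nonneg _
  have hL1 : 1 ≤ L := by
    have : (1 : ℝ) ≤ L := by nlinarith
    exact_mod_cast this
  have hL0 : (0 : ℝ) < L := by exact_mod_cast hL1
  -- A mesh of order `2 ^ (-b n)` suffices, where `b` is the exponent of the Hölder bound.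
  refine ⟨(2 ^ b) ^ N, one_le_pow₀ (one_le_pow₀ one_le_two), (3 * R * L) ^ N,
    fun n => grid N R (L * (2 ^ b) ^ n), fun n => ?_, fun n t ht => ?_⟩
  · have := card_grid_le (N := N) hR (q := L * (2 ^ b) ^ n)
      (Nat.mul_le_mul hL1 (Nat.one_le_pow _ _ (by positivity)))
    calc ((grid N R (L * (2 ^ b) ^ n)).card : ℝ) ≤ ((3 * R * (L * (2 ^ b) ^ n)) ^ N : ℕ) := by
          exact_mod_cast this
      _ = _ := by
          push_cast
          rw [← pow_mul _ N n, mul_comm N n, pow_mul, ← mul_pow]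
          ring
  · obtain ⟨g, hg, hgt⟩ := exists_mem_grid (R := R) (q := L * (2 ^ b) ^ n)
      (Nat.mul_le_mul hL1 (Nat.one_le_pow _ _ (by positivity))) ht
    refine ⟨g, hg, ?_⟩
    push_cast at hgt
    have hB : (1 : ℝ) ≤ (2 ^ b) ^ n := one_le_pow₀ (one_le_pow₀ one_le_two)
    have hNL : (C + 1) * ((N : ℝ) * (1 / (L * (2 ^ b) ^ n))) ≤ 1 / (2 ^ b) ^ n := by
      rw [one_div, mul_inv, ← mul_assoc, ← mul_assoc, one_div]
      refine mul_le_of_le_one_left (by positivity) ?_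
      rw [← div_eq_mul_inv, div_le_one hL0]
      linarith
    have hx : 0 ≤ (N : ℝ) * (1 / (L * (2 ^ b) ^ n)) := by positivity
    have h1 : (1 : ℝ) / (2 ^ b) ^ n ≤ 1 := by
      rw [div_le_one (by positivity)]
      exact hB
    have h2 := h (t - g) (by nlinarith)
    refine (pow_le_pow_iff_left₀ (sd_nonneg _) (by positivity) (by omega : b ≠ 0)).1 ?_
    rw [← pow_mul, mul_comm n b, pow_mul, one_div_pow, one_div_pow]
    nlinarith

end Nets

/-! ### Upper bound for the modulus -/

section

variable {N : ℕ} {E : Matrix (Fin N) (Fin N) ℝ} {ψ : Space N → ℝ}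
  {Ω : Type*} [MeasurableSpace Ω] {P : Measure Ω} [IsProbabilityMeasure P]
  {M : Set (Space N) → Ω → ℂ} {X : Space N → Ω → ℝ}

theorem one_le_log' (x : ℝ) : 1 ≤ log' x := by
  rw [log', Real.le_log_iff_exp_le (lt_max_of_lt_right (Real.exp_pos 1))]
  exact le_max_right _ _

theorem log_le_log' {x : ℝ} (hx : 0 < x) : Real.log x ≤ log' x :=
  Real.log_le_log hx (le_max_left _ _)

theorem continuous_log' : Continuous log' := by
  unfold log'
  exact (continuous_id.max continuous_const).log
    fun x => (lt_max_of_lt_right (Real.exp_pos 1)).ne'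

/-- The normalization `τ √(log(1 + τ⁻¹))` of an increment. -/
def gauge (τ : ℝ) : ℝ := τ * √(log' (1 + τ⁻¹))

theorem gauge_pos {τ : ℝ} (hτ : 0 < τ) : 0 < gauge τ :=
  mul_pos hτ (Real.sqrt_pos.2 (one_pos.trans_le (one_le_log' _)))

theorem continuousAt_gauge {τ : ℝ} (hτ : 0 < τ) : ContinuousAt gauge τ :=
  continuousAt_id.mul ((continuous_log'.continuousAt.comp
    (continuousAt_const.add (continuousAt_inv₀ hτ.ne'))).sqrt)

theorem norm_le_of_mem_cube {t : Space N} (ht : t ∈ cube N) : ‖t‖ ≤ N := by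
  simpa using norm_le_of_forall_abs_le zero_le_one
    fun i => (abs_of_nonneg (ht i).1).trans_le (ht i).2

/-- Chaining over a countable separant, extended to the whole cube by separability. -/
theorem IsHarmonizableField.exists_chainGauge_bound (hψ : IsAdmissible E ψ) (p : PolarNorm E)
    (hM : IsGaussianRandomMeasure P M) (hX : IsHarmonizableField P E ψ M X)
    (hsep : IsSeparable P X) :
    ∃ C > 0, ∀ᵐ ω ∂P, ∀ᶠ n in atTop, ∀ s ∈ cube N, ∀ t ∈ cube N,
      sd E ψ (s - t) < (1 / 2) ^ n → |X s ω - X t ω| ≤ C * chainGauge n := by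
  have hL := fun t => hX.memLp_kernel hψ t
  obtain ⟨S, hS, hcl⟩ := hsep
  obtain ⟨A, hA, K, G, hG, hnet⟩ := exists_nets hψ hL p (R := N + 1) (by omega)
  set B : Set (Space N) := Metric.ball 0 (N + 1)
  obtain ⟨C, hC, hmod⟩ := (hX.hasGaussianIncrements hψ hM).exists_modulus
    (fun s t => by rw [← sd_neg, neg_sub])
    (fun s t u => by simpa using sd_add_le hψ hL (s - t) (t - u)) hA G hG (D := S ∩ B)
    (hS.mono inter_subset_left)
    (fun n t ht => hnet n t (by simpa using (mem_ball_zero_iff.1 ht.2).le))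
  refine ⟨C, hC, ?_⟩
  filter_upwards [hmod, hcl] with ω h1 h2
  filter_upwards [h1] with n hn s hs t ht hst
  by_contra! hlt
  have hB : ∀ t ∈ cube N, t ∈ B := fun t ht =>
    mem_ball_zero_iff.2 (by linarith [norm_le_of_mem_cube ht])
  have hsd := continuous_sd hψ hL p
  set U : Set ((Space N × ℝ) × (Space N × ℝ)) := {z | z.1.1 ∈ B ∧ z.2.1 ∈ B ∧
    sd E ψ (z.1.1 - z.2.1) < (1 / 2) ^ n ∧ C * chainGauge n < |z.1.2 - z.2.2|}
  have hU : IsOpen U := by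
    have o1 : IsOpen {z : (Space N × ℝ) × (Space N × ℝ) | z.1.1 ∈ B} :=
      Metric.isOpen_ball.preimage (by fun_prop)
    have o2 : IsOpen {z : (Space N × ℝ) × (Space N × ℝ) | z.2.1 ∈ B} :=
      Metric.isOpen_ball.preimage (by fun_prop)
    have o3 : IsOpen {z : (Space N × ℝ) × (Space N × ℝ) |
        sd E ψ (z.1.1 - z.2.1) < (1 / 2) ^ n} :=
      isOpen_lt (hsd.comp (by fun_prop)) continuous_const
    have o4 : IsOpen {z : (Space N × ℝ) × (Space N × ℝ) |
        C * chainGauge n < |z.1.2 - z.2.2|} := isOpen_lt continuous_const (by fun_prop)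
    exact o1.inter (o2.inter (o3.inter o4))
  have hmem : ((s, X s ω), (t, X t ω))
      ∈ closure (((fun s => (s, X s ω)) '' S) ×ˢ ((fun s => (s, X s ω)) '' S)) := by
    rw [closure_prod_eq]
    exact ⟨h2 s, h2 t⟩
  obtain ⟨z, ⟨hz1, hz2, hz3, hz4⟩, ⟨s', hs', hs''⟩, t', ht', ht''⟩ :=
    mem_closure_iff.1 hmem U hU ⟨hB s hs, hB t ht, hst, hlt⟩
  rw [← hs''] at hz1 hz3 hz4
  rw [← ht''] at hz2 hz3 hz4
  exact hz4.not_ge (hn s' ⟨hs', hz1⟩ t' ⟨ht', hz2⟩ hz3.le)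

/-- The dyadic gauge is comparable with `τ √(log(1 + τ⁻¹))` for `τ` of order `2⁻ⁿ`. -/
theorem chainGauge_le_gauge {c τ : ℝ} (hc : 1 / 2 ≤ c) (hτ : 0 < τ) {n : ℕ}
    (h1 : (1 / 2) ^ (n + 1) < 2 * c * τ) (h2 : 2 * c * τ ≤ (1 / 2) ^ n) :
    chainGauge n ≤ 8 * c * gauge τ := by
  have hlog := one_le_log' (1 + τ⁻¹)
  have hn : (n : ℝ) * Real.log 2 ≤ log' (1 + τ⁻¹) := by
    rw [← Real.log_pow]
    refine (Real.log_le_log (by positivity) ?_).trans (log_le_log' (by positivity))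
    have h3 : τ ≤ (1 / 2) ^ n := le_trans (by nlinarith) h2
    rw [one_div, inv_pow] at h3
    have := (le_inv_comm₀ hτ (by positivity)).1 h3
    linarith
  have hn' : (n : ℝ) + 1 ≤ 4 * log' (1 + τ⁻¹) := by
    have := Real.log_two_gt_d9
    have h0 : (0 : ℝ) ≤ n := Nat.cast_nonneg n
    nlinarith
  have hs : √((n : ℝ) + 1) ≤ 2 * √(log' (1 + τ⁻¹)) := by
    refine (Real.sqrt_le_sqrt hn').trans ?_
    rw [Real.sqrt_mul (by norm_num), show (4 : ℝ) = 2 ^ 2 by norm_num,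
      Real.sqrt_sq (by norm_num)]
  rw [pow_succ] at h1
  calc chainGauge n = (1 / 2) ^ n * √((n : ℝ) + 1) := rfl
    _ ≤ (4 * c * τ) * (2 * √(log' (1 + τ⁻¹))) :=
        mul_le_mul (by linarith) hs (Real.sqrt_nonneg _) (by positivity)
    _ = _ := by rw [gauge]; ring

/-- A function whose increments satisfy the dyadic bounds has a bounded modulus. -/
theorem eventually_modulus_le {c C : ℝ} {p : PolarNorm E} (hc : 1 / 2 ≤ c)
    (hστ : ∀ x, sd E ψ x ≤ c * p.tau x) (hC : 0 < C) {x : Space N → ℝ}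
    (h : ∀ᶠ n in atTop, ∀ s ∈ cube N, ∀ t ∈ cube N,
      sd E ψ (s - t) < (1 / 2) ^ n → |x s - x t| ≤ C * chainGauge n) :
    ∀ᶠ r in 𝓝[>] (0 : ℝ), modulus p.tau x r ≤ ENNReal.ofReal (C * (8 * c)) := by
  have hc0 : 0 < c := by linarith
  obtain ⟨n₀, hn₀⟩ := eventually_atTop.1 h
  have hr₀ : 0 < (1 / 2 : ℝ) ^ (n₀ + 1) / (2 * c) := by positivity
  filter_upwards [Ioo_mem_nhdsGT hr₀] with r hr
  refine iSup₂_le fun s hs => iSup₂_le fun t ht => iSup₂_le fun hst hτr => ?_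
  have hτ := p.tau_pos (sub_ne_zero.2 hst)
  set τ := p.tau (s - t)
  have hx : 0 < 2 * c * τ := by positivity
  have hxr : 2 * c * τ < (1 / 2) ^ (n₀ + 1) := by
    have := (lt_div_iff₀ (by positivity)).1 (hτr.trans_lt hr.2)
    linarith
  obtain ⟨n, hn1, hn2⟩ := exists_nat_pow_near_of_lt_one hx
    (hxr.le.trans (pow_le_one₀ (by norm_num) (by norm_num))) (by norm_num : (0 : ℝ) < 1 / 2)
    (by norm_num)
  have hn : n₀ ≤ n := by
    have := (pow_lt_pow_iff_right_of_lt_one₀ (by norm_num : (0 : ℝ) < 1 / 2)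
      (by norm_num)).1 (hn1.trans hxr)
    omega
  refine ENNReal.ofReal_le_ofReal ?_
  change |x s - x t| / gauge τ ≤ _
  rw [div_le_iff₀ (gauge_pos hτ)]
  have h1 := hn₀ n hn s hs t ht (((hστ _).trans_lt (by nlinarith)).trans_le hn2)
  have h2 := mul_le_mul_of_nonneg_left (chainGauge_le_gauge hc hτ hn1 hn2) hC.le
  calc |x s - x t| ≤ C * chainGauge n := h1
    _ ≤ C * (8 * c * gauge τ) := h2
    _ = C * (8 * c) * gauge τ := by ring

theorem continuousOn_cube_of_chainGauge_bound {C : ℝ} (hsd : Continuous (sd E ψ))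
    {x : Space N → ℝ} (h : ∀ᶠ n in atTop, ∀ s ∈ cube N, ∀ t ∈ cube N,
      sd E ψ (s - t) < (1 / 2) ^ n → |x s - x t| ≤ C * chainGauge n) :
    ContinuousOn x (cube N) := by
  intro t ht
  rw [ContinuousWithinAt, Metric.tendsto_nhds]
  intro ε hε
  have hg : Tendsto (fun n => C * chainGauge n) atTop (𝓝 0) := by
    simpa using tendsto_chainGauge.const_mul C
  obtain ⟨n, hn, hnε⟩ := (h.and (hg.eventually_lt_const hε)).exists
  have h1 : Tendsto (fun s => sd E ψ (s - t)) (𝓝[cube N] t) (𝓝 0) := by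
    have : Tendsto (fun s => sd E ψ (s - t)) (𝓝 t) (𝓝 (sd E ψ (t - t))) :=
      (hsd.comp (continuous_id.sub continuous_const)).tendsto t
    rw [sub_self, sd_zero] at this
    exact this.mono_left nhdsWithin_le_nhds
  filter_upwards [h1.eventually_lt_const (by positivity : (0 : ℝ) < (1 / 2) ^ n),
    self_mem_nhdsWithin] with s hs hsc
  exact (hn s hsc t ht hs).trans_lt hnε

end

/-! ### The limit of the modulus is a constant determined by the covariance -/

section

variable {N : ℕ} {E : Matrix (Fin N) (Fin N) ℝ} {ψ : Space N → ℝ}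

/-- Ordered pairs of distinct points of `D`. -/
abbrev Pairs (D : Set (Space N)) : Type :=
  {q : Space N × Space N // (q.1 ∈ D ∧ q.2 ∈ D) ∧ q.1 ≠ q.2}

theorem countable_pairs {D : Set (Space N)} (hD : D.Countable) : Countable (Pairs D) := by
  have h : {q : Space N × Space N | (q.1 ∈ D ∧ q.2 ∈ D) ∧ q.1 ≠ q.2}.Countable :=
    (hD.prod hD).mono fun _ hq => hq.1
  exact h.to_subtype

/-- The normalized increment of a path over a pair of points. -/
def ratio {D : Set (Space N)} (p : PolarNorm E) (x : Space N → ℝ) (q : Pairs D) : ℝ :=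
  (gauge (p.tau (q.1.1 - q.1.2)))⁻¹ * (x q.1.1 - x q.1.2)

/-- The pairs at `τ`-distance at most `1 / (k + 1)`. -/
def smallPairs (p : PolarNorm E) (D : Set (Space N)) (k : ℕ) : Set (Pairs D) :=
  {q | p.tau (q.1.1 - q.1.2) ≤ 1 / (k + 1)}

theorem antitone_smallPairs (p : PolarNorm E) (D : Set (Space N)) : Antitone (smallPairs p D) := by
  intro k l h q hq
  simp only [smallPairs, mem_ofPred_eq] at hq ⊢
  exact hq.trans (Nat.one_div_le_one_div h)

theorem enorm_ratio {D : Set (Space N)} (p : PolarNorm E) (x : Space N → ℝ) (q : Pairs D) :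
    ‖ratio p x q‖ₑ
      = ENNReal.ofReal (|x q.1.1 - x q.1.2| / gauge (p.tau (q.1.1 - q.1.2))) := by
  rw [Real.enorm_eq_ofReal_abs, ratio, abs_mul, abs_inv,
    abs_of_pos (gauge_pos (p.tau_pos (sub_ne_zero.2 q.2.2))), div_eq_inv_mul]

/-- For a continuous path the modulus may be computed on a dense set of points, up to an
arbitrarily small increase of the radius. -/
theorem modulus_le_iSup_smallPairs (p : PolarNorm E) {D : Set (Space N)}
    (hDc : D ⊆ cube N) (hcD : cube N ⊆ closure D) {x : Space N → ℝ}
    (hx : ContinuousOn x (cube N)) {k : ℕ} {r : ℝ} (hr : r < 1 / (k + 1)) :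
    modulus p.tau x r ≤ ⨆ q ∈ smallPairs p D k, ‖ratio p x q‖ₑ := by
  refine iSup₂_le fun s hs => iSup₂_le fun t ht => iSup₂_le fun hst hτr => ?_
  have hst0 : s - t ≠ 0 := sub_ne_zero.2 hst
  have hF : (𝓝[D] s ×ˢ 𝓝[D] t).NeBot := by
    have h1 := mem_closure_iff_nhdsWithin_neBot.1 (hcD hs)
    have h2 := mem_closure_iff_nhdsWithin_neBot.1 (hcD ht)
    infer_instance
  have h1 : Tendsto Prod.fst (𝓝[D] s ×ˢ 𝓝[D] t) (𝓝[D] s) := tendsto_fst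
  have h2 : Tendsto Prod.snd (𝓝[D] s ×ˢ 𝓝[D] t) (𝓝[D] t) := tendsto_snd
  have hsub : Tendsto (fun z : Space N × Space N => z.1 - z.2) (𝓝[D] s ×ˢ 𝓝[D] t) (𝓝 (s - t)) :=
    (h1.mono_right nhdsWithin_le_nhds).sub (h2.mono_right nhdsWithin_le_nhds)
  have hτ := (p.continuousAt_tau hst0).tendsto.comp hsub
  have hxs := ((hx s hs).mono_left (nhdsWithin_mono s hDc)).comp h1
  have hxt := ((hx t ht).mono_left (nhdsWithin_mono t hDc)).comp h2
  have hgp := gauge_pos (p.tau_pos hst0)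
  have hlim := ENNReal.tendsto_ofReal (((hxs.sub hxt).abs).div
    ((continuousAt_gauge (p.tau_pos hst0)).tendsto.comp hτ) hgp.ne')
  refine le_of_tendsto hlim ?_
  filter_upwards [hτ.eventually_lt_const (hτr.trans_lt hr), hsub.eventually_ne hst0,
    h1.eventually self_mem_nhdsWithin, h2.eventually self_mem_nhdsWithin] with z hz1 hz2 hz3 hz4
  let q : Pairs D := ⟨z, ⟨hz3, hz4⟩, sub_ne_zero.1 hz2⟩
  exact (enorm_ratio p x q).ge.trans
    (le_iSup₂ (f := fun q (_ : q ∈ smallPairs p D k) => ‖ratio p x q‖ₑ) q hz1.le)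

theorem iSup_smallPairs_le_modulus (p : PolarNorm E) {D : Set (Space N)} (hDc : D ⊆ cube N)
    (x : Space N → ℝ) {k : ℕ} {r : ℝ} (hr : 1 / (k + 1) ≤ r) :
    ⨆ q ∈ smallPairs p D k, ‖ratio p x q‖ₑ ≤ modulus p.tau x r := by
  refine iSup₂_le fun q hq => ?_
  rw [enorm_ratio]
  refine le_iSup₂_of_le q.1.1 (hDc q.2.1.1) ?_
  refine le_iSup₂_of_le q.1.2 (hDc q.2.1.2) ?_
  exact le_iSup₂_of_le q.2.2 (le_trans hq hr) le_rfl

theorem tendsto_modulus (p : PolarNorm E) {D : Set (Space N)}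
    (hDc : D ⊆ cube N) (hcD : cube N ⊆ closure D) {x : Space N → ℝ}
    (hx : ContinuousOn x (cube N)) {c : ℝ≥0∞}
    (hc : ⨅ k, ⨆ q ∈ smallPairs p D k, ‖ratio p x q‖ₑ = c) :
    Tendsto (modulus p.tau x) (𝓝[>] 0) (𝓝 c) := by
  rw [tendsto_order]
  refine ⟨fun a ha => ?_, fun a ha => ?_⟩
  · filter_upwards [self_mem_nhdsWithin] with r hr
    obtain ⟨k, hk⟩ := exists_nat_one_div_lt (mem_Ioi.1 hr)
    refine ha.trans_le ((hc.ge.trans (iInf_le _ k)).trans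
      (iSup_smallPairs_le_modulus p hDc x hk.le))
  · rw [← hc] at ha
    obtain ⟨k, hk⟩ := iInf_lt_iff.1 ha
    filter_upwards [Ioo_mem_nhdsGT (Nat.one_div_pos_of_nat (α := ℝ) (n := k))] with r hr
    exact (modulus_le_iSup_smallPairs p hDc hcD hx hr.2).trans_lt hk

variable {Ω : Type*} [MeasurableSpace Ω] {P : Measure Ω} [IsProbabilityMeasure P]
  {M : Set (Space N) → Ω → ℂ} {X : Space N → Ω → ℝ} {D : Set (Space N)}

theorem integral_abs_le_of_integral_sq_le {Y : Ω → ℝ} (hY : MemLp Y 2 P) {a : ℝ} (ha : 0 < a)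
    (h : ∫ ω, Y ω ^ 2 ∂P ≤ a ^ 2) : ∫ ω, |Y ω| ∂P ≤ a := by
  have h1 : ∀ ω, |Y ω| ≤ a / 2 + (2 * a)⁻¹ * Y ω ^ 2 := fun ω => by
    have := sq_nonneg (|Y ω| - a)
    rw [← sq_abs (Y ω)]
    field_simp
    nlinarith
  have i2 : Integrable (fun ω => (2 * a)⁻¹ * Y ω ^ 2) P := hY.integrable_sq.const_mul _
  calc ∫ ω, |Y ω| ∂P ≤ ∫ ω, (a / 2 + (2 * a)⁻¹ * Y ω ^ 2) ∂P :=
        integral_mono (hY.integrable one_le_two).abs ((integrable_const _).add i2) h1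
    _ = a / 2 + (2 * a)⁻¹ * ∫ ω, Y ω ^ 2 ∂P := by
        rw [integral_add (integrable_const _) i2, integral_const_mul]
        simp
    _ ≤ a / 2 + (2 * a)⁻¹ * a ^ 2 := by gcongr
    _ = a := by field_simp; ring

theorem IsHarmonizableField.isGaussianProcess_ratio (hψ : IsAdmissible E ψ) (p : PolarNorm E)
    (hM : IsGaussianRandomMeasure P M) (hX : IsHarmonizableField P E ψ M X) :
    IsGaussianProcess (fun (q : Pairs D) ω => ratio p (fun t => X t ω) q) P :=
  isGaussianProcess_increments (hX.gaussian hψ hM).1 _ _ _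

/-- The law of the normalized increments depends on the covariance of the field only. -/
theorem IsHarmonizableField.map_ratio_eq (hψ : IsAdmissible E ψ) (p : PolarNorm E)
    (hM : IsGaussianRandomMeasure P M) (hX : IsHarmonizableField P E ψ M X)
    {Ω' : Type*} [MeasurableSpace Ω'] {P' : Measure Ω'} [IsProbabilityMeasure P']
    {M' : Set (Space N) → Ω' → ℂ} {X' : Space N → Ω' → ℝ}
    (hM' : IsGaussianRandomMeasure P' M') (hX' : IsHarmonizableField P' E ψ M' X')
    (hD : D.Countable) :
    P.map (fun ω (q : Pairs D) => ratio p (fun t => X t ω) q)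
      = P'.map (fun ω (q : Pairs D) => ratio p (fun t => X' t ω) q) := by
  have hcount := countable_pairs hD
  refine map_eq_of_covariance_eq (hX.isGaussianProcess_ratio hψ p hM)
    (hX'.isGaussianProcess_ratio hψ p hM') (fun q => hX.integral_increment hψ hM _ _ _)
    (fun q => hX'.integral_increment hψ hM' _ _ _) fun q q' => ?_
  exact (hX.integral_increment_mul hψ hM _ _ _ _ _ _).trans
    (hX'.integral_increment_mul hψ hM' _ _ _ _ _ _).symm

/-- The normalized increments over small distances have small variance, because of the logarithmic
factor; hence the limit of their suprema is almost surely constant. -/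
theorem IsHarmonizableField.exists_ae_iInf_iSup_ratio_eq (hψ : IsAdmissible E ψ)
    (p : PolarNorm E) (hM : IsGaussianRandomMeasure P M) (hX : IsHarmonizableField P E ψ M X)
    (hD : D.Countable) :
    ∃ c : ℝ≥0∞, ∀ᵐ y ∂P.map (fun ω (q : Pairs D) => ratio p (fun t => X t ω) q),
      ⨅ k, ⨆ q ∈ smallPairs p D k, ‖y q‖ₑ = c := by
  have hcount := countable_pairs hD
  have hL := fun t => hX.memLp_kernel hψ t
  obtain ⟨C, hC, hστ⟩ := exists_sd_le_tau hψ hL p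
  have hG := hX.isGaussianProcess_ratio (D := D) hψ p hM
  set Y : Ω → Pairs D → ℝ := fun ω q => ratio p (fun t => X t ω) q
  have hYm : AEMeasurable Y P := aemeasurable_pi_lambda _ fun q => hG.aemeasurable q
  have hν : IsProbabilityMeasure (P.map Y) := Measure.isProbabilityMeasure_map hYm
  have hGν : IsGaussianProcess (fun (q : Pairs D) (y : Pairs D → ℝ) => y q) (P.map Y) := by
    refine ⟨fun I => ⟨?_⟩⟩
    have hI : Measurable fun y : Pairs D → ℝ => I.restrict (fun q => y q) := by fun_prop
    rw [AEMeasurable.map_map_of_aemeasurable hI.aemeasurable hYm]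
    exact (hG.hasGaussianLaw I).isGaussian_map
  refine exists_ae_iInf_iSup_eq hGν (fun q => ?_) (antitone_smallPairs p D)
    (s := fun k => C / √(log' (1 + (k + 1)))) (fun k => by positivity) (fun k q hq => ?_) ?_
  · rw [integral_map hYm (measurable_pi_apply q).aestronglyMeasurable]
    exact hX.integral_increment hψ hM _ _ _
  · rw [integral_map hYm (measurable_pi_apply q).abs.aestronglyMeasurable]
    have hτ := p.tau_pos (sub_ne_zero.2 q.2.2)
    have hlogk : 0 < log' (1 + ((k : ℝ) + 1)) := one_pos.trans_le (one_le_log' _)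
    have hlogτ : 0 < log' (1 + (p.tau (q.1.1 - q.1.2))⁻¹) := one_pos.trans_le (one_le_log' _)
    refine integral_abs_le_of_integral_sq_le (hG.hasGaussianLaw_eval q).memLp_two
      (by positivity) ?_
    have hvar := (hX.hasGaussianIncrements hψ hM).variance q.1.1 q.1.2
    simp only [ratio, mul_pow]
    rw [integral_const_mul, hvar, ← mul_pow]
    refine pow_le_pow_left₀ (mul_nonneg (inv_nonneg.2 (gauge_pos hτ).le) (sd_nonneg _)) ?_ 2
    rw [← div_eq_inv_mul, div_le_div_iff₀ (gauge_pos hτ) (Real.sqrt_pos.2 hlogk), gauge,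
      ← mul_assoc]
    refine mul_le_mul (hστ _) (Real.sqrt_le_sqrt ?_) (Real.sqrt_nonneg _) (by positivity)
    have hq' : p.tau (q.1.1 - q.1.2) ≤ 1 / ((k : ℝ) + 1) := hq
    rw [one_div] at hq'
    have := (le_inv_comm₀ hτ (by positivity)).1 hq'
    refine Real.log_le_log (lt_max_of_lt_right (Real.exp_pos 1)) ?_
    gcongr
  · refine Tendsto.const_div_atTop (Real.tendsto_sqrt_atTop.comp ?_) C
    have h1 : Tendsto (fun k : ℕ => 1 + ((k : ℝ) + 1)) atTop atTop :=
      tendsto_atTop_add_const_left _ _ (tendsto_atTop_add_const_right _ _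
        tendsto_natCast_atTop_atTop)
    exact tendsto_atTop_mono (fun k => log_le_log' (by positivity))
      (Real.tendsto_log_atTop.comp h1)

end

/-! ### Lower bound for the modulus -/

section

variable {N : ℕ} {E : Matrix (Fin N) (Fin N) ℝ} {ψ : Space N → ℝ}

/-- The points `(r, …, r) + j √r e` of an arithmetic progression in the first coordinate
direction. -/
def progression (i₀ : Fin N) (r : ℝ) (j : ℕ) : Space N :=
  WithLp.toLp 2 fun i => r + if i = i₀ then j * √r else 0

theorem progression_apply (i₀ : Fin N) (r : ℝ) (j : ℕ) (i : Fin N) :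
    progression i₀ r j i = r + if i = i₀ then j * √r else 0 := rfl

theorem progression_sub (i₀ : Fin N) (r : ℝ) (j k : ℕ) :
    progression i₀ r j - progression i₀ r k
      = EuclideanSpace.single i₀ (((j : ℝ) - k) * √r) := by
  ext i
  by_cases h : i = i₀ <;> simp [progression_apply, h, sub_mul]

theorem progression_add_mem_cube {i₀ : Fin N} {r : ℝ} {j : ℕ} {h : Space N}
    (hr : 4 * r ≤ 1) (hj : 2 * (j * √r) ≤ 1) (hh : ‖h‖ ≤ r) :
    progression i₀ r j + h ∈ cube N := by
  intro i
  have h1 := abs_le.1 ((PiLp.norm_apply_le h i).trans hh)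
  have h2 : 0 ≤ j * √r := by positivity
  rw [PiLp.add_apply, progression_apply]
  split_ifs <;> constructor <;> linarith [h1.1, h1.2]

theorem log'_one_add_inv_le {τ : ℝ} (hτ : 0 < τ) {m : ℕ} (hm : 1 + 4 / τ ≤ m) (hm3 : 3 ≤ m) :
    log' (1 + (1 / (4 * (m : ℝ) ^ 2) * τ)⁻¹) ≤ 3 * Real.log m := by
  have hm3' : (3 : ℝ) ≤ m := by exact_mod_cast hm3
  have hm0 : (0 : ℝ) < m := by linarith
  rw [log', show 3 * Real.log m = Real.log ((m : ℝ) ^ 3) by rw [Real.log_pow]; norm_num]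
  refine Real.log_le_log (lt_max_of_lt_right (Real.exp_pos 1)) (max_le ?_ ?_)
  · have e : (1 / (4 * (m : ℝ) ^ 2) * τ)⁻¹ = 4 / τ * (m : ℝ) ^ 2 := by field_simp
    rw [e]
    have h4 : 0 < 4 / τ := by positivity
    have h1 : (1 : ℝ) ≤ (m : ℝ) ^ 2 := one_le_pow₀ (by linarith)
    calc 1 + 4 / τ * (m : ℝ) ^ 2 ≤ (1 + 4 / τ) * (m : ℝ) ^ 2 := by nlinarith
      _ ≤ m * (m : ℝ) ^ 2 := by gcongr
      _ = _ := by ring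
  · have := Real.exp_one_lt_d9
    have h2 : (m : ℝ) ^ 1 ≤ (m : ℝ) ^ 3 := pow_le_pow_right₀ (by linarith) (by norm_num)
    rw [pow_one] at h2
    linarith

variable {Ω : Type*} [MeasurableSpace Ω] {P : Measure Ω} [IsProbabilityMeasure P]
  {M : Set (Space N) → Ω → ℂ} {X : Space N → Ω → ℝ}

/-- A sequence of events that almost surely eventually occur has probabilities close to one. -/
theorem exists_lt_measure_of_ae_eventually {B : ℕ → Set Ω} (h : ∀ᵐ ω ∂P, ∀ᶠ n in atTop, ω ∈ B n)
    {a : ℝ≥0∞} (ha : a < 1) : ∀ᶠ n in atTop, a < P (B n) := by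
  set A : ℕ → Set Ω := fun k => {ω | ∀ n ≥ k, ω ∈ B n}
  have hA : Monotone A := fun k l hkl ω hω n hn => hω n (hkl.trans hn)
  have hU : P (⋃ k, A k) = 1 := by
    rw [measure_congr (eventuallyEq_univ.2 ?_), measure_univ]
    filter_upwards [h] with ω hω
    exact mem_iUnion.2 (eventually_atTop.1 hω)
  have := tendsto_measure_iUnion_atTop (μ := P) hA
  rw [hU] at this
  filter_upwards [this.eventually_const_lt ha] with n hn
  exact hn.trans_le (measure_mono fun ω hω => hω n le_rfl)

/-- Increments along many well separated parallel segments are weakly correlated, and the largest of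
them exceeds a fixed multiple of its normalization with probability at least `1/4`. -/
theorem IsHarmonizableField.exists_le_modulus (hN : 1 ≤ N) (hψ : IsAdmissible E ψ)
    (p : PolarNorm E) (hM : IsGaussianRandomMeasure P M) (hX : IsHarmonizableField P E ψ M X) :
    ∃ c > 0, ∃ r : ℕ → ℝ, Tendsto r atTop (𝓝[>] 0) ∧ ∀ᶠ m in atTop,
      P {ω | modulus p.tau (fun t => X t ω) (r m) ≤ ENNReal.ofReal c} ≤ ENNReal.ofReal (3 / 4) := by
  have hL := fun t => hX.memLp_kernel hψ t
  obtain ⟨x, hx, hact⟩ := exists_norm_powAct_le hN hψ hL p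
  obtain ⟨r₀, hr₀, hcorr⟩ := exists_correlation_le hψ hL hx
  obtain ⟨c, hc, hτσ⟩ := exists_tau_le_sd hψ hL p
  have hτx := p.tau_pos hx
  -- For `r = 1 / (4 m²)`, `m` points at mutual distances at least `√r = 1 / (2 m)` fit into the
  -- cube.
  have hr : Tendsto (fun m : ℕ => 1 / (4 * (m : ℝ) ^ 2)) atTop (𝓝[>] 0) := by
    refine tendsto_nhdsWithin_iff.2 ⟨?_, ?_⟩
    · refine Tendsto.const_div_atTop ?_ 1
      exact (((tendsto_pow_atTop two_ne_zero).comp tendsto_natCast_atTop_atTop).const_mul_atTop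
        (by norm_num))
    · filter_upwards [eventually_gt_atTop 0] with m hm
      have : (0 : ℝ) < m := by exact_mod_cast hm
      exact mem_Ioi.2 (by positivity)
  have hr' := tendsto_nhdsWithin_iff.1 hr
  refine ⟨c / 12, by positivity, fun m => 1 / (4 * (m : ℝ) ^ 2) * p.tau x,
    tendsto_nhdsWithin_iff.2 ⟨by simpa using hr'.1.mul_const (p.tau x), ?_⟩, ?_⟩
  · filter_upwards [hr'.2] with m hm
    exact mul_pos hm hτx
  filter_upwards [hr'.1.eventually_lt_const hr₀, eventually_ge_atTop 3,
    (tendsto_natCast_atTop_atTop (R := ℝ)).eventually_ge_atTop (1 + 4 / p.tau x)]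
    with m hmr hm3 hmτ
  have hm3' : (3 : ℝ) ≤ m := by exact_mod_cast hm3
  have hm0 : (0 : ℝ) < m := by linarith
  have hlogm : 0 < Real.log m := Real.log_pos (by linarith)
  have hlog := log'_one_add_inv_le hτx hmτ hm3
  set r : ℝ := 1 / (4 * (m : ℝ) ^ 2) with hrdef
  have hrpos : 0 < r := by positivity
  have hsq : √r = 1 / (2 * m) := by
    rw [hrdef, show 1 / (4 * (m : ℝ) ^ 2) = (1 / (2 * m)) ^ 2 by field_simp; norm_num,
      Real.sqrt_sq (by positivity)]
  have hr4 : 4 * r ≤ 1 := by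
    rw [hrdef]
    have : (1 : ℝ) ≤ (m : ℝ) ^ 2 := one_le_pow₀ (by linarith)
    field_simp
    linarith
  set h : Space N := powAct E r x with hh
  have hh0 : h ≠ 0 := powAct_ne_zero E r hx
  have hhn : ‖h‖ ≤ r := hact r hrpos (by linarith)
  have hτh : p.tau h = r * p.tau x := p.tau_powAct hx hrpos
  have hτh0 := p.tau_pos hh0
  have hσ := sd_pos hψ hL hh0
  set i₀ : Fin N := ⟨0, hN⟩
  set u : Fin m → Space N := fun j => progression i₀ r j
  have hj : ∀ j : Fin m, 2 * ((j : ℕ) * √r) ≤ 1 := fun j => by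
    have : ((j : ℕ) : ℝ) ≤ m := by exact_mod_cast j.2.le
    rw [hsq]
    field_simp
    linarith
  have hu : ∀ j, u j ∈ cube N := fun j => by
    simpa using progression_add_mem_cube (i₀ := i₀) (h := 0) hr4 (hj j) (by simpa using hrpos.le)
  have huh : ∀ j, u j + h ∈ cube N := fun j => progression_add_mem_cube hr4 (hj j) hhn
  set Y : Fin m → Ω → ℝ := fun j ω => (sd E ψ h)⁻¹ * (X (u j + h) ω - X (u j) ω)
  have hcovY : ∀ j k, ∫ ω, Y j ω * Y k ω ∂P = (sd E ψ h)⁻¹ * (sd E ψ h)⁻¹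
      * ∫ ξ, ‖kernel E ψ h ξ‖ ^ 2 * Real.cos ⟪u j - u k, ξ⟫ := fun j k => by
    rw [hX.integral_increment_mul hψ hM]
    simp_rw [inner_increments]
  have hmax := measure_forall_abs_le_sqrt_log_le (P := P) (Y := Y)
    ?_ (fun j => hX.integral_increment hψ hM _ _ _) (fun j => ?_) (fun j k hjk => ?_)
    (by simpa using (by omega : 2 ≤ m))
  rotate_left
  · have := (isGaussianProcess_increments (hX.gaussian hψ hM).1 (fun _ : Fin m => (sd E ψ h)⁻¹)
      (fun j => u j + h) u).hasGaussianLaw Finset.univ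
    let L : (↥(Finset.univ : Finset (Fin m)) → ℝ) →L[ℝ] (Fin m → ℝ) :=
      ContinuousLinearMap.pi fun j => ContinuousLinearMap.proj ⟨j, Finset.mem_univ j⟩
    exact this.map_fun L
  · rw [hcovY, sub_self]
    simp only [inner_zero_left, Real.cos_zero, mul_one]
    rw [← sd_sq hL]
    field_simp
  · rw [hcovY, abs_mul, abs_of_pos (by positivity)]
    have hjk' : (1 : ℝ) ≤ |((j : ℕ) : ℝ) - (k : ℕ)| := by
      have : (1 : ℤ) ≤ |((j : ℕ) : ℤ) - (k : ℕ)| := by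
        exact Int.one_le_abs fun h0 => hjk (Fin.ext (by omega))
      exact_mod_cast this
    have hjk2 : |((j : ℕ) : ℝ) - (k : ℕ)| ≤ m := by
      have : |((j : ℕ) : ℤ) - (k : ℕ)| ≤ m := by
        rw [abs_le]
        omega
      exact_mod_cast this
    have hnorm : ‖u j - u k‖ = |((j : ℕ) : ℝ) - (k : ℕ)| * √r := by
      rw [progression_sub, PiLp.norm_single, Real.norm_eq_abs, abs_mul,
        abs_of_nonneg (Real.sqrt_nonneg r)]
    have := hcorr r hrpos hmr (u j - u k) (by rw [hnorm]; nlinarith [Real.sqrt_nonneg r]) (by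
      rw [hnorm, hsq]
      calc |((j : ℕ) : ℝ) - (k : ℕ)| * (1 / (2 * m)) ≤ m * (1 / (2 * m)) := by gcongr
        _ ≤ 1 := by field_simp; norm_num)
    calc _ ≤ (sd E ψ h)⁻¹ * (sd E ψ h)⁻¹ * (sd E ψ h ^ 2 / 2) := by gcongr
      _ = 1 / 2 := by field_simp
  refine (measure_mono fun ω hω => ?_).trans hmax
  intro j
  have hω' : modulus p.tau (fun t => X t ω) (r * p.tau x) ≤ ENNReal.ofReal (c / 12) := hω
  have h1 : ENNReal.ofReal (|X (u j + h) ω - X (u j) ω| / gauge (p.tau h))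
      ≤ ENNReal.ofReal (c / 12) := by
    refine le_trans ?_ hω'
    refine le_iSup₂_of_le (u j + h) (huh j) (le_iSup₂_of_le (u j) (hu j)
      (le_iSup₂_of_le (by simpa using hh0) (by rw [add_sub_cancel_left, hτh]) ?_))
    rw [add_sub_cancel_left]
    exact le_rfl
  rw [ENNReal.ofReal_le_ofReal_iff (by positivity), div_le_iff₀ (gauge_pos hτh0)] at h1
  have hg : gauge (p.tau h) ≤ p.tau h * (2 * √(Real.log m)) := by
    refine mul_le_mul_of_nonneg_left ?_ hτh0.le
    rw [hτh, show 2 * √(Real.log m) = √(4 * Real.log m) by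
      rw [Real.sqrt_mul (by norm_num), show (4 : ℝ) = 2 ^ 2 by norm_num,
        Real.sqrt_sq (by norm_num)]]
    exact Real.sqrt_le_sqrt (hlog.trans (by linarith))
  simp only [Y, Fintype.card_fin]
  rw [abs_mul, abs_of_pos (by positivity), inv_mul_le_iff₀ hσ]
  have h0 := Real.sqrt_nonneg (Real.log m)
  calc _ ≤ c / 12 * gauge (p.tau h) := h1
    _ ≤ c / 12 * (p.tau h * (2 * √(Real.log m))) := by gcongr
    _ = c * p.tau h * (√(Real.log m) / 6) := by ring
    _ ≤ _ := by
      have := hτσ h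
      gcongr

end

/-! ### The exact modulus of continuity -/

section

variable {N : ℕ} {E : Matrix (Fin N) (Fin N) ℝ} {ψ : Space N → ℝ}

/-- If the suprema of the normalized increments over a countable dense set converge to `c` almost
surely, then so does the modulus, and `c` is positive and finite. -/
theorem IsHarmonizableField.ae_tendsto_modulus {Ω : Type*} [MeasurableSpace Ω] {P : Measure Ω}
    [IsProbabilityMeasure P] {M : Set (Space N) → Ω → ℂ} {X : Space N → Ω → ℝ}
    {D : Set (Space N)} (hN : 1 ≤ N) (hψ : IsAdmissible E ψ) (p : PolarNorm E)
    (hM : IsGaussianRandomMeasure P M) (hX : IsHarmonizableField P E ψ M X)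
    (hsep : IsSeparable P X) (hDc : D ⊆ cube N) (hcD : cube N ⊆ closure D) {c : ℝ≥0∞}
    (hc : ∀ᵐ ω ∂P, ⨅ k, ⨆ q ∈ smallPairs p D k, ‖ratio p (fun t => X t ω) q‖ₑ = c) :
    0 < c ∧ c < ∞ ∧
      ∀ᵐ ω ∂P, Tendsto (modulus p.tau fun t => X t ω) (𝓝[>] 0) (𝓝 c) := by
  have hL := fun t => hX.memLp_kernel hψ t
  obtain ⟨C, hC, hbound⟩ := hX.exists_chainGauge_bound hψ p hM hsep
  have hlim : ∀ᵐ ω ∂P, Tendsto (modulus p.tau fun t => X t ω) (𝓝[>] 0) (𝓝 c) := by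
    filter_upwards [hbound, hc] with ω h1 h2
    exact tendsto_modulus p hDc hcD
      (continuousOn_cube_of_chainGauge_bound (continuous_sd hψ hL p) h1) h2
  refine ⟨?_, ?_, hlim⟩
  · obtain ⟨a, ha, r, hr, hprob⟩ := hX.exists_le_modulus hN hψ p hM
    by_contra hc0
    have hev : ∀ᵐ ω ∂P, ∀ᶠ m in atTop,
        ω ∈ {ω | modulus p.tau (fun t => X t ω) (r m) ≤ ENNReal.ofReal a} := by
      filter_upwards [hlim] with ω hω
      have hca : c < ENNReal.ofReal a := by
        rw [nonpos_iff_eq_zero.1 (not_lt.1 hc0)]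
        exact ENNReal.ofReal_pos.2 ha
      filter_upwards [(hω.comp hr).eventually_lt_const hca] with m hm
      exact hm.le
    have h34 : ENNReal.ofReal (3 / 4) < 1 := by
      rw [ENNReal.ofReal_lt_one]; norm_num
    obtain ⟨m, hm1, hm2⟩ := (hprob.and (exists_lt_measure_of_ae_eventually hev h34)).exists
    exact hm2.not_ge hm1
  · obtain ⟨C', hC', hστ⟩ := exists_sd_le_tau hψ hL p
    obtain ⟨ω, h1, h2⟩ := (hbound.and hlim).exists
    refine (le_of_tendsto h2 (eventually_modulus_le (c := max C' (1 / 2)) (le_max_right _ _)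
      (fun x => (hστ x).trans ?_) hC h1)).trans_lt ENNReal.ofReal_lt_top
    exact mul_le_mul_of_nonneg_right (le_max_left _ _) (p.tau_nonneg x)

theorem exists_modulus_limit (hN : 1 ≤ N) (p : PolarNorm E) (hψ : IsAdmissible E ψ) :
    ∃ C₆ : ℝ, 0 < C₆ ∧
      ∀ (Ω : Type*) [MeasurableSpace Ω] (P : Measure Ω) [IsProbabilityMeasure P]
        (M : Set (Space N) → Ω → ℂ) (X : Space N → Ω → ℝ),
        IsGaussianRandomMeasure P M → IsHarmonizableField P E ψ M X → IsSeparable P X →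
        ∀ᵐ ω ∂P, Tendsto (fun r : ℝ => modulus p.tau (fun t => X t ω) r)
          (𝓝[>] 0) (𝓝 (ENNReal.ofReal C₆)) := by
  obtain ⟨D, hDc, hD, hcD⟩ :=
    (TopologicalSpace.IsSeparable.of_separableSpace (cube N)).exists_countable_dense_subset
  by_cases hex : ∃ (Ω : Type _) (_ : MeasurableSpace Ω) (P : Measure Ω)
      (_ : IsProbabilityMeasure P) (M : Set (Space N) → Ω → ℂ) (X : Space N → Ω → ℝ),
      IsGaussianRandomMeasure P M ∧ IsHarmonizableField P E ψ M X ∧ IsSeparable P X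
  · obtain ⟨Ω₀, _, P₀, _, M₀, X₀, hM₀, hX₀, hsep₀⟩ := hex
    obtain ⟨c, hc⟩ := hX₀.exists_ae_iInf_iSup_ratio_eq (D := D) hψ p hM₀ hD
    have hcount := countable_pairs hD
    -- The constant found on one probability space works on all others: only the law of the
    -- normalized increments matters.
    have key : ∀ (Ω : Type _) [MeasurableSpace Ω] (P : Measure Ω) [IsProbabilityMeasure P]
        (M : Set (Space N) → Ω → ℂ) (X : Space N → Ω → ℝ), IsGaussianRandomMeasure P M →
        IsHarmonizableField P E ψ M X → IsSeparable P X → 0 < c ∧ c < ∞ ∧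
        ∀ᵐ ω ∂P, Tendsto (modulus p.tau fun t => X t ω) (𝓝[>] 0) (𝓝 c) := by
      intro Ω _ P _ M X hM hX hsep
      rw [hX₀.map_ratio_eq hψ p hM₀ hM hX hD] at hc
      exact hX.ae_tendsto_modulus hN hψ p hM hsep hDc hcD (ae_of_ae_map
        (aemeasurable_pi_lambda _ fun q => (hX.isGaussianProcess_ratio hψ p hM).aemeasurable q) hc)
    obtain ⟨h0, h1, -⟩ := key Ω₀ P₀ M₀ X₀ hM₀ hX₀ hsep₀
    refine ⟨c.toReal, ENNReal.toReal_pos h0.ne' h1.ne, fun Ω _ P _ M X hM hX hsep => ?_⟩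
    rw [ENNReal.ofReal_toReal h1.ne]
    exact (key Ω P M X hM hX hsep).2.2
  -- Without any such field the constant is not constrained.
  · exact ⟨1, one_pos, fun Ω _ P _ M X hM hX hsep =>
      (hex ⟨Ω, _, P, ‹_›, M, X, hM, hX, hsep⟩).elim⟩

end

end OperatorScaling

end

theorem theorem4p1 (N : ℕ) (hN : 1 ≤ N) (E : Matrix (Fin N) (Fin N) ℝ)
    (hE : OperatorScaling.EigenvaluesGtOne E) (p : OperatorScaling.PolarNorm E)
    (ψ : OperatorScaling.Space N → ℝ) (hψ : OperatorScaling.IsAdmissible E ψ) :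
    ∃ C₆ : ℝ, 0 < C₆ ∧
      ∀ (Ω : Type*) [MeasurableSpace Ω] (P : Measure Ω) [IsProbabilityMeasure P]
        (M : Set (OperatorScaling.Space N) → Ω → ℂ) (X : OperatorScaling.Space N → Ω → ℝ),
        OperatorScaling.IsGaussianRandomMeasure P M →
        OperatorScaling.IsHarmonizableField P E ψ M X →
        OperatorScaling.IsSeparable P X →
        ∀ᵐ ω ∂P, Tendsto (fun r : ℝ => OperatorScaling.modulus p.tau (fun t => X t ω) r)
          (𝓝[>] 0) (𝓝 (ENNReal.ofReal C₆)) :=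
  OperatorScaling.exists_modulus_limit hN p hψ
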